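/- **Setting.** Let $(\Omega,\mathcal G,\mu)$ be a probability space with a group $(\tau_x)_{x\in\mathbb R}$ of measure preserving transformations acting ergodically on $\Omega$, such that $(x,\omega)\mapsto\tau_x\omega$ is measurable; $\mathbb M$ is the expectation under $\mu$ and $L^p(\Omega)$ are the real $L^p$-spaces of $\mu$, with norms $|\cdot|_p$. Let $T_x f(\omega)=f(\tau_x\omega)$ and let $D f=\lim_{h\to0}h^{-1}(T_hf-f)$ (limit in $L^2(\Omega)$) be the generator of $(T_x)$ on $L^2(\Omega)$. Let $H^k(\Omega)=\mathrm{Dom}(D^k)$ (so $H^0=L^2$), let $H^\infty(\Omega)=\bigcap_kH^k(\Omega)$, with the Fréchet topology of the seminorms $|D^kf|_2$, $k\ge0$, and let $C^\infty(\Omega)$ be the set of $f\in H^\infty(\Omega)$ with $|D^kf|_\infty<\infty$ for all $k\ge0$. Let $\mathcal C$ be the span of the functions $\omega\mapsto\int_{\mathbb R}g(\tau_x\omega)\varphi(x)\,dx$ with $g\in L^\infty(\Omega)$, $\varphi\in C_c^\infty(\mathbb R)$. Let $0<\alpha<2$ and $\nu(dz)=|z|^{-1-\alpha}dz$. Let $V,\sigma\in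 C^\infty(\Omega)$, $a=\sigma^2$, and let $c:\Omega\times\mathbb R\to\mathbb R$ be measurable, such that * $c(\tau_z\omega,-z)=c(\omega,z)$ for $\mu$-a.e. $\omega$ and a.e. $z$; * for some $K>0$, $K^{-1}\le a\le K$ and $K^{-1}\le c(\omega,z)\le K$ for a.e. $\omega$ and a.e. $z$; * for a.e. $z$, $c(\cdot,z)\in C^\infty(\Omega)$, and for every $k\ge1$ there is $C_k$ with $|D^kc(\cdot,z)|_\infty\le C_k$ for a.e. $z$. Put $(f,g)_\pi=\mathbb M[fg\,e^{-2V}]$, $|f|_\pi=(f,f)_\pi^{1/2}$. For $\varepsilon,\lambda>0$ put $$B^\varepsilon_\lambda(f,g)=\lambda(f,g)_\pi+\tfrac12(a\,Df,Dg)_\pi+\tfrac{\varepsilon^{2-\alpha}}2\,\mathbb M\int_{\mathbb R}(T_zf-f)(T_zg-g)\,c(\cdot,z)\,\nu(dz),$$ and let $\mathbb H\subset H^1(\Omega)$ be the closure of $\mathcal C$ for the norm $B^\varepsilon_\lambda(f,f)^{1/2}$. For $f\in L^2(\Omega)$ let $G^\varepsilon_\lambda f$ be the element $u\in\mathbb H$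 such that $B^\varepsilon_\lambda(u,\psi)=(f,\psi)_\pi$ for all $\psi\in\mathbb H$, and let $L^\varepsilon=\lambda-(G^\varepsilon_\lambda)^{-1}$ with domain $\mathrm{Dom}(L^\varepsilon)=G^\varepsilon_\lambda(L^2(\Omega))$. **Proposition.** Fix $\varepsilon>0$. For each $\lambda>0$ the operator $G^\varepsilon_\lambda$ is well defined (such a $u$ exists and is unique) and one-to-one, and the following holds, with $L^\varepsilon$ formed from any $\lambda>0$. 1. For each $\lambda>0$, $G^\varepsilon_\lambda$ maps $L^2(\Omega)$ into $H^2(\Omega)$, and $H^m(\Omega)$ into $H^{m+2}(\Omega)$ for every $m\ge1$. In particular $\mathrm{Dom}((L^\varepsilon)^m)=H^{2m}(\Omega)$ for every $m\ge0$. 2. $L^\varepsilon$ is densely defined and self-adjoint for $(\cdot,\cdot)_\pi$, and it is the generator of a strongly continuous semigroup $(P^\varepsilon_t)_{t\ge0}$ of operators on $L^2(\Omega)$ that are self-adjoint for $(\cdot,\cdot)_\pi$ and contractions for $|\cdot|_\pi$. For $f\in L^2(\Omega)$, the map $t\mapsto P^\varepsilon_tf$ belongs to $C([0,\infty);L^2(\Omega))\cap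 C^\infty((0,\infty);H^\infty(\Omega))$; for $f\in H^\infty(\Omega)$ it belongs to $C^\infty([0,\infty);H^\infty(\Omega))$. 3. The semigroup is sub-Markovian: if $f\in L^2(\Omega)$ and $0\le f\le1$ $\mu$-a.s., then $0\le P^\varepsilon_tf\le1$ $\mu$-a.s. for every $t\ge0$. Moreover, for every $t\ge0$ and $\lambda>0$, $P^\varepsilon_t$ and $G^\varepsilon_\lambda$ map $L^\infty(\Omega)$ into $L^\infty(\Omega)$ and are bounded operators there, with norms exactly $1$ and $1/\lambda$ respectively. -/

import Mathlib

open MeasureTheory Filter Topology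

noncomputable section

/-- The domain of the power `A ^ k` of an unbounded operator `A` with domain `dom`
(the values of `A` off `dom` play no role):
`Dom (A ^ 0)` is everything and
`Dom (A ^ (k + 1)) = {x ∈ Dom (A ^ k) | A ^ k x ∈ dom}`. -/
def powDomain {X : Type*} (dom : Set X) (A : X → X) : ℕ → Set X
  | 0 => Set.univ
  | k + 1 => {x | x ∈ powDomain dom A k ∧ A^[k] x ∈ dom}

/-- A random medium: a probability space together with a jointly measurable group
`(τ_x)`, `x ∈ ℝ`, of measure preserving transformations acting ergodically. -/
structure RandomMedium (Ω : Type*) [MeasurableSpace Ω] where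
  μ : Measure Ω
  isProbabilityMeasure : IsProbabilityMeasure μ
  τ : ℝ → Ω → Ω
  τ_zero : ∀ ω, τ 0 ω = ω
  τ_add : ∀ x y ω, τ (x + y) ω = τ x (τ y ω)
  measurePreserving : ∀ x, MeasurePreserving (τ x) μ μ
  ergodic : ∀ A, MeasurableSet A → (∀ x, τ x '' A = A) → μ A = 0 ∨ μ A = 1
  measurable_τ : Measurable fun p : ℝ × Ω => τ p.1 p.2

attribute [instance] RandomMedium.isProbabilityMeasure

namespace RandomMedium

variable {Ω : Type*} [MeasurableSpace Ω] (M : RandomMedium Ω)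

/-- The real space `L²(Ω)`. -/
abbrev L2 : Type _ := Lp ℝ 2 M.μ

/-- `T_x f (ω) = f (τ_x ω)` on `L²(Ω)`. -/
def T (x : ℝ) (f : M.L2) : M.L2 :=
  Lp.compMeasurePreserving (M.τ x) (M.measurePreserving x) f

/-- The domain of the generator `D` of the group `(T_x)`. -/
def domD : Set M.L2 :=
  {f | ∃ g : M.L2, Tendsto (fun h : ℝ => h⁻¹ • (M.T h f - f)) (𝓝[≠] 0) (𝓝 g)}

/-- The generator `D f = lim_{h → 0} h⁻¹ (T_h f - f)`, the limit being taken in `L²(Ω)`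
(meaningful for `f ∈ domD`). -/
def D (f : M.L2) : M.L2 :=
  limUnder (𝓝[≠] (0 : ℝ)) (fun h : ℝ => h⁻¹ • (M.T h f - f))

/-- `H^k(Ω)`, the domain of `D ^ k`. -/
def H (k : ℕ) : Set M.L2 := powDomain M.domD M.D k

/-- `H^∞(Ω)`. -/
def Hinf : Set M.L2 := {f | ∀ k, f ∈ M.H k}

/-- `g` coincides almost everywhere with an element `f` of `H^k(Ω)` such that `|D^k f|_∞ ≤ C`. -/
def DerivBoundedBy (g : Ω → ℝ) (k : ℕ) (C : ℝ) : Prop :=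
  ∃ f : M.L2, f =ᵐ[M.μ] g ∧ f ∈ M.H k ∧ ∀ᵐ ω ∂M.μ, |(M.D^[k] f : M.L2) ω| ≤ C

/-- `g` belongs to `C^∞(Ω)`: it lies in `H^∞(Ω)` and `|D^k g|_∞ < ∞` for all `k ≥ 0`. -/
def MemCinf (g : Ω → ℝ) : Prop :=
  ∃ f : M.L2, f =ᵐ[M.μ] g ∧ f ∈ M.Hinf ∧
    ∀ k, ∃ C : ℝ, ∀ᵐ ω ∂M.μ, |(M.D^[k] f : M.L2) ω| ≤ C

/-- The space `𝒞`, spanned by the functions `g ⋆ φ (ω) = ∫ g (τ_x ω) φ(x) dx` with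
`g ∈ L^∞(Ω)` and `φ ∈ C_c^∞(ℝ)`. -/
def testSpace : Submodule ℝ M.L2 :=
  Submodule.span ℝ {f | ∃ (g : Ω → ℝ) (φ : ℝ → ℝ), MemLp g ⊤ M.μ ∧ ContDiff ℝ (⊤ : ℕ∞) φ ∧
    HasCompactSupport φ ∧ f =ᵐ[M.μ] fun ω => ∫ x, g (M.τ x ω) * φ x}

/-- `u ∈ C^∞(I; H^∞(Ω))`, where `H^∞(Ω)` carries its Fréchet topology, given by the seminorms
`f ↦ |D^k f|_2`, `k ≥ 0`: there are successive derivatives `v 0 = u, v 1, v 2, …` with values in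
`H^∞(Ω)`, each being the derivative on `I` of the preceding one for all these seminorms. -/
def SmoothOn (I : Set ℝ) (u : ℝ → M.L2) : Prop :=
  ∃ v : ℕ → ℝ → M.L2, (∀ t ∈ I, v 0 t = u t) ∧
    ∀ n, ∀ t ∈ I, v n t ∈ M.Hinf ∧
      ∀ k, HasDerivWithinAt (fun s => M.D^[k] (v n s)) (M.D^[k] (v (n + 1) t)) I t

/-- A strongly continuous semigroup `(P_t)`, `t ≥ 0`, of bounded operators on `L²(Ω)`
(the values `P t` for `t < 0` play no role). -/
structure IsSemigroup (P : ℝ → M.L2 →L[ℝ] M.L2) : Prop where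
  zero : ∀ f, P 0 f = f
  add : ∀ s t, 0 ≤ s → 0 ≤ t → ∀ f, P (s + t) f = P s (P t f)
  continuousOn : ∀ f, ContinuousOn (fun t => P t f) (Set.Ici 0)

end RandomMedium

/-- The measure `ν(dz) = |z|^{-1-α} dz`. -/
def levyMeasure (α : ℝ) : Measure ℝ :=
  volume.withDensity fun z => ENNReal.ofReal (1 / |z| ^ (1 + α))

/-- The coefficients `V`, `σ`, `c` and the index `α` entering the Dirichlet form, with their
symmetry, ellipticity and regularity assumptions. -/
structure Coefficients {Ω : Type*} [MeasurableSpace Ω] (M : RandomMedium Ω) where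
  α : ℝ
  α_pos : 0 < α
  α_lt : α < 2
  V : Ω → ℝ
  σ : Ω → ℝ
  c : Ω → ℝ → ℝ
  measurable_c : Measurable fun p : Ω × ℝ => c p.1 p.2
  symm : ∀ᵐ ω ∂M.μ, ∀ᵐ z : ℝ, c (M.τ z ω) (-z) = c ω z
  elliptic : ∃ K : ℝ, 0 < K ∧ (∀ᵐ ω ∂M.μ, K⁻¹ ≤ σ ω ^ 2 ∧ σ ω ^ 2 ≤ K) ∧
    ∀ᵐ ω ∂M.μ, ∀ᵐ z : ℝ, K⁻¹ ≤ c ω z ∧ c ω z ≤ K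
  smooth_V : M.MemCinf V
  smooth_σ : M.MemCinf σ
  smooth_c : ∀ᵐ z : ℝ, M.MemCinf fun ω => c ω z
  smooth_c_bound : ∀ k, 1 ≤ k → ∃ C : ℝ, ∀ᵐ z : ℝ, M.DerivBoundedBy (fun ω => c ω z) k C

namespace Coefficients

variable {Ω : Type*} [MeasurableSpace Ω] {M : RandomMedium Ω} (A : Coefficients M)

/-- `(f, g)_π = 𝕄[f g e^{-2V}]`. -/
def innerPi (f g : M.L2) : ℝ := ∫ ω, f ω * g ω * Real.exp (-2 * A.V ω) ∂M.μ

/-- `|f|_π`. -/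
def normPi (f : M.L2) : ℝ := Real.sqrt (A.innerPi f f)

/-- `B^d(f, g) = (1/2) (a Df, Dg)_π` with `a = σ²`, for `f, g ∈ Dom D`. -/
def Bd (f g : M.L2) : ℝ :=
  (1 / 2) * ∫ ω, A.σ ω ^ 2 * (M.D f) ω * (M.D g) ω * Real.exp (-2 * A.V ω) ∂M.μ

/-- `B^j(f, g) = (1/2) 𝕄 ∫ (T_z f - f)(T_z g - g) c(·, z) ν(dz)`. -/
def Bj (f g : M.L2) : ℝ :=
  (1 / 2) * ∫ ω, ∫ z, (f (M.τ z ω) - f ω) * (g (M.τ z ω) - g ω) * A.c ω z ∂(levyMeasure A.α) ∂M.μ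

/-- `B_λ^ε = λ (·, ·)_π + B^d + ε^{2 - α} B^j`, for functions in `Dom D`. -/
def B (ε lam : ℝ) (f g : M.L2) : ℝ :=
  lam * A.innerPi f g + A.Bd f g + ε ^ (2 - A.α) * A.Bj f g

/-- The space `ℍ`: the closure of `𝒞` in `Dom D` for the norm associated with `B_λ^ε`. -/
def formDomain (ε lam : ℝ) : Set M.L2 :=
  {f | f ∈ M.domD ∧ ∃ φ : ℕ → M.L2, (∀ n, φ n ∈ M.testSpace) ∧
    Tendsto (fun n => A.B ε lam (φ n - f) (φ n - f)) atTop (𝓝 0)}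

/-- `u ∈ ℍ` and `B_λ^ε(u, ψ) = (f, ψ)_π` for all `ψ ∈ ℍ`. -/
def IsResolventSolution (ε lam : ℝ) (f u : M.L2) : Prop :=
  u ∈ A.formDomain ε lam ∧ ∀ ψ ∈ A.formDomain ε lam, A.B ε lam u ψ = A.innerPi f ψ

/-- The resolvent operator `G_λ^ε`: `G_λ^ε f` is the `u ∈ ℍ` such that
`B_λ^ε(u, ψ) = (f, ψ)_π` for all `ψ ∈ ℍ`. -/
def G (ε lam : ℝ) (f : M.L2) : M.L2 :=
  Classical.epsilon fun u => A.IsResolventSolution ε lam f u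

/-- `Dom(L^ε) = G_λ^ε(L²(Ω))`. -/
def domL (ε lam : ℝ) : Set M.L2 := Set.range (A.G ε lam)

/-- `L^ε = λ - (G_λ^ε)⁻¹` (meaningful on `Dom(L^ε)`). -/
def L (ε lam : ℝ) (u : M.L2) : M.L2 := lam • u - Function.invFun (A.G ε lam) u

end Coefficients

end

/-! On the graph of `D` the form `B_λ^ε` is bounded and coercive, and `𝒞` is dense in that graph, so
`ℍ = H¹(Ω)` and Lax–Milgram produces `G_λ^ε`. Translating the equation solved by `u = G_λ^ε f` moves
only its coefficients: testing it against second differences of `u` bounds the difference quotients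
of `u` in `H¹(Ω)`, so `u ∈ H²(Ω)`, and `D u` solves an equation for the same form whose right-hand
side involves the derivatives of the coefficients. Induction gives `G_λ^ε(H^m(Ω)) ⊆ H^{m+2}(Ω)`,
hence `Dom((L^ε)^m) = H^{2m}(Ω)`.

Conjugation by `e^{-V}` makes the `G_λ^ε` a symmetric contraction resolvent on `L²(Ω)`. Its
semigroup is the limit of the exponentials of the Yosida approximations, and for `t > 0` it maps
everything into the domain of each power of the generator, because `⟨P_t x, x⟩` is completely
monotone in `t`; so `P_t^ε f ∈ H^∞(Ω)`. Since `B_λ^ε(|u|, |u|) ≤ B_λ^ε(u, u)`, the resolvent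
preserves positivity, and with `λ G_λ^ε 1 = 1` this yields the sub-Markov property and the `L^∞`
norms. -/

noncomputable section

/-- A one-parameter group of linear isometries of a real normed space. Strong continuity is a
separate assumption, `IsometryGroup.StronglyContinuous`: translations are not strongly continuous
on `L^∞`. -/
structure IsometryGroup (E : Type*) [NormedAddCommGroup E] [NormedSpace ℝ E] where
  toFun : ℝ → E →ₗᵢ[ℝ] E
  zero_apply' : ∀ f, toFun 0 f = f
  add_apply' : ∀ x y f, toFun (x + y) f = toFun x (toFun y f)

namespace IsometryGroup

section Generator

variable {E : Type*} [NormedAddCommGroup E] [NormedSpace ℝ E]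

instance : CoeFun (IsometryGroup E) fun _ => ℝ → E →ₗᵢ[ℝ] E := ⟨toFun⟩

/-- Strong continuity of a one-parameter group of isometries. -/
class StronglyContinuous (U : IsometryGroup E) : Prop where
  continuous_apply : ∀ f, Continuous fun x => U x f

variable (U : IsometryGroup E)

/-- `U.HasGen f g` says that `f` lies in the domain of the generator `D` of `U`, and that
`D f = g`. -/
def HasGen (f g : E) : Prop := HasDerivAt (fun x => U x f) g 0

@[simp] lemma zero_apply (f : E) : U 0 f = f := U.zero_apply' f

lemma add_apply (x y : ℝ) (f : E) : U (x + y) f = U x (U y f) := U.add_apply' x y f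

lemma apply_comm (x y : ℝ) (f : E) : U x (U y f) = U y (U x f) := by
  rw [← add_apply, ← add_apply, add_comm]

@[simp] lemma apply_neg_apply (x : ℝ) (f : E) : U x (U (-x) f) = f := by
  rw [← add_apply, add_neg_cancel, zero_apply]

lemma stronglyContinuous_of_tendsto (h : ∀ f, Tendsto (fun x => U x f) (𝓝 0) (𝓝 f)) :
    U.StronglyContinuous where
  continuous_apply f := continuous_iff_continuousAt.2 fun x => by
    have hsub : Tendsto (fun y : ℝ => y - x) (𝓝 x) (𝓝 0) := tendsto_sub_nhds_zero_iff.2 tendsto_id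
    refine (((U x).continuous.tendsto f).comp ((h f).comp hsub)).congr fun y => ?_
    rw [Function.comp_apply, Function.comp_apply, ← add_apply, add_sub_cancel]

variable {U}

lemma hasGen_iff_tendsto {f g : E} :
    U.HasGen f g ↔ Tendsto (fun x : ℝ => x⁻¹ • (U x f - f)) (𝓝[≠] 0) (𝓝 g) := by
  rw [HasGen, hasDerivAt_iff_tendsto_slope_zero]
  simp only [zero_add, zero_apply]

namespace HasGen

lemma unique {f g g' : E} (h : U.HasGen f g) (h' : U.HasGen f g') : g = g' :=
  HasDerivAt.unique h h'

lemma add {f g f' g' : E} (h : U.HasGen f g) (h' : U.HasGen f' g') :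
    U.HasGen (f + f') (g + g') := by
  simpa only [HasGen, map_add] using HasDerivAt.fun_add h h'

lemma const_smul {f g : E} (c : ℝ) (h : U.HasGen f g) : U.HasGen (c • f) (c • g) := by
  simpa only [HasGen, map_smul] using HasDerivAt.fun_const_smul c h

lemma zero : U.HasGen 0 0 := by
  simpa only [HasGen, map_zero] using hasDerivAt_const (0 : ℝ) (0 : E)

lemma map {F : Type*} [NormedAddCommGroup F] [NormedSpace ℝ F] {W : IsometryGroup F}
    (j : E →L[ℝ] F) (hj : ∀ x f, j (U x f) = W x (j f)) {f g : E} (h : U.HasGen f g) :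
    W.HasGen (j f) (j g) := by
  simpa only [HasGen, Function.comp_def, hj] using j.hasFDerivAt.comp_hasDerivAt (0 : ℝ) h

lemma apply {f g : E} (h : U.HasGen f g) (x : ℝ) : U.HasGen (U x f) (U x g) :=
  h.map (U x).toContinuousLinearMap fun y f => U.apply_comm x y f

lemma hasDerivAt {f g : E} (h : U.HasGen f g) (x : ℝ) : HasDerivAt (fun y => U y f) (U x g) x := by
  have htrans : HasDerivAt (fun y => U (y - x) (U x f)) (U x g) x :=
    HasDerivAt.comp_sub_const x x (by rw [sub_self]; exact h.apply x)
  simpa only [← add_apply, sub_add_cancel] using htrans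

lemma norm_apply_sub_le {f g : E} (h : U.HasGen f g) (x : ℝ) : ‖U x f - f‖ ≤ ‖g‖ * |x| := by
  have := convex_univ.norm_image_sub_le_of_norm_hasDerivWithin_le (x := 0) (y := x)
    (fun y _ => (h.hasDerivAt y).hasDerivWithinAt) (fun y _ => ((U y).norm_map g).le)
    (Set.mem_univ _) (Set.mem_univ _)
  simpa using this

lemma bilinear {F G : Type*} [NormedAddCommGroup F] [NormedSpace ℝ F] [NormedAddCommGroup G]
    [NormedSpace ℝ G] {W : IsometryGroup F} {Z : IsometryGroup G} {b : E →L[ℝ] F →L[ℝ] G}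
    (hb : ∀ x f g, Z x (b f g) = b (U x f) (W x g)) {f f' : E} {g g' : F}
    (hf : U.HasGen f f') (hg : W.HasGen g g') : Z.HasGen (b f g) (b f g' + b f' g) := by
  have h := (b.hasFDerivAt.comp_hasDerivAt (0 : ℝ) hf).clm_apply hg
  simpa only [HasGen, hb, zero_apply, Function.comp_apply, add_comm] using h

end HasGen

variable (U)

/-- The graph of the generator. -/
def genGraph : Submodule ℝ (E × E) where
  carrier := {p | U.HasGen p.1 p.2}
  add_mem' := HasGen.add
  zero_mem' := HasGen.zero
  smul_mem' := fun c _ h => HasGen.const_smul c h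

/-- The domain of the `k`-th power of the generator. -/
def domPow : ℕ → Submodule ℝ E
  | 0 => ⊤
  | k + 1 => (U.genGraph ⊓ (domPow k).comap (LinearMap.snd ℝ E E)).map (LinearMap.fst ℝ E E)

variable {U}

lemma HasGen.sub {f g f' g' : E} (h : U.HasGen f g) (h' : U.HasGen f' g') :
    U.HasGen (f - f') (g - g') :=
  U.genGraph.sub_mem (x := (f, g)) (y := (f', g')) h h'

lemma mem_domPow_zero (f : E) : f ∈ U.domPow 0 := Submodule.mem_top

lemma mem_domPow_succ {k : ℕ} {f : E} :
    f ∈ U.domPow (k + 1) ↔ ∃ g, U.HasGen f g ∧ g ∈ U.domPow k := by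
  simp [domPow, genGraph]

lemma HasGen.mem_domPow_succ {k : ℕ} {f g : E} (h : U.HasGen f g) (hg : g ∈ U.domPow k) :
    f ∈ U.domPow (k + 1) :=
  IsometryGroup.mem_domPow_succ.2 ⟨g, h, hg⟩

lemma HasGen.mem_domPow_of_succ {k : ℕ} {f g : E} (h : U.HasGen f g)
    (hf : f ∈ U.domPow (k + 1)) : g ∈ U.domPow k := by
  obtain ⟨g', h', hg'⟩ := IsometryGroup.mem_domPow_succ.1 hf
  rwa [h.unique h']

lemma domPow_succ_le (k : ℕ) : U.domPow (k + 1) ≤ U.domPow k := by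
  induction k with
  | zero => exact le_top
  | succ k ih =>
    intro f hf
    obtain ⟨g, hfg, hg⟩ := mem_domPow_succ.1 hf
    exact hfg.mem_domPow_succ (ih hg)

lemma domPow_antitone : Antitone U.domPow := antitone_nat_of_succ_le domPow_succ_le

lemma bilinear_mem_domPow {F G : Type*} [NormedAddCommGroup F] [NormedSpace ℝ F]
    [NormedAddCommGroup G] [NormedSpace ℝ G] {W : IsometryGroup F} {Z : IsometryGroup G}
    {b : E →L[ℝ] F →L[ℝ] G} (hb : ∀ x f g, Z x (b f g) = b (U x f) (W x g)) {k : ℕ} {f : E} {g : F}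
    (hf : f ∈ U.domPow k) (hg : g ∈ W.domPow k) : b f g ∈ Z.domPow k := by
  induction k generalizing f g with
  | zero => exact mem_domPow_zero _
  | succ k ih =>
    obtain ⟨f', hff', hf'⟩ := mem_domPow_succ.1 hf
    obtain ⟨g', hgg', hg'⟩ := mem_domPow_succ.1 hg
    exact (hff'.bilinear hb hgg').mem_domPow_succ
      (add_mem (ih (domPow_succ_le k hf) hg') (ih hf' (domPow_succ_le k hg)))

variable (U)

/-- The smooth vectors of the group: the intersection of the domains of the powers of the
generator. -/
def smooth : Submodule ℝ E := ⨅ k, U.domPow k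

variable {U}

lemma mem_smooth {f : E} : f ∈ U.smooth ↔ ∀ k, f ∈ U.domPow k := Submodule.mem_iInf _

lemma mem_smooth_of_hasGen_succ {f : ℕ → E} (h : ∀ k, U.HasGen (f k) (f (k + 1))) (n : ℕ) :
    f n ∈ U.smooth := by
  refine mem_smooth.2 fun k => ?_
  induction k generalizing n with
  | zero => exact mem_domPow_zero _
  | succ k ih => exact (h n).mem_domPow_succ (ih (n + 1))

lemma exists_hasGen_of_mem_smooth {f : E} (hf : f ∈ U.smooth) : ∃ g ∈ U.smooth, U.HasGen f g := by
  obtain ⟨g, hfg, -⟩ := mem_domPow_succ.1 (mem_smooth.1 hf 1)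
  exact ⟨g, mem_smooth.2 fun k => hfg.mem_domPow_of_succ (mem_smooth.1 hf (k + 1)), hfg⟩

variable (U) in
/-- The generator, meaningful on its domain. -/
def generator (f : E) : E := deriv (fun x => U x f) 0

lemma HasGen.generator_eq {f g : E} (h : U.HasGen f g) : U.generator f = g := HasDerivAt.deriv h

lemma generator_mem_smooth {f : E} (hf : f ∈ U.smooth) : U.generator f ∈ U.smooth := by
  obtain ⟨g, hg, hfg⟩ := exists_hasGen_of_mem_smooth hf
  rwa [hfg.generator_eq]

lemma iterate_generator_mem_smooth {f : E} (hf : f ∈ U.smooth) (k : ℕ) :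
    U.generator^[k] f ∈ U.smooth :=
  Set.MapsTo.iterate (fun _ => generator_mem_smooth) k hf

lemma hasGen_iterate_generator {f : E} (hf : f ∈ U.smooth) (k : ℕ) :
    U.HasGen (U.generator^[k] f) (U.generator^[k + 1] f) := by
  obtain ⟨g, -, hg⟩ := exists_hasGen_of_mem_smooth (iterate_generator_mem_smooth hf k)
  rwa [Function.iterate_succ_apply', hg.generator_eq]

lemma iterate_generator_eq {f : ℕ → E} (h : ∀ k, U.HasGen (f k) (f (k + 1))) (k : ℕ) :
    U.generator^[k] (f 0) = f k := by
  induction k with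
  | zero => rfl
  | succ k ih => rw [Function.iterate_succ_apply', ih, (h k).generator_eq]

end Generator

section StronglyContinuous

variable {E : Type*} [NormedAddCommGroup E] [NormedSpace ℝ E] {U : IsometryGroup E}

variable (U) in
/-- `∫_0^x U_s f ds`, an antiderivative of the orbit of `f`. -/
def orbitIntegral (x : ℝ) (f : E) : E := ∫ s in (0 : ℝ)..x, U s f

@[simp] lemma orbitIntegral_zero (f : E) : U.orbitIntegral 0 f = 0 := intervalIntegral.integral_same

variable [hU : U.StronglyContinuous]

lemma intervalIntegrable_apply (f : E) (a b : ℝ) :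
    IntervalIntegrable (fun x => U x f) volume a b :=
  (hU.continuous_apply f).intervalIntegrable a b

variable [CompleteSpace E]

lemma hasDerivAt_orbitIntegral (f : E) (x : ℝ) :
    HasDerivAt (fun y => U.orbitIntegral y f) (U x f) x :=
  intervalIntegral.integral_hasDerivAt_right (intervalIntegrable_apply f _ _)
    ((hU.continuous_apply f).stronglyMeasurableAtFilter _ _) (hU.continuous_apply f).continuousAt

lemma apply_orbitIntegral (x y : ℝ) (f : E) :
    U x (U.orbitIntegral y f) = U.orbitIntegral (x + y) f - U.orbitIntegral x f :=
  calc U x (U.orbitIntegral y f) = ∫ s in (0 : ℝ)..y, U (x + s) f := by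
        simp only [add_apply]
        exact ((U x).toContinuousLinearMap.intervalIntegral_comp_comm
          (intervalIntegrable_apply f 0 y)).symm
    _ = ∫ s in x..x + y, U s f := by
        rw [intervalIntegral.integral_comp_add_left (fun s => U s f), add_zero]
    _ = U.orbitIntegral (x + y) f - U.orbitIntegral x f :=
        (intervalIntegral.integral_interval_sub_left (intervalIntegrable_apply f _ _)
          (intervalIntegrable_apply f _ _)).symm

lemma hasGen_orbitIntegral (y : ℝ) (f : E) : U.HasGen (U.orbitIntegral y f) (U y f - f) := by
  have hshift : HasDerivAt (fun x => U.orbitIntegral (x + y) f) (U y f) 0 :=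
    HasDerivAt.comp_add_const 0 y (by simpa using hasDerivAt_orbitIntegral (U := U) f y)
  simpa only [HasGen, apply_orbitIntegral, zero_apply]
    using hshift.fun_sub (hasDerivAt_orbitIntegral f 0)

lemma HasGen.apply_sub_eq_orbitIntegral {f g : E} (h : U.HasGen f g) (x : ℝ) :
    U x f - f = U.orbitIntegral x g := by
  have := intervalIntegral.integral_eq_sub_of_hasDerivAt (a := 0) (b := x)
    (fun y _ => h.hasDerivAt y) (intervalIntegrable_apply g _ _)
  rw [orbitIntegral, this, zero_apply]

lemma HasGen.orbitIntegral {f g : E} (h : U.HasGen f g) (x : ℝ) :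
    U.HasGen (U.orbitIntegral x f) (U.orbitIntegral x g) := by
  rw [← h.apply_sub_eq_orbitIntegral]
  exact hasGen_orbitIntegral x f

variable (U) in
/-- The mean value of the orbit of `f` over `[0, 1 / (n + 1)]`. -/
def orbitMean (n : ℕ) (f : E) : E := ((n : ℝ) + 1) • U.orbitIntegral ((n : ℝ) + 1)⁻¹ f

lemma tendsto_orbitMean (f : E) : Tendsto (fun n => U.orbitMean n f) atTop (𝓝 f) := by
  have hslope := hasDerivAt_iff_tendsto_slope_zero.1 (hasDerivAt_orbitIntegral (U := U) f 0)
  simp only [zero_apply, zero_add, orbitIntegral_zero, sub_zero] at hslope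
  have hzero : Tendsto (fun n : ℕ => ((n : ℝ) + 1)⁻¹) atTop (𝓝[≠] 0) := by
    refine tendsto_nhdsWithin_iff.2 ⟨?_, Eventually.of_forall fun n => ?_⟩
    · simpa using tendsto_one_div_add_atTop_nhds_zero_nat (𝕜 := ℝ)
    · exact (by positivity : ((n : ℝ) + 1)⁻¹ ≠ 0)
  simpa only [orbitMean, Function.comp_def, inv_inv] using hslope.comp hzero

lemma orbitMean_mem_domPow_succ {k : ℕ} {f : E} (hf : f ∈ U.domPow k) (n : ℕ) :
    U.orbitMean n f ∈ U.domPow (k + 1) := by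
  refine Submodule.smul_mem _ _ ?_
  induction k generalizing f with
  | zero => exact (hasGen_orbitIntegral _ f).mem_domPow_succ (mem_domPow_zero _)
  | succ k ih =>
    obtain ⟨g, hfg, hg⟩ := mem_domPow_succ.1 hf
    exact (hfg.orbitIntegral _).mem_domPow_succ (ih hg)

variable (U) in
lemma dense_domPow (k : ℕ) : Dense (U.domPow k : Set E) := by
  induction k with
  | zero => exact dense_univ
  | succ k ih =>
    refine dense_closure.1 (ih.mono fun f hf => ?_)
    exact mem_closure_of_tendsto (tendsto_orbitMean f)
      (Eventually.of_forall fun n => orbitMean_mem_domPow_succ hf n)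

lemma induction_on_domGen {p : E → Prop} (hclosed : IsClosed {f | p f})
    (hgen : ∀ f g, U.HasGen f g → p f) (f : E) : p f :=
  hclosed.closure_subset_iff.2 (fun f hf => by
    obtain ⟨g, hfg, -⟩ := mem_domPow_succ.1 hf
    exact hgen f g hfg) (U.dense_domPow 1 f)

end StronglyContinuous

end IsometryGroup

lemma exists_inner_eq_of_bound {E X : Type*} [NormedAddCommGroup E] [InnerProductSpace ℝ E]
    [CompleteSpace E] [AddCommGroup X] [Module ℝ X] (j : X →ₗ[ℝ] E) (φ : X →ₗ[ℝ] ℝ) (C : ℝ)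
    (h : ∀ x, |φ x| ≤ C * ‖j x‖) : ∃ w : E, ∀ x, φ x = inner ℝ w (j x) := by
  have hφ : φ ∈ LinearMap.range j.dualMap := by
    rw [LinearMap.range_dualMap_eq_dualAnnihilator_ker, Submodule.mem_dualAnnihilator]
    intro x hx
    simpa [LinearMap.mem_ker.1 hx] using h x
  obtain ⟨ψ, rfl⟩ := hφ
  let ψ' : LinearMap.range j →L[ℝ] ℝ :=
    (ψ.comp (LinearMap.range j).subtype).mkContinuous C (by rintro ⟨-, x, rfl⟩; exact h x)
  obtain ⟨g, hg, -⟩ := exists_extension_norm_eq (LinearMap.range j) ψ'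
  refine ⟨(InnerProductSpace.toDual ℝ E).symm g, fun x => ?_⟩
  rw [InnerProductSpace.toDual_symm_apply, hg ⟨j x, LinearMap.mem_range_self j x⟩]
  rfl

namespace IsometryGroup

lemma abs_apply_apply_sub_le {E : Type*} [NormedAddCommGroup E] [NormedSpace ℝ E]
    [CompleteSpace E] {U : IsometryGroup E} [U.StronglyContinuous] {b c : E →L[ℝ] E →L[ℝ] ℝ}
    (h : ∀ {u u' v v'}, U.HasGen u u' → U.HasGen v v' → b u v' + b u' v = -c u v)
    (x : ℝ) (u v : E) : |b (U x u) (U x v) - b u v| ≤ ‖c‖ * ‖u‖ * ‖v‖ * |x| := by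
  induction u using U.induction_on_domGen with
  | hclosed => exact isClosed_le (by fun_prop) (by fun_prop)
  | hgen u u' hu =>
  induction v using U.induction_on_domGen with
  | hclosed => exact isClosed_le (by fun_prop) (by fun_prop)
  | hgen v v' hv =>
  have hderiv (y : ℝ) :
      HasDerivAt (fun y => b (U y u) (U y v)) (-c (U y u) (U y v)) y := by
    rw [← h (hu.apply y) (hv.apply y), add_comm]
    exact (b.hasFDerivAt.comp_hasDerivAt y (hu.hasDerivAt y)).clm_apply (hv.hasDerivAt y)
  have hbound (y : ℝ) : ‖-c (U y u) (U y v)‖ ≤ ‖c‖ * ‖u‖ * ‖v‖ := by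
    simpa only [norm_neg, LinearIsometry.norm_map] using c.le_opNorm₂ (U y u) (U y v)
  simpa using convex_univ.norm_image_sub_le_of_norm_hasDerivWithin_le (x := 0) (y := x)
    (fun y _ => (hderiv y).hasDerivWithinAt) (fun y _ => hbound y) (Set.mem_univ _)
    (Set.mem_univ _)

section Hilbert

variable {E : Type*} [NormedAddCommGroup E] [InnerProductSpace ℝ E] {U : IsometryGroup E}

lemma inner_apply_left (x : ℝ) (f g : E) : inner ℝ (U x f) g = inner ℝ f (U (-x) g) := by
  rw [← (U x).inner_map_map f, apply_neg_apply]

lemma HasGen.inner_skew {f f' g g' : E} (hf : U.HasGen f f') (hg : U.HasGen g g') :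
    inner ℝ f g' = -inner ℝ f' g := by
  have hconst : HasDerivAt (fun x => inner ℝ (U x f) (U x g)) 0 0 := by
    simpa only [(U _).inner_map_map] using hasDerivAt_const (0 : ℝ) (inner ℝ f g)
  have hprod := (HasDerivAt.inner ℝ hf hg).unique hconst
  rw [zero_apply, zero_apply] at hprod
  exact eq_neg_of_add_eq_zero_left hprod

lemma abs_inner_gen_le_of_norm_apply_sub_le {v : E} {C : ℝ} (h : ∀ x, ‖U x v - v‖ ≤ C * |x|)
    {ψ ψ' : E} (hψ : U.HasGen ψ ψ') : |inner ℝ v ψ'| ≤ C * ‖ψ‖ := by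
  refine le_of_tendsto ((tendsto_const_nhds (x := v)).inner (𝕜 := ℝ)
    (hasGen_iff_tendsto.1 hψ)).abs ?_
  filter_upwards [self_mem_nhdsWithin] with x hx
  have hmove : inner ℝ v (U x ψ - ψ) = inner ℝ (U (-x) v - v) ψ := by
    rw [inner_sub_right, inner_sub_left, inner_apply_left, neg_neg]
  rw [inner_smul_right, hmove, abs_mul, abs_inv, inv_mul_le_iff₀ (abs_pos.2 hx)]
  calc |inner ℝ (U (-x) v - v) ψ| ≤ ‖U (-x) v - v‖ * ‖ψ‖ := abs_real_inner_le_norm _ _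
    _ ≤ C * |x| * ‖ψ‖ := by gcongr; simpa using h (-x)
    _ = |x| * (C * ‖ψ‖) := by ring

lemma hasDerivAt_inner_apply_of_weak {v w : E}
    (h : ∀ {ψ ψ' ψ''}, U.HasGen ψ ψ' → U.HasGen ψ' ψ'' → inner ℝ v ψ' = -inner ℝ w ψ)
    {ψ ψ' ψ'' : E} (hψ : U.HasGen ψ ψ') (hψ' : U.HasGen ψ' ψ'') (x : ℝ) :
    HasDerivAt (fun y => inner ℝ (U y v) ψ) (inner ℝ (U x w) ψ) x := by
  have hshift : HasDerivAt (fun y => U (-y) ψ) (-U (-x) ψ') x := by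
    simpa only [zero_sub] using
      HasDerivAt.comp_const_sub 0 x (by rw [zero_sub]; exact hψ.hasDerivAt (-x))
  have hinner := (hasDerivAt_const x v).inner ℝ hshift
  rw [inner_zero_left, add_zero, inner_neg_right, h (hψ.apply (-x)) (hψ'.apply (-x)),
    neg_neg] at hinner
  simpa only [inner_apply_left] using hinner

variable [CompleteSpace E] [U.StronglyContinuous]

lemma hasGen_of_weak {v w : E}
    (h : ∀ {ψ ψ' ψ''}, U.HasGen ψ ψ' → U.HasGen ψ' ψ'' → inner ℝ v ψ' = -inner ℝ w ψ) :
    U.HasGen v w := by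
  have horbit (x : ℝ) : U x v = v + U.orbitIntegral x w := by
    refine (U.dense_domPow 2).eq_of_inner_left (𝕜 := ℝ) fun ψ hψ => ?_
    obtain ⟨ψ', hψ', hψ'_mem⟩ := mem_domPow_succ.1 hψ
    obtain ⟨ψ'', hψ'', -⟩ := mem_domPow_succ.1 hψ'_mem
    have hderiv (y : ℝ) : HasDerivAt
        (fun y => inner ℝ (U y v) ψ - inner ℝ (v + U.orbitIntegral y w) ψ) 0 y := by
      have hright := ((hasDerivAt_orbitIntegral (U := U) w y).const_add v).inner ℝ
        (hasDerivAt_const y ψ)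
      rw [inner_zero_right, zero_add] at hright
      simpa only [sub_self] using (hasDerivAt_inner_apply_of_weak h hψ' hψ'' y).fun_sub hright
    have hconst := is_const_of_deriv_eq_zero (fun y => (hderiv y).differentiableAt)
      (fun y => (hderiv y).deriv) x 0
    simp only [zero_apply, orbitIntegral_zero, add_zero, sub_self] at hconst
    exact sub_eq_zero.1 hconst
  rw [HasGen, funext horbit]
  simpa only [zero_apply] using (hasDerivAt_orbitIntegral (U := U) w 0).const_add v

variable (U) in
lemma isClosed_genGraph : IsClosed (U.genGraph : Set (E × E)) := by
  refine isClosed_of_closure_subset fun p hp => ?_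
  obtain ⟨q, hq, hqp⟩ := mem_closure_iff_seq_limit.1 hp
  refine hasGen_of_weak fun {ψ ψ' _} hψ _ => ?_
  refine tendsto_nhds_unique (((continuous_fst.tendsto p).comp hqp).inner tendsto_const_nhds)
    (((((continuous_snd.tendsto p).comp hqp).inner tendsto_const_nhds).neg).congr fun n => ?_)
  exact (HasGen.inner_skew (hq n) hψ).symm

lemma exists_hasGen_of_norm_apply_sub_le {v : E} {C : ℝ} (h : ∀ x, ‖U x v - v‖ ≤ C * |x|) :
    ∃ w, U.HasGen v w := by
  obtain ⟨w, hw⟩ := exists_inner_eq_of_bound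
    ((LinearMap.fst ℝ E E).comp U.genGraph.subtype)
    ((innerₛₗ ℝ v).comp ((LinearMap.snd ℝ E E).comp U.genGraph.subtype)) C
    fun p => abs_inner_gen_le_of_norm_apply_sub_le h p.2
  refine ⟨-w, hasGen_of_weak fun {ψ ψ' _} hψ _ => ?_⟩
  rw [inner_neg_left, neg_neg]
  exact hw ⟨(ψ, ψ'), hψ⟩

end Hilbert

section GraphSpace

variable {E : Type*} [NormedAddCommGroup E] [InnerProductSpace ℝ E] (U : IsometryGroup E)

/-- The domain of the generator as a Hilbert space for the graph norm (the space `H¹` of the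
medium): the graph of the generator inside the Hilbert sum `E ⊕ E`. -/
def GraphSpace : Type _ := U.genGraph.comap (WithLp.linearEquiv 2 ℝ (E × E)).toLinearMap

variable {U} in
/-- The element of the graph space given by a vector in the domain of the generator. -/
def HasGen.toGraph {f g : E} (h : U.HasGen f g) : U.GraphSpace := ⟨WithLp.toLp 2 (f, g), h⟩

namespace GraphSpace

instance : NormedAddCommGroup U.GraphSpace :=
  inferInstanceAs (NormedAddCommGroup (U.genGraph.comap _))

instance : InnerProductSpace ℝ U.GraphSpace :=
  inferInstanceAs (InnerProductSpace ℝ (U.genGraph.comap _))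

variable {U}

/-- The inclusion of the domain of the generator into `E`. -/
def incl : U.GraphSpace →L[ℝ] E := (WithLp.fstL 2 ℝ E E).comp (Submodule.subtypeL _)

/-- The generator, as a bounded operator for the graph norm. -/
def gen : U.GraphSpace →L[ℝ] E := (WithLp.sndL 2 ℝ E E).comp (Submodule.subtypeL _)

lemma hasGen (u : U.GraphSpace) : U.HasGen (incl u) (gen u) := u.2

@[simp] lemma incl_toGraph {f g : E} (h : U.HasGen f g) : incl h.toGraph = f := rfl

@[simp] lemma gen_toGraph {f g : E} (h : U.HasGen f g) : gen h.toGraph = g := rfl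

@[ext] lemma ext {u v : U.GraphSpace} (h : incl u = incl v) : u = v := by
  have hgen : gen u = gen v := (hasGen u).unique (h ▸ hasGen v)
  exact Subtype.ext (WithLp.ofLp_injective 2 (Prod.ext h hgen))

lemma norm_sq_eq (u : U.GraphSpace) : ‖u‖ ^ 2 = ‖incl u‖ ^ 2 + ‖gen u‖ ^ 2 :=
  WithLp.prod_norm_sq_eq_of_L2 u.1

lemma norm_incl_le (u : U.GraphSpace) : ‖incl u‖ ≤ ‖u‖ := WithLp.norm_fst_le E u.1

lemma norm_gen_le (u : U.GraphSpace) : ‖gen u‖ ≤ ‖u‖ := WithLp.norm_snd_le E u.1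

lemma tendsto_iff {ι : Type*} {l : Filter ι} {u : ι → U.GraphSpace} {v : U.GraphSpace} :
    Tendsto u l (𝓝 v) ↔ Tendsto (fun i => incl (u i)) l (𝓝 (incl v)) ∧
      Tendsto (fun i => gen (u i)) l (𝓝 (gen v)) := by
  refine ⟨fun h => ⟨(incl.continuous.tendsto v).comp h, (gen.continuous.tendsto v).comp h⟩,
    fun h => tendsto_subtype_rng.2 ?_⟩
  exact ((WithLp.prod_continuous_toLp 2 E E).tendsto _).comp (h.1.prodMk_nhds h.2)

instance [CompleteSpace E] [U.StronglyContinuous] : CompleteSpace U.GraphSpace :=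
  (U.isClosed_genGraph.preimage (WithLp.prod_continuous_ofLp 2 E E)).completeSpace_coe

end GraphSpace

open GraphSpace

/-- The action of the group on the domain of its generator. -/
def onGraph : IsometryGroup U.GraphSpace where
  toFun x :=
    { toFun u := ((hasGen u).apply x).toGraph
      map_add' u v := by ext; simp
      map_smul' c u := by ext; simp
      norm_map' u := by
        rw [← sq_eq_sq₀ (norm_nonneg _) (norm_nonneg _), norm_sq_eq, norm_sq_eq]
        simp }
  zero_apply' u := by ext; simp
  add_apply' x y u := by ext; simp [add_apply]

variable {U}

@[simp] lemma incl_onGraph (x : ℝ) (u : U.GraphSpace) : incl (U.onGraph x u) = U x (incl u) := rfl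

@[simp] lemma gen_onGraph (x : ℝ) (u : U.GraphSpace) : gen (U.onGraph x u) = U x (gen u) := rfl

lemma hasGen_onGraph_iff {u u' : U.GraphSpace} : U.onGraph.HasGen u u' ↔ incl u' = gen u := by
  refine ⟨fun h => (h.map (W := U) incl incl_onGraph).unique (hasGen u), fun h => ?_⟩
  have hgen := h ▸ hasGen u'
  simp only [hasGen_iff_tendsto, tendsto_iff, map_smul, map_sub, incl_onGraph, gen_onGraph, h]
  exact ⟨hasGen_iff_tendsto.1 (hasGen u), hasGen_iff_tendsto.1 hgen⟩

lemma HasGen.toGraph_toGraph {f g h : E} (hfg : U.HasGen f g) (hgh : U.HasGen g h) :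
    U.onGraph.HasGen hfg.toGraph hgh.toGraph :=
  hasGen_onGraph_iff.2 (by rw [incl_toGraph, gen_toGraph])

instance [hU : U.StronglyContinuous] : U.onGraph.StronglyContinuous where
  continuous_apply u := continuous_iff_continuousAt.2 fun x => tendsto_iff.2
    ⟨(hU.continuous_apply (incl u)).tendsto x, (hU.continuous_apply (gen u)).tendsto x⟩

lemma incl_mem_domPow_succ {k : ℕ} {u : U.GraphSpace} :
    incl u ∈ U.domPow (k + 1) ↔ gen u ∈ U.domPow k :=
  ⟨(hasGen u).mem_domPow_of_succ, (hasGen u).mem_domPow_succ⟩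

lemma exists_hasGen_onGraph {k : ℕ} {u : U.GraphSpace} (hu : incl u ∈ U.domPow (k + 2)) :
    ∃ u', U.onGraph.HasGen u u' ∧ incl u' ∈ U.domPow (k + 1) := by
  have hgen := incl_mem_domPow_succ.1 hu
  obtain ⟨w, hw, -⟩ := mem_domPow_succ.1 hgen
  exact ⟨hw.toGraph, hasGen_onGraph_iff.2 rfl, hgen⟩

variable (U) in
/-- A sequence of bounded bilinear forms on the domain of the generator, each being the derivative
of the preceding one along the group, and such that `b k u` is bounded for the norm of `E` (hence
represented by a vector of `E`) when `u` is in the domain of the square of the generator. -/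
structure SmoothForms (b : ℕ → U.GraphSpace →L[ℝ] U.GraphSpace →L[ℝ] ℝ) : Prop where
  deriv : ∀ k {u u' v v'}, U.onGraph.HasGen u u' → U.onGraph.HasGen v v' →
    b k u v' + b k u' v = -b (k + 1) u v
  exists_repr : ∀ k {u u'}, U.onGraph.HasGen u u' → ∃ w : E, ∀ v, b k u v = inner ℝ w (incl v)

namespace SmoothForms

variable {b c : ℕ → U.GraphSpace →L[ℝ] U.GraphSpace →L[ℝ] ℝ}

lemma add (hb : U.SmoothForms b) (hc : U.SmoothForms c) : U.SmoothForms (b + c) where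
  deriv k u u' v v' hu hv := by
    have hbk := hb.deriv k hu hv
    have hck := hc.deriv k hu hv
    simp only [Pi.add_apply, _root_.add_apply]
    linarith
  exists_repr k u u' hu := by
    obtain ⟨w, hw⟩ := hb.exists_repr k hu
    obtain ⟨w', hw'⟩ := hc.exists_repr k hu
    exact ⟨w + w', fun v => by simp [hw, hw', inner_add_left]⟩

lemma const_smul (hb : U.SmoothForms b) (r : ℝ) : U.SmoothForms (r • b) where
  deriv k u u' v v' hu hv := by
    simp only [Pi.smul_apply, _root_.smul_apply, ← smul_add, hb.deriv k hu hv, smul_neg]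
  exists_repr k u u' hu := by
    obtain ⟨w, hw⟩ := hb.exists_repr k hu
    exact ⟨r • w, fun v => by simp [hw, real_inner_smul_left]⟩

variable [CompleteSpace E] [U.StronglyContinuous]

lemma exists_repr_mem_domPow (hb : U.SmoothForms b) (m k : ℕ) {u : U.GraphSpace}
    (hu : incl u ∈ U.domPow (m + 2)) : ∃ w ∈ U.domPow m, ∀ v, b k u v = inner ℝ w (incl v) := by
  obtain ⟨u', huu', hu'⟩ := exists_hasGen_onGraph hu
  obtain ⟨w, hw⟩ := hb.exists_repr k huu'
  induction m generalizing k u u' w with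
  | zero => exact ⟨w, mem_domPow_zero w, hw⟩
  | succ m ih =>
    obtain ⟨u'', hu'u'', hu''⟩ := exists_hasGen_onGraph hu'
    obtain ⟨w₀, hw₀⟩ := hb.exists_repr k hu'u''
    obtain ⟨w₁, hw₁_mem, hw₁⟩ := ih k hu' u'' hu'u'' hu'' w₀ hw₀
    obtain ⟨w₀', hw₀'⟩ := hb.exists_repr (k + 1) huu'
    obtain ⟨w₂, hw₂_mem, hw₂⟩ := ih (k + 1) (domPow_succ_le _ hu) u' huu' (domPow_succ_le _ hu') w₀'
      hw₀'
    have hgen : U.HasGen w (w₁ + w₂) := hasGen_of_weak fun {ψ ψ' ψ''} hψ hψ' => by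
      have hderiv := hb.deriv k huu' (hψ.toGraph_toGraph hψ')
      rw [hw, hw₁, hw₂, incl_toGraph, incl_toGraph] at hderiv
      rw [inner_add_left]
      linarith
    exact ⟨w, hgen.mem_domPow_succ (add_mem hw₁_mem hw₂_mem), hw⟩

variable {κ : ℝ}

/-- The difference quotients of `u` are estimated by testing the equation against the second
difference `U_{-x} d - d`, where `d = U_x u - u`. -/
lemma norm_apply_sub_le_of_repr (hb : U.SmoothForms b) (hκ : 0 < κ)
    (hcoercive : ∀ u, κ * ‖u‖ ^ 2 ≤ b 0 u u) {u : U.GraphSpace} {w : E}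
    (h : ∀ v, b 0 u v = inner ℝ w (incl v)) (x : ℝ) :
    ‖U.onGraph x u - u‖ ≤ κ⁻¹ * (‖b 1‖ * ‖u‖ + ‖w‖) * |x| := by
  set d := U.onGraph x u - u
  set d' := U.onGraph (-x) d
  have hsplit : b 0 d d = (b 0 (U.onGraph x u) (U.onGraph x d') - b 0 u d') + b 0 u (d' - d) := by
    have hsub : b 0 d d = b 0 (U.onGraph x u) d - b 0 u d := (b 0).map_sub₂ _ _ _
    have hsub' : b 0 u (d' - d) = b 0 u d' - b 0 u d := map_sub _ _ _
    rw [apply_neg_apply, hsub, hsub']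
    ring
  have hfirst : |b 0 (U.onGraph x u) (U.onGraph x d') - b 0 u d'| ≤ ‖b 1‖ * ‖u‖ * ‖d‖ * |x| := by
    simpa only [d', LinearIsometry.norm_map] using
      abs_apply_apply_sub_le (fun hu hv => hb.deriv 0 hu hv) x u d'
  have hsecond : |b 0 u (d' - d)| ≤ ‖w‖ * (‖d‖ * |x|) := by
    rw [h]
    refine (abs_real_inner_le_norm _ _).trans (mul_le_mul_of_nonneg_left ?_ (norm_nonneg _))
    rw [map_sub, incl_onGraph, ← abs_neg x]
    exact ((hasGen d).norm_apply_sub_le (-x)).trans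
      (mul_le_mul_of_nonneg_right (norm_gen_le d) (abs_nonneg _))
  have hquad : κ * ‖d‖ * ‖d‖ ≤ (‖b 1‖ * ‖u‖ + ‖w‖) * |x| * ‖d‖ :=
    calc κ * ‖d‖ * ‖d‖ = κ * ‖d‖ ^ 2 := by ring
      _ ≤ |b 0 d d| := (hcoercive d).trans (le_abs_self _)
      _ ≤ ‖b 1‖ * ‖u‖ * ‖d‖ * |x| + ‖w‖ * (‖d‖ * |x|) :=
          hsplit ▸ (abs_add_le _ _).trans (add_le_add hfirst hsecond)
      _ = (‖b 1‖ * ‖u‖ + ‖w‖) * |x| * ‖d‖ := by ring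
  rw [mul_assoc, le_inv_mul_iff₀ hκ]
  rcases (norm_nonneg d).eq_or_lt with hzero | hpos
  · rw [← hzero, mul_zero]
    positivity
  · exact le_of_mul_le_mul_right hquad hpos

lemma mem_domPow_of_repr (hb : U.SmoothForms b) (hκ : 0 < κ)
    (hcoercive : ∀ u, κ * ‖u‖ ^ 2 ≤ b 0 u u) {m : ℕ} {u : U.GraphSpace} {w : E}
    (h : ∀ v, b 0 u v = inner ℝ w (incl v)) (hw : w ∈ U.domPow m) : incl u ∈ U.domPow (m + 2) := by
  induction m generalizing u w with
  | zero =>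
    obtain ⟨u', hu'⟩ := exists_hasGen_of_norm_apply_sub_le
      (hb.norm_apply_sub_le_of_repr hκ hcoercive h)
    refine incl_mem_domPow_succ.2 ?_
    rw [← hasGen_onGraph_iff.1 hu']
    exact (hasGen u').mem_domPow_succ (mem_domPow_zero _)
  | succ m ih =>
    have hu := ih h (domPow_succ_le m hw)
    obtain ⟨w', hww', hw'⟩ := mem_domPow_succ.1 hw
    obtain ⟨w₁, hw₁_mem, hw₁⟩ := hb.exists_repr_mem_domPow m 1 hu
    obtain ⟨u', hu', -⟩ := exists_hasGen_onGraph hu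
    -- `D u` solves the equation obtained by differentiating the one of `u`.
    have hderiv (v : U.GraphSpace) : b 0 u' v = inner ℝ (w' - w₁) (incl v) := by
      induction v using U.onGraph.induction_on_domGen with
      | hclosed => exact isClosed_eq (by fun_prop) (by fun_prop)
      | hgen v v' hv =>
        have hbv := hb.deriv 0 hu' hv
        have hskew := hww'.inner_skew (hasGen v)
        rw [h, hasGen_onGraph_iff.1 hv, zero_add, hw₁] at hbv
        rw [inner_sub_left]
        linarith
    rw [incl_mem_domPow_succ, ← hasGen_onGraph_iff.1 hu']
    exact ih hderiv (sub_mem hw' hw₁_mem)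

end SmoothForms

end GraphSpace

end IsometryGroup

section Measurability

variable {E Z : Type*} [MeasurableSpace Z] {ν : Measure Z}

lemma aemeasurable_simpleFunc_pair {F : E → E → Z → ℝ} (hF : ∀ a b, AEMeasurable (F a b) ν)
    (s t : SimpleFunc Z E) : AEMeasurable (fun z => F (s z) (t z) z) ν := by
  classical
  have hsum : (fun z => F (s z) (t z) z) = fun z =>
      ∑ c ∈ (s.pair t).range, ((s.pair t) ⁻¹' {c}).indicator (F c.1 c.2) z := by
    funext z
    rw [Finset.sum_eq_single ((s.pair t) z)]
    · rw [Set.indicator_of_mem (by simp)]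
      rfl
    · intro c _ hc
      rw [Set.indicator_of_notMem]
      simpa using hc.symm
    · intro h
      exact absurd (SimpleFunc.mem_range_self _ z) h
  rw [hsum]
  exact Finset.aemeasurable_fun_sum _ fun c _ =>
    (hF c.1 c.2).indicator ((s.pair t).measurableSet_fiber c)

lemma aemeasurable_inner_of_continuous [NormedAddCommGroup E] [InnerProductSpace ℝ E]
    [TopologicalSpace Z] [SecondCountableTopology Z] [OpensMeasurableSpace Z]
    {Q : Z → E →L[ℝ] E} (hQ : ∀ a b, AEMeasurable (fun z => inner ℝ (Q z a) b) ν)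
    {X Y : Z → E} (hX : Continuous X) (hY : Continuous Y) :
    AEMeasurable (fun z => inner ℝ (Q z (X z)) (Y z)) ν := by
  have hX' := hX.stronglyMeasurable
  have hY' := hY.stronglyMeasurable
  refine aemeasurable_of_tendsto_metrizable_ae atTop
    (f := fun n z => inner ℝ (Q z (hX'.approx n z)) (hY'.approx n z))
    (fun n => aemeasurable_simpleFunc_pair (F := fun a b z => inner ℝ (Q z a) b) hQ _ _)
    (Eventually.of_forall fun z => ?_)
  exact (((Q z).continuous.tendsto _).comp (hX'.tendsto_approx z)).inner (hY'.tendsto_approx z)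

lemma isClosed_setOf_aemeasurable [TopologicalSpace E] [FrechetUrysohnSpace E] {F : E → Z → ℝ}
    (hF : ∀ z, Continuous fun f => F f z) : IsClosed {f | AEMeasurable (F f) ν} := by
  refine isClosed_of_closure_subset fun f hf => ?_
  obtain ⟨u, hu, huf⟩ := mem_closure_iff_seq_limit.1 hf
  exact aemeasurable_of_tendsto_metrizable_ae atTop hu
    (Eventually.of_forall fun z => ((hF z).tendsto f).comp huf)

end Measurability

section LevyWeight

lemma integrable_of_even {f : ℝ → ℝ} (heven : ∀ x, f (-x) = f x)
    (hf : IntegrableOn f (Set.Ioi 0)) : Integrable f := by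
  have hIio : IntegrableOn f (Set.Iio 0) := by
    have hneg := ((Measure.measurePreserving_neg (volume : Measure ℝ)).integrableOn_comp_preimage
      (Homeomorph.neg ℝ).measurableEmbedding).2 hf
    rwa [show f ∘ Neg.neg = f from funext heven, Set.neg_preimage, Set.neg_Ioi, neg_zero] at hneg
  rw [← integrableOn_univ, ← Set.Iic_union_Ioi (a := (0 : ℝ))]
  exact ((integrableOn_Iic_iff_integrableOn_Iio (by simp)).2 hIio).union hf

/-- The weight `min(1, z²)`, integrable against Lévy measures. -/
def levyWeight (z : ℝ) : ℝ := (min 1 |z|) ^ 2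

variable {α : ℝ}

lemma integrableOn_Ioi_levyWeight_div (h0 : 0 < α) (h2 : α < 2) :
    IntegrableOn (fun z => 1 / |z| ^ (1 + α) * levyWeight z) (Set.Ioi 0) := by
  rw [← Set.Ioc_union_Ioi_eq_Ioi (zero_le_one' ℝ)]
  refine IntegrableOn.union ?_ ?_
  · have hpow : IntegrableOn (fun z : ℝ => z ^ (1 - α)) (Set.Ioc 0 1) :=
      (intervalIntegrable_iff_integrableOn_Ioc_of_le zero_le_one).1
        (intervalIntegral.intervalIntegrable_rpow' (by linarith))
    refine hpow.congr_fun (fun z hz => ?_) measurableSet_Ioc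
    rw [levyWeight, abs_of_pos hz.1, min_eq_right hz.2, one_div, ← Real.rpow_neg hz.1.le,
      ← Real.rpow_add_natCast hz.1.ne']
    push_cast
    ring_nf
  · have hpow : IntegrableOn (fun z : ℝ => z ^ (-(1 + α))) (Set.Ioi 1) :=
      integrableOn_Ioi_rpow_of_lt (by linarith) one_pos
    refine hpow.congr_fun (fun z hz => ?_) measurableSet_Ioi
    have hz0 : 0 < z := one_pos.trans hz
    rw [levyWeight, abs_of_pos hz0, min_eq_left (le_of_lt hz), one_div, ← Real.rpow_neg hz0.le,
      one_pow, mul_one]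

lemma integrable_levyWeight (h0 : 0 < α) (h2 : α < 2) :
    Integrable levyWeight (levyMeasure α) := by
  have hmeas : Measurable fun z : ℝ => 1 / |z| ^ (1 + α) :=
    measurable_const.div (measurable_norm.pow_const _)
  rw [levyMeasure, integrable_withDensity_iff_integrable_smul' hmeas.ennreal_ofReal
    (Eventually.of_forall fun _ => ENNReal.ofReal_lt_top)]
  refine (integrable_of_even (fun z => ?_) (integrableOn_Ioi_levyWeight_div h0 h2)).congr
    (Eventually.of_forall fun z => ?_)
  · simp only [levyWeight, abs_neg]
  · simp only [smul_eq_mul]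
    rw [ENNReal.toReal_ofReal (by positivity)]

end LevyWeight

namespace IsometryGroup

lemma HasGen.norm_apply_sub_le_min {E : Type*} [NormedAddCommGroup E] [NormedSpace ℝ E]
    {U : IsometryGroup E} {f g : E} (h : U.HasGen f g) (z : ℝ) :
    ‖U z f - f‖ ≤ 2 * min 1 |z| * max ‖f‖ ‖g‖ := by
  have hmax : 0 ≤ max ‖f‖ ‖g‖ := (norm_nonneg f).trans (le_max_left _ _)
  rcases le_total 1 |z| with hz | hz
  · calc ‖U z f - f‖ ≤ ‖U z f‖ + ‖f‖ := norm_sub_le _ _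
      _ = 2 * 1 * ‖f‖ := by rw [LinearIsometry.norm_map]; ring
      _ ≤ 2 * min 1 |z| * max ‖f‖ ‖g‖ := by
        rw [min_eq_left hz]
        gcongr
        exact le_max_left _ _
  · calc ‖U z f - f‖ ≤ ‖g‖ * |z| := h.norm_apply_sub_le z
      _ ≤ max ‖f‖ ‖g‖ * |z| := by gcongr; exact le_max_right _ _
      _ ≤ 2 * min 1 |z| * max ‖f‖ ‖g‖ := by
        rw [min_eq_right hz]
        nlinarith [mul_nonneg hmax (abs_nonneg z)]

variable {E : Type*} [NormedAddCommGroup E] [InnerProductSpace ℝ E] {U : IsometryGroup E}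

open GraphSpace

variable (U) in
/-- A sequence of bounded operators, each being the commutator of the generator with the preceding
one. -/
def IsCommutatorSeq (Q : ℕ → E →L[ℝ] E) : Prop :=
  ∀ k {f g}, U.HasGen f g → U.HasGen (Q k f) (Q (k + 1) f + Q k g)

section InnerForm

variable {F : Type*} [NormedAddCommGroup F] [NormedSpace ℝ F]

/-- The bilinear form `(f, g) ↦ ⟪A f, B g⟫`. -/
def innerForm (A B : F →L[ℝ] E) : F →L[ℝ] F →L[ℝ] ℝ :=
  (isBoundedBilinearMap_inner (𝕜 := ℝ)).toContinuousLinearMap.bilinearComp A B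

@[simp] lemma innerForm_apply (A B : F →L[ℝ] E) (f g : F) :
    innerForm A B f g = inner ℝ (A f) (B g) := rfl

variable {Q : ℕ → E →L[ℝ] E}

lemma IsCommutatorSeq.smoothForms_incl (hQ : U.IsCommutatorSeq Q) :
    U.SmoothForms fun k => innerForm ((Q k).comp incl) incl where
  deriv k u u' v v' hu hv := by
    have hskew := (hQ k (hasGen u)).inner_skew (hasGen v)
    rw [inner_add_left] at hskew
    simp only [innerForm_apply, ContinuousLinearMap.comp_apply, hasGen_onGraph_iff.1 hu,
      hasGen_onGraph_iff.1 hv]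
    linarith
  exists_repr k u _ _ := ⟨Q k (incl u), fun _ => rfl⟩

lemma IsCommutatorSeq.smoothForms_gen (hQ : U.IsCommutatorSeq Q) :
    U.SmoothForms fun k => innerForm ((Q k).comp gen) gen where
  deriv k u u' v v' hu hv := by
    have hskew := (hQ k (hasGen u')).inner_skew (hasGen v')
    rw [inner_add_left, hasGen_onGraph_iff.1 hu, hasGen_onGraph_iff.1 hv] at hskew
    simp only [innerForm_apply, ContinuousLinearMap.comp_apply]
    linarith
  exists_repr k u u' hu := by
    have hgen := hQ k (hasGen u')
    rw [hasGen_onGraph_iff.1 hu] at hgen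
    refine ⟨-(Q (k + 1) (gen u) + Q k (gen u')), fun v => ?_⟩
    rw [inner_neg_left]
    exact hgen.inner_skew (hasGen v)

end InnerForm

section Increment

variable (U) in
/-- The increment `u ↦ U_z u - u`, on the domain of the generator. -/
def increment (z : ℝ) : U.GraphSpace →L[ℝ] E :=
  (U z).toContinuousLinearMap.comp incl - incl

lemma increment_apply (z : ℝ) (u : U.GraphSpace) : U.increment z u = U z (incl u) - incl u := rfl

lemma hasGen_increment {u u' : U.GraphSpace} (hu : U.onGraph.HasGen u u') (z : ℝ) :
    U.HasGen (U.increment z u) (U.increment z u') := by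
  rw [increment_apply, increment_apply, hasGen_onGraph_iff.1 hu]
  exact ((hasGen u).apply z).sub (hasGen u)

lemma inner_increment_right (z : ℝ) (f : E) (u : U.GraphSpace) :
    inner ℝ f (U.increment z u) = inner ℝ (U (-z) f - f) (incl u) := by
  rw [increment_apply, inner_sub_right, inner_sub_left, inner_apply_left, neg_neg]

lemma norm_increment_le (z : ℝ) (u : U.GraphSpace) :
    ‖U.increment z u‖ ≤ 2 * min 1 |z| * ‖u‖ :=
  ((hasGen u).norm_apply_sub_le_min z).trans
    (mul_le_mul_of_nonneg_left (max_le (norm_incl_le u) (norm_gen_le u)) (by positivity))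

lemma continuous_increment [hU : U.StronglyContinuous] (u : U.GraphSpace) :
    Continuous fun z => U.increment z u :=
  (hU.continuous_apply _).sub continuous_const

lemma abs_inner_increment_le {Q : ℝ → E →L[ℝ] E} {C : ℝ} (hC : ∀ z, ‖Q z‖ ≤ C)
    (u v : U.GraphSpace) (z : ℝ) : |inner ℝ (Q z (U.increment z u)) (U.increment z v)| ≤
      4 * C * ‖u‖ * ‖v‖ * levyWeight z := by
  have hC0 : 0 ≤ C := (norm_nonneg _).trans (hC z)
  calc |inner ℝ (Q z (U.increment z u)) (U.increment z v)|
      ≤ ‖Q z (U.increment z u)‖ * ‖U.increment z v‖ := abs_real_inner_le_norm _ _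
    _ ≤ C * (2 * min 1 |z| * ‖u‖) * (2 * min 1 |z| * ‖v‖) := by
        gcongr
        · exact (Q z).le_of_opNorm_le_of_le (hC z) (norm_increment_le z u)
        · exact norm_increment_le z v
    _ = 4 * C * ‖u‖ * ‖v‖ * levyWeight z := by rw [levyWeight]; ring

end Increment

variable (U) in
/-- A family of bounded operators indexed by the jump size, together with its successive
commutators with the generator. -/
structure SmoothKernel (ν : Measure ℝ) (Q : ℕ → ℝ → E →L[ℝ] E) : Prop where
  bound : ∀ k, ∃ C, ∀ z, ‖Q k z‖ ≤ C
  isCommutatorSeq : ∀ z, U.IsCommutatorSeq fun k => Q k z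
  aemeasurable_zero : ∀ f g, AEMeasurable (fun z => inner ℝ (Q 0 z f) g) ν

namespace SmoothKernel

variable {ν : Measure ℝ} {Q : ℕ → ℝ → E →L[ℝ] E}

/-- On the domain of the square of the generator, one increment can be moved from `v` to the
other argument, so that only the norm of `incl v` remains. -/
lemma abs_inner_increment_le_of_hasGen (hQ : U.SmoothKernel ν Q) (k : ℕ) {u u' : U.GraphSpace}
    (hu : U.onGraph.HasGen u u') :
    ∃ C, ∀ v z, |inner ℝ (Q k z (U.increment z u)) (U.increment z v)| ≤
      C * ‖incl v‖ * levyWeight z := by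
  obtain ⟨C, hC⟩ := hQ.bound k
  obtain ⟨C', hC'⟩ := hQ.bound (k + 1)
  have hC0 : 0 ≤ C := (norm_nonneg _).trans (hC 0)
  have hC'0 : 0 ≤ C' := (norm_nonneg _).trans (hC' 0)
  refine ⟨4 * (C * ‖u‖ + C' * ‖u‖ + C * ‖u'‖), fun v z => ?_⟩
  have hgen := hQ.isCommutatorSeq z k (hasGen_increment hu z)
  have hQu : ‖Q k z (U.increment z u)‖ ≤ C * (2 * min 1 |z| * ‖u‖) :=
    (Q k z).le_of_opNorm_le_of_le (hC z) (norm_increment_le z u)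
  have hQu' : ‖Q (k + 1) z (U.increment z u) + Q k z (U.increment z u')‖ ≤
      C' * (2 * min 1 |z| * ‖u‖) + C * (2 * min 1 |z| * ‖u'‖) :=
    norm_add_le_of_le ((Q (k + 1) z).le_of_opNorm_le_of_le (hC' z) (norm_increment_le z u))
      ((Q k z).le_of_opNorm_le_of_le (hC z) (norm_increment_le z u'))
  have hmax : max ‖Q k z (U.increment z u)‖
      ‖Q (k + 1) z (U.increment z u) + Q k z (U.increment z u')‖ ≤
        2 * min 1 |z| * (C * ‖u‖ + C' * ‖u‖ + C * ‖u'‖) := by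
    have : 0 ≤ min 1 |z| * (C * ‖u‖) := by positivity
    have : 0 ≤ min 1 |z| * (C' * ‖u‖) := by positivity
    have : 0 ≤ min 1 |z| * (C * ‖u'‖) := by positivity
    exact max_le (by linarith) (by linarith)
  rw [inner_increment_right]
  calc _ ≤ ‖U (-z) (Q k z (U.increment z u)) - Q k z (U.increment z u)‖ * ‖incl v‖ :=
        abs_real_inner_le_norm _ _
    _ ≤ 2 * min 1 |z| * (2 * min 1 |z| * (C * ‖u‖ + C' * ‖u‖ + C * ‖u'‖)) * ‖incl v‖ := by
        gcongr
        refine (hgen.norm_apply_sub_le_min (-z)).trans ?_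
        rw [abs_neg]
        gcongr
    _ = 4 * (C * ‖u‖ + C' * ‖u‖ + C * ‖u'‖) * ‖incl v‖ * levyWeight z := by rw [levyWeight]; ring

variable [CompleteSpace E] [U.StronglyContinuous]

lemma aemeasurable (hQ : U.SmoothKernel ν Q) (k : ℕ) (f g : E) :
    AEMeasurable (fun z => inner ℝ (Q k z f) g) ν := by
  induction k generalizing f g with
  | zero => exact hQ.aemeasurable_zero f g
  | succ k ih =>
    induction f using U.induction_on_domGen with
    | hclosed => exact isClosed_setOf_aemeasurable fun z => by fun_prop
    | hgen f f' hf =>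
    induction g using U.induction_on_domGen with
    | hclosed => exact isClosed_setOf_aemeasurable fun z => by fun_prop
    | hgen g g' hg =>
    refine ((ih f g').neg.sub (ih f' g)).congr (Eventually.of_forall fun z => ?_)
    have hskew := (hQ.isCommutatorSeq z k hf).inner_skew hg
    rw [inner_add_left] at hskew
    simp only [Pi.sub_apply, Pi.neg_apply]
    linarith

lemma aestronglyMeasurable (hQ : U.SmoothKernel ν Q) (k : ℕ) (u v : U.GraphSpace) :
    AEStronglyMeasurable (fun z => inner ℝ (Q k z (U.increment z u)) (U.increment z v)) ν :=
  (aemeasurable_inner_of_continuous (hQ.aemeasurable k) (continuous_increment u)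
    (continuous_increment v)).aestronglyMeasurable

lemma integrable (hQ : U.SmoothKernel ν Q) (hν : Integrable levyWeight ν) (k : ℕ)
    (u v : U.GraphSpace) :
    Integrable (fun z => inner ℝ (Q k z (U.increment z u)) (U.increment z v)) ν := by
  obtain ⟨C, hC⟩ := hQ.bound k
  exact Integrable.mono' (hν.const_mul (4 * C * ‖u‖ * ‖v‖)) (hQ.aestronglyMeasurable k u v)
    (Eventually.of_forall fun z => abs_inner_increment_le hC u v z)

/-- The form `(u, v) ↦ ∫ ⟪Q_z (U_z u - u), U_z v - v⟫ ν(dz)` on the domain of the generator. -/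
def form (hQ : U.SmoothKernel ν Q) (hν : Integrable levyWeight ν) (k : ℕ) :
    U.GraphSpace →L[ℝ] U.GraphSpace →L[ℝ] ℝ :=
  LinearMap.mkContinuousOfExistsBound₂
    (LinearMap.mk₂ ℝ
      (fun u v => ∫ z, inner ℝ (Q k z (U.increment z u)) (U.increment z v) ∂ν)
      (fun u u' v => by
        simp only [map_add, inner_add_left]
        exact integral_add (hQ.integrable hν k u v) (hQ.integrable hν k u' v))
      (fun c u v => by
        simp only [map_smul, real_inner_smul_left, integral_const_mul, smul_eq_mul])
      (fun u v v' => by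
        simp only [map_add, inner_add_right]
        exact integral_add (hQ.integrable hν k u v) (hQ.integrable hν k u v'))
      (fun c u v => by
        simp only [map_smul, real_inner_smul_right, integral_const_mul, smul_eq_mul]))
    (by
      obtain ⟨C, hC⟩ := hQ.bound k
      refine ⟨4 * C * ∫ z, levyWeight z ∂ν, fun u v => ?_⟩
      calc _ ≤ ∫ z, 4 * C * ‖u‖ * ‖v‖ * levyWeight z ∂ν :=
            norm_integral_le_of_norm_le (hν.const_mul _)
              (Eventually.of_forall fun z => abs_inner_increment_le hC u v z)
        _ = _ := by rw [integral_const_mul]; ring)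

lemma form_apply (hQ : U.SmoothKernel ν Q) (hν : Integrable levyWeight ν) (k : ℕ)
    (u v : U.GraphSpace) :
    hQ.form hν k u v = ∫ z, inner ℝ (Q k z (U.increment z u)) (U.increment z v) ∂ν := rfl

lemma smoothForms (hQ : U.SmoothKernel ν Q) (hν : Integrable levyWeight ν) :
    U.SmoothForms (hQ.form hν) where
  deriv k u u' v v' hu hv := by
    simp only [form_apply]
    rw [← integral_add (hQ.integrable hν k u v') (hQ.integrable hν k u' v), ← integral_neg]
    congr 1 with z
    have hskew := (hQ.isCommutatorSeq z k (hasGen_increment hu z)).inner_skew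
      (hasGen_increment hv z)
    rw [inner_add_left] at hskew
    linarith
  exists_repr k u u' hu := by
    obtain ⟨C, hC⟩ := hQ.abs_inner_increment_le_of_hasGen k hu
    refine exists_inner_eq_of_bound (incl : U.GraphSpace →L[ℝ] E).toLinearMap
      (hQ.form hν k u).toLinearMap (C * ∫ z, levyWeight z ∂ν) fun v => ?_
    calc |hQ.form hν k u v| ≤ ∫ z, C * ‖incl v‖ * levyWeight z ∂ν := by
          rw [form_apply, ← Real.norm_eq_abs]
          exact norm_integral_le_of_norm_le (hν.const_mul _) (Eventually.of_forall (hC v))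
      _ = C * (∫ z, levyWeight z ∂ν) * ‖incl v‖ := by rw [integral_const_mul]; ring

end SmoothKernel

end IsometryGroup

namespace RandomMedium

variable {Ω : Type*} [MeasurableSpace Ω] (M : RandomMedium Ω)

/-- The group `T_x f = f ∘ τ_x` acting on `L^p(Ω)`. -/
def shift (p : ENNReal) [Fact (1 ≤ p)] : IsometryGroup (Lp ℝ p M.μ) where
  toFun x := Lp.compMeasurePreservingₗᵢ ℝ (M.τ x) (M.measurePreserving x)
  zero_apply' f := Lp.ext <| by
    filter_upwards [Lp.coeFn_compMeasurePreserving f (M.measurePreserving 0)] with ω hω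
    exact hω.trans (by rw [Function.comp_apply, M.τ_zero])
  add_apply' x y f := Lp.ext <| by
    filter_upwards [Lp.coeFn_compMeasurePreserving f (M.measurePreserving (x + y)),
      Lp.coeFn_compMeasurePreserving (Lp.compMeasurePreserving _ (M.measurePreserving y) f)
        (M.measurePreserving x),
      (M.measurePreserving x).quasiMeasurePreserving.ae
        (Lp.coeFn_compMeasurePreserving f (M.measurePreserving y))] with ω hxy hx hy
    rw [Function.comp_apply] at hxy hx hy
    exact hxy.trans ((hx.trans (hy.trans (by rw [add_comm, M.τ_add]))).symm)

variable {M} {p : ENNReal} [Fact (1 ≤ p)]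

lemma shift_coeFn (x : ℝ) (f : Lp ℝ p M.μ) : M.shift p x f =ᵐ[M.μ] fun ω => f (M.τ x ω) :=
  Lp.coeFn_compMeasurePreserving f (M.measurePreserving x)

lemma ae_τ {P : Ω → Prop} (x : ℝ) (h : ∀ᵐ ω ∂M.μ, P ω) : ∀ᵐ ω ∂M.μ, P (M.τ x ω) :=
  (M.measurePreserving x).quasiMeasurePreserving.ae h

lemma measurable_orbit (ω : Ω) : Measurable fun x => M.τ x ω :=
  M.measurable_τ.comp measurable_prodMk_right

/-- Fubini and stationarity: the measure of a set is the mean time its orbits spend in it. -/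
lemma measure_eq_lintegral_orbit {S : Set Ω} (hS : MeasurableSet S) :
    M.μ S = ∫⁻ ω, volume.restrict (Set.Icc 0 1) {x : ℝ | M.τ x ω ∈ S} ∂M.μ := by
  have hmeas : MeasurableSet {q : Ω × ℝ | M.τ q.2 q.1 ∈ S} :=
    (M.measurable_τ.comp measurable_swap) hS
  calc M.μ S = ∫⁻ _ in Set.Icc (0 : ℝ) 1, M.μ S := by simp
    _ = ∫⁻ x in Set.Icc (0 : ℝ) 1, M.μ {ω | M.τ x ω ∈ S} :=
        lintegral_congr fun x =>
          ((M.measurePreserving x).measure_preimage hS.nullMeasurableSet).symm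
    _ = (M.μ.prod (volume.restrict (Set.Icc (0 : ℝ) 1))) {q : Ω × ℝ | M.τ q.2 q.1 ∈ S} :=
        (Measure.prod_apply_symm hmeas).symm
    _ = _ := Measure.prod_apply hmeas

lemma measurable_volume_orbit {S : Set Ω} (hS : MeasurableSet S) :
    Measurable fun ω => volume.restrict (Set.Icc 0 1) {x : ℝ | M.τ x ω ∈ S} :=
  measurable_measure_prodMk_left ((M.measurable_τ.comp measurable_swap) hS)

end RandomMedium

lemma tendsto_volume_symmDiff_add_left {B : Set ℝ} (hB : MeasurableSet B) :
    Tendsto (fun h : ℝ => volume.restrict (Set.Icc 0 1) (symmDiff {x | h + x ∈ B} B))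
      (𝓝 0) (𝓝 0) := by
  let B' := B ∩ Set.Icc (-1 : ℝ) 2
  have hB' : MeasurableSet B' := hB.inter measurableSet_Icc
  let add : ℝ → C(ℝ, ℝ) := fun h => ⟨fun x => h + x, by fun_prop⟩
  have hadd : Continuous add := ContinuousMap.continuous_of_continuous_uncurry _ continuous_add
  have hlim := tendsto_measure_symmDiff_preimage_nhds_zero (μ := volume) (ν := volume)
    (hadd.tendsto 0) (Eventually.of_forall fun h => measurePreserving_add_left volume h)
    (measurePreserving_add_left volume (0 : ℝ)) hB'.nullMeasurableSet
    (measure_ne_top_of_subset Set.inter_subset_right (by simp))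
  refine tendsto_of_tendsto_of_tendsto_of_le_of_le' tendsto_const_nhds hlim
    (Eventually.of_forall fun _ => zero_le) ?_
  filter_upwards [Ioo_mem_nhds (neg_lt_zero.2 one_pos) one_pos] with h hh
  have hpre : MeasurableSet {x | h + x ∈ B} := measurable_const_add h hB
  rw [Measure.restrict_apply (hpre.symmDiff hB)]
  refine measure_mono fun x ⟨hx, hx0, hx1⟩ => ?_
  have hxI : x ∈ Set.Icc (-1 : ℝ) 2 := ⟨by linarith, by linarith⟩
  have hhxI : h + x ∈ Set.Icc (-1 : ℝ) 2 := ⟨by linarith [hh.1], by linarith [hh.2]⟩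
  simp only [Set.mem_symmDiff, Set.mem_ofPred_eq, Set.mem_preimage, ContinuousMap.coe_mk,
    zero_add, add, B', Set.mem_inter_iff, hxI, hhxI, and_true] at hx ⊢
  exact hx

namespace RandomMedium

variable {Ω : Type*} [MeasurableSpace Ω] {M : RandomMedium Ω}

lemma tendsto_measure_symmDiff_preimage_τ {S : Set Ω} (hS : MeasurableSet S) :
    Tendsto (fun h => M.μ (symmDiff (M.τ h ⁻¹' S) S)) (𝓝 0) (𝓝 0) := by
  have hmeas : ∀ h, MeasurableSet (symmDiff (M.τ h ⁻¹' S) S) := fun h =>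
    ((M.measurePreserving h).measurable hS).symmDiff hS
  simp_rw [measure_eq_lintegral_orbit (hmeas _)]
  rw [← lintegral_zero (μ := M.μ)]
  refine tendsto_lintegral_filter_of_dominated_convergence (fun _ => 1)
    (Eventually.of_forall fun h => measurable_volume_orbit (hmeas h))
    (Eventually.of_forall fun h => Eventually.of_forall fun ω => ?_) (by simp)
    (Eventually.of_forall fun ω => ?_)
  · exact (measure_mono (Set.subset_univ _)).trans (by simp)
  · refine (tendsto_volume_symmDiff_add_left (measurable_orbit (M := M) ω hS)).congr fun h => ?_
    congr 1 with x
    simp only [Set.mem_symmDiff, Set.mem_preimage, Set.mem_ofPred_eq, M.τ_add]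

lemma tendsto_shift {p : ENNReal} [Fact (1 ≤ p)] (hp : p ≠ ⊤) (f : Lp ℝ p M.μ) :
    Tendsto (fun x => M.shift p x f) (𝓝 0) (𝓝 f) := by
  induction f using Lp.induction hp with
  | indicatorConst c hs hμs =>
    exact tendsto_indicatorConstLp_set (hs := hs) (hμs := hμs.ne)
      (ht := fun h => (M.measurePreserving h).measurable hs) (hμt := fun h => measure_ne_top _ _)
      hp (tendsto_measure_symmDiff_preimage_τ hs)
  | add hf hg _ ihf ihg =>
    simpa only [map_add] using ihf.add ihg
  | isClosed =>
    refine isClosed_of_closure_subset fun f hf => Metric.tendsto_nhds.2 fun ε hε => ?_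
    obtain ⟨g, hg, hfg⟩ := Metric.mem_closure_iff.1 hf (ε / 3) (by positivity)
    filter_upwards [Metric.tendsto_nhds.1 hg (ε / 3) (by positivity)] with x hx
    have htri := dist_triangle4 (M.shift p x f) (M.shift p x g) g f
    rw [(M.shift p x).isometry.dist_eq, dist_comm g f] at htri
    linarith

instance : (M.shift 2).StronglyContinuous :=
  IsometryGroup.stronglyContinuous_of_tendsto _ (tendsto_shift ENNReal.ofNat_ne_top)

lemma T_eq_shift (x : ℝ) (f : M.L2) : M.T x f = M.shift 2 x f := rfl

lemma mem_domD_iff {f : M.L2} : f ∈ M.domD ↔ ∃ g, (M.shift 2).HasGen f g := by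
  simp only [domD, IsometryGroup.hasGen_iff_tendsto, T_eq_shift, Set.mem_ofPred_eq]

lemma _root_.IsometryGroup.HasGen.D_eq {f g : M.L2} (h : (M.shift 2).HasGen f g) : M.D f = g := by
  simp only [IsometryGroup.hasGen_iff_tendsto, ← T_eq_shift] at h
  exact h.limUnder_eq

lemma hasGen_D {f : M.L2} (hf : f ∈ M.domD) : (M.shift 2).HasGen f (M.D f) := by
  obtain ⟨g, hfg⟩ := mem_domD_iff.1 hf
  rwa [hfg.D_eq]

end RandomMedium

lemma mem_powDomain_succ_iff {X : Type*} {dom : Set X} {A : X → X} {k : ℕ} {x : X} :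
    x ∈ powDomain dom A (k + 1) ↔ x ∈ dom ∧ A x ∈ powDomain dom A k := by
  induction k with
  | zero => simp [powDomain]
  | succ k ih =>
    rw [powDomain, Set.mem_ofPred_eq, ih, powDomain, Set.mem_ofPred_eq, Function.iterate_succ_apply,
      and_assoc]

namespace RandomMedium

variable {Ω : Type*} [MeasurableSpace Ω] {M : RandomMedium Ω}

lemma mem_H_iff {k : ℕ} {f : M.L2} : f ∈ M.H k ↔ f ∈ (M.shift 2).domPow k := by
  induction k generalizing f with
  | zero => exact iff_of_true (Set.mem_univ f) (IsometryGroup.mem_domPow_zero f)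
  | succ k ih =>
    rw [H, mem_powDomain_succ_iff, IsometryGroup.mem_domPow_succ]
    refine ⟨fun ⟨hf, hDf⟩ => ⟨M.D f, hasGen_D hf, ih.1 hDf⟩, fun ⟨g, hfg, hg⟩ => ?_⟩
    exact ⟨mem_domD_iff.2 ⟨g, hfg⟩, by rw [hfg.D_eq]; exact ih.2 hg⟩

lemma mem_Hinf_iff {f : M.L2} : f ∈ M.Hinf ↔ f ∈ (M.shift 2).smooth := by
  rw [IsometryGroup.mem_smooth]
  exact forall_congr' fun _ => mem_H_iff

lemma iterate_D_eq_iterate_generator {f : M.L2} (hf : f ∈ M.Hinf) (k : ℕ) :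
    M.D^[k] f = (M.shift 2).generator^[k] f := by
  induction k with
  | zero => rfl
  | succ k ih =>
    have hgen := IsometryGroup.hasGen_iterate_generator (mem_Hinf_iff.1 hf) k
    rw [Function.iterate_succ_apply', ih, hgen.D_eq]

lemma hasGen_iterate_D {f : M.L2} (hf : f ∈ M.Hinf) (k : ℕ) :
    (M.shift 2).HasGen (M.D^[k] f) (M.D^[k + 1] f) := by
  rw [iterate_D_eq_iterate_generator hf, iterate_D_eq_iterate_generator hf]
  exact IsometryGroup.hasGen_iterate_generator (mem_Hinf_iff.1 hf) k

end RandomMedium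

section BoundedMultiplication

variable {Ω : Type*} [MeasurableSpace Ω] {μ : Measure Ω}

lemma ae_abs_le_norm (p : Lp ℝ ⊤ μ) : ∀ᵐ ω ∂μ, |p ω| ≤ ‖p‖ := by
  filter_upwards [enorm_ae_le_eLpNormEssSup p μ] with ω hω
  rw [Lp.norm_def, eLpNorm_exponent_top, ← Real.norm_eq_abs, ← toReal_enorm]
  exact ENNReal.toReal_mono (by simpa using Lp.eLpNorm_ne_top p) hω

lemma linfty_norm_le_iff {p : Lp ℝ ⊤ μ} {C : ℝ} (hC : 0 ≤ C) :
    ‖p‖ ≤ C ↔ ∀ᵐ ω ∂μ, |p ω| ≤ C := by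
  refine ⟨fun h => (ae_abs_le_norm p).mono fun ω hω => hω.trans h, fun h => ?_⟩
  rw [Lp.norm_def, eLpNorm_exponent_top]
  exact ENNReal.toReal_le_of_le_ofReal hC (eLpNormEssSup_le_of_ae_bound h)

variable (q : ENNReal) [Fact (1 ≤ q)]

/-- Pointwise multiplication of `L^q` functions by bounded functions. -/
def linftyMul : Lp ℝ ⊤ μ →L[ℝ] Lp ℝ q μ →L[ℝ] Lp ℝ q μ :=
  (ContinuousLinearMap.mul ℝ ℝ).holderL μ ⊤ q q

variable {q}

lemma linftyMul_coeFn (p : Lp ℝ ⊤ μ) (f : Lp ℝ q μ) :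
    linftyMul q p f =ᵐ[μ] fun ω => p ω * f ω :=
  (ContinuousLinearMap.mul ℝ ℝ).coeFn_holder p f

lemma norm_linftyMul_apply_le (p : Lp ℝ ⊤ μ) (f : Lp ℝ q μ) :
    ‖linftyMul q p f‖ ≤ ‖p‖ * ‖f‖ := by
  refine ((ContinuousLinearMap.mul ℝ ℝ).norm_holder_apply_apply_le p f).trans ?_
  gcongr
  exact mul_le_of_le_one_left (norm_nonneg p) (ContinuousLinearMap.opNorm_mul_le ℝ ℝ)

lemma norm_linftyMul_le (p : Lp ℝ ⊤ μ) : ‖linftyMul q p‖ ≤ ‖p‖ :=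
  ContinuousLinearMap.opNorm_le_bound _ (norm_nonneg p) (norm_linftyMul_apply_le p)

lemma inner_eq_integral (f g : Lp ℝ 2 μ) : inner ℝ f g = ∫ ω, f ω * g ω ∂μ :=
  (L2.inner_def f g).trans (integral_congr_ae (Eventually.of_forall fun _ => mul_comm _ _))

lemma inner_linftyMul_eq_integral (p : Lp ℝ ⊤ μ) (f g : Lp ℝ 2 μ) :
    inner ℝ (linftyMul 2 p f) g = ∫ ω, p ω * f ω * g ω ∂μ := by
  rw [inner_eq_integral]
  refine integral_congr_ae ?_
  filter_upwards [linftyMul_coeFn p f] with ω hω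
  rw [hω]

lemma inner_linftyMul_left (p : Lp ℝ ⊤ μ) (f g : Lp ℝ 2 μ) :
    inner ℝ (linftyMul 2 p f) g = inner ℝ f (linftyMul 2 p g) := by
  rw [real_inner_comm (linftyMul 2 p g), inner_linftyMul_eq_integral, inner_linftyMul_eq_integral]
  simp only [mul_right_comm]

lemma integrable_linftyMul_mul (p : Lp ℝ ⊤ μ) (f g : Lp ℝ 2 μ) :
    Integrable (fun ω => p ω * f ω * g ω) μ :=
  (L2.integrable_inner (𝕜 := ℝ) g (linftyMul 2 p f)).congr <| by
    filter_upwards [linftyMul_coeFn p f] with ω hω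
    rw [hω]
    rfl

lemma inner_linftyMul_mono {p p' : Lp ℝ ⊤ μ} {f g : Lp ℝ 2 μ}
    (h : ∀ᵐ ω ∂μ, p ω * f ω * f ω ≤ p' ω * g ω * g ω) :
    inner ℝ (linftyMul 2 p f) f ≤ inner ℝ (linftyMul 2 p' g) g := by
  rw [inner_linftyMul_eq_integral, inner_linftyMul_eq_integral]
  exact integral_mono_ae (integrable_linftyMul_mul p f f) (integrable_linftyMul_mul p' g g) h

lemma le_inner_linftyMul {p : Lp ℝ ⊤ μ} {κ : ℝ} (hκ : ∀ᵐ ω ∂μ, κ ≤ p ω) (f : Lp ℝ 2 μ) :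
    κ * ‖f‖ ^ 2 ≤ inner ℝ (linftyMul 2 p f) f := by
  rw [← real_inner_self_eq_norm_sq, inner_eq_integral, inner_linftyMul_eq_integral,
    ← integral_const_mul]
  refine integral_mono_ae ((L2.integrable_inner (𝕜 := ℝ) f f).const_mul κ)
    (integrable_linftyMul_mul p f f) ?_
  filter_upwards [hκ] with ω hω
  nlinarith [mul_self_nonneg (f ω)]

variable [IsFiniteMeasure μ]

/-- The embedding of `L^∞` into `L²`. -/
def linftyToL2 : Lp ℝ ⊤ μ →L[ℝ] Lp ℝ 2 μ := (linftyMul 2).flip (Lp.const 2 μ 1)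

lemma linftyToL2_coeFn (p : Lp ℝ ⊤ μ) : linftyToL2 p =ᵐ[μ] p := by
  filter_upwards [linftyMul_coeFn p (Lp.const 2 μ 1), Lp.coeFn_const 2 μ (1 : ℝ)] with ω hω h1
  exact hω.trans (by rw [h1, Function.const_apply, mul_one])

lemma linftyToL2_injective : Function.Injective (linftyToL2 (μ := μ)) := fun p p' h => Lp.ext <|
  (linftyToL2_coeFn p).symm.trans (h ▸ linftyToL2_coeFn p')

lemma mem_image_linftyToL2_closedBall_iff {f : Lp ℝ 2 μ} {C : ℝ} (hC : 0 ≤ C) :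
    f ∈ linftyToL2 '' Metric.closedBall 0 C ↔ ∀ᵐ ω ∂μ, |f ω| ≤ C := by
  constructor
  · rintro ⟨p, hp, rfl⟩
    filter_upwards [linftyToL2_coeFn p,
      (linfty_norm_le_iff hC).1 (mem_closedBall_zero_iff.1 hp)] with ω hω hpω
    rwa [hω]
  · intro h
    have hmem : MemLp f ⊤ μ := MemLp.of_bound (Lp.aestronglyMeasurable f) C h
    refine ⟨hmem.toLp f, mem_closedBall_zero_iff.2 ((linfty_norm_le_iff hC).2 ?_), Lp.ext ?_⟩
    · filter_upwards [hmem.coeFn_toLp, h] with ω hω hfω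
      rwa [hω]
    · exact (linftyToL2_coeFn _).trans hmem.coeFn_toLp

lemma image_linftyToL2_closedBall {C : ℝ} (hC : 0 ≤ C) :
    linftyToL2 '' Metric.closedBall 0 C = Set.Icc (Lp.const 2 μ (-C)) (Lp.const 2 μ C) := by
  ext f
  rw [mem_image_linftyToL2_closedBall_iff hC, Set.mem_Icc, ← Lp.coeFn_le, ← Lp.coeFn_le,
    EventuallyLE, EventuallyLE, ← eventually_and]
  refine eventually_congr ?_
  filter_upwards [Lp.coeFn_const 2 μ (-C), Lp.coeFn_const 2 μ C] with ω h₁ h₂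
  rw [h₁, h₂, abs_le, Function.const_apply, Function.const_apply]

lemma isClosed_image_linftyToL2_closedBall {C : ℝ} (hC : 0 ≤ C) :
    IsClosed (linftyToL2 (μ := μ) '' Metric.closedBall 0 C) := by
  rw [image_linftyToL2_closedBall hC]
  exact isClosed_Icc

lemma norm_le_of_linftyToL2_eq_integral {P : ℝ → Lp ℝ ⊤ μ} {p : Lp ℝ ⊤ μ} {C x : ℝ}
    (hcont : Continuous fun s => linftyToL2 (P s)) (hP : ∀ s ∈ Set.uIcc 0 x, ‖P s‖ ≤ C)
    (hp : linftyToL2 p = ∫ s in (0 : ℝ)..x, linftyToL2 (P s)) : ‖p‖ ≤ C * |x| := by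
  rcases eq_or_ne x 0 with rfl | hx
  · rw [intervalIntegral.integral_same, ← map_zero linftyToL2] at hp
    simp [linftyToL2_injective hp]
  have hC : 0 ≤ C := (norm_nonneg _).trans (hP 0 Set.left_mem_uIcc)
  have hconvex : Convex ℝ (linftyToL2 (μ := μ) '' Metric.closedBall 0 C) :=
    (convex_closedBall 0 C).linear_image (linftyToL2 (μ := μ)).toLinearMap
  have hmean : (⨍ s in (0 : ℝ)..x, linftyToL2 (P s)) ∈ linftyToL2 '' Metric.closedBall 0 C := by
    refine hconvex.set_average_mem (isClosed_image_linftyToL2_closedBall hC) ?_ ?_ ?_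
      (intervalIntegrable_iff.1 (hcont.intervalIntegrable 0 x))
    · simpa [Real.volume_uIoc] using hx
    · simp [Real.volume_uIoc]
    · exact (ae_restrict_iff' measurableSet_uIoc).2 (Eventually.of_forall fun s hs =>
        ⟨P s, mem_closedBall_zero_iff.2 (hP s (Set.uIoc_subset_uIcc hs)), rfl⟩)
  obtain ⟨m, hm, hmeq⟩ := hmean
  rw [interval_average_eq, sub_zero, ← hp, ← map_smul] at hmeq
  calc ‖p‖ = ‖x • m‖ := by rw [linftyToL2_injective hmeq, smul_inv_smul₀ hx]
    _ = |x| * ‖m‖ := norm_smul x m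
    _ ≤ C * |x| := by
        rw [mul_comm]
        gcongr
        exact mem_closedBall_zero_iff.1 hm

end BoundedMultiplication

section Exponential

variable {Ω : Type*} [MeasurableSpace Ω] {μ : Measure Ω}

lemma memLp_exp_linfty (p : Lp ℝ ⊤ μ) : MemLp (fun ω => Real.exp (p ω)) ⊤ μ := by
  refine memLp_top_of_bound (Real.continuous_exp.comp_aestronglyMeasurable
    (Lp.aestronglyMeasurable p)) (Real.exp ‖p‖) ?_
  filter_upwards [ae_abs_le_norm p] with ω hω
  rw [Real.norm_eq_abs, Real.abs_exp]
  exact Real.exp_le_exp.2 ((le_abs_self _).trans hω)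

/-- The exponential of a bounded function, as an element of `L^∞`. -/
def linftyExp (p : Lp ℝ ⊤ μ) : Lp ℝ ⊤ μ := (memLp_exp_linfty p).toLp _

lemma linftyExp_coeFn (p : Lp ℝ ⊤ μ) : linftyExp p =ᵐ[μ] fun ω => Real.exp (p ω) :=
  (memLp_exp_linfty p).coeFn_toLp

lemma norm_linftyExp_add_sub_le (p : Lp ℝ ⊤ μ) {w : Lp ℝ ⊤ μ} (hw : ‖w‖ ≤ 1) :
    ‖linftyExp (p + w) - linftyExp p - linftyMul ⊤ (linftyExp p) w‖ ≤
      ‖linftyExp p‖ * ‖w‖ ^ 2 := by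
  refine (linfty_norm_le_iff (by positivity)).2 ?_
  filter_upwards [ae_abs_le_norm (linftyExp p), ae_abs_le_norm w, linftyExp_coeFn (p + w),
    linftyExp_coeFn p, linftyMul_coeFn (linftyExp p) w, Lp.coeFn_add p w,
    Lp.coeFn_sub (linftyExp (p + w)) (linftyExp p),
    Lp.coeFn_sub (linftyExp (p + w) - linftyExp p) (linftyMul ⊤ (linftyExp p) w)]
    with ω hp hwω hexp_add hexp hmul hadd hsub hsub'
  have hremainder : |Real.exp (w ω) - 1 - w ω| ≤ ‖w‖ ^ 2 :=
    (Real.abs_exp_sub_one_sub_id_le (hwω.trans hw)).trans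
      (sq_le_sq' (abs_le.1 hwω).1 (abs_le.1 hwω).2)
  calc |(linftyExp (p + w) - linftyExp p - linftyMul ⊤ (linftyExp p) w : Lp ℝ ⊤ μ) ω|
      = |linftyExp p ω| * |Real.exp (w ω) - 1 - w ω| := by
        rw [hsub', Pi.sub_apply, hsub, Pi.sub_apply, hexp_add, hadd, Pi.add_apply, hmul, hexp,
          Real.exp_add, ← abs_mul]
        ring_nf
    _ ≤ ‖linftyExp p‖ * ‖w‖ ^ 2 := by gcongr

lemma hasFDerivAt_linftyExp (p : Lp ℝ ⊤ μ) :
    HasFDerivAt linftyExp (linftyMul ⊤ (linftyExp p)) p := by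
  rw [hasFDerivAt_iff_isLittleO_nhds_zero]
  have hO : (fun w => linftyExp (p + w) - linftyExp p - linftyMul ⊤ (linftyExp p) w) =O[𝓝 0]
      fun w => ‖w‖ ^ 2 := by
    refine Asymptotics.IsBigO.of_bound ‖linftyExp p‖ ?_
    filter_upwards [Metric.closedBall_mem_nhds (0 : Lp ℝ ⊤ μ) one_pos] with w hw
    rw [norm_pow, norm_norm]
    exact norm_linftyExp_add_sub_le p (mem_closedBall_zero_iff.1 hw)
  exact hO.trans_isLittleO (Asymptotics.isLittleO_norm_pow_id one_lt_two)

end Exponential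

namespace RandomMedium

variable {Ω : Type*} [MeasurableSpace Ω] {M : RandomMedium Ω}

lemma shift_linftyMul {q : ENNReal} [Fact (1 ≤ q)] (x : ℝ) (p : Lp ℝ ⊤ M.μ) (f : Lp ℝ q M.μ) :
    M.shift q x (linftyMul q p f) = linftyMul q (M.shift ⊤ x p) (M.shift q x f) := Lp.ext <| by
  filter_upwards [shift_coeFn x (linftyMul q p f), ae_τ x (linftyMul_coeFn p f),
    linftyMul_coeFn (M.shift ⊤ x p) (M.shift q x f), shift_coeFn x p, shift_coeFn x f]
    with ω h₁ h₂ h₃ h₄ h₅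
  rw [h₁, h₂, h₃, h₄, h₅]

lemma shift_linftyExp (x : ℝ) (p : Lp ℝ ⊤ M.μ) :
    M.shift ⊤ x (linftyExp p) = linftyExp (M.shift ⊤ x p) := Lp.ext <| by
  filter_upwards [shift_coeFn x (linftyExp p), ae_τ x (linftyExp_coeFn p),
    linftyExp_coeFn (M.shift ⊤ x p), shift_coeFn x p] with ω h₁ h₂ h₃ h₄
  rw [h₁, h₂, h₃, h₄]

lemma linftyToL2_shift (x : ℝ) (p : Lp ℝ ⊤ M.μ) :
    linftyToL2 (M.shift ⊤ x p) = M.shift 2 x (linftyToL2 p) := Lp.ext <| by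
  filter_upwards [linftyToL2_coeFn (M.shift ⊤ x p), shift_coeFn x p,
    shift_coeFn x (linftyToL2 p), ae_τ x (linftyToL2_coeFn p)] with ω h₁ h₂ h₃ h₄
  rw [h₁, h₂, h₃, h₄]

lemma hasGen_linftyMul {q : ENNReal} [Fact (1 ≤ q)] {p p' : Lp ℝ ⊤ M.μ} {f f' : Lp ℝ q M.μ}
    (hp : (M.shift ⊤).HasGen p p') (hf : (M.shift q).HasGen f f') :
    (M.shift q).HasGen (linftyMul q p f) (linftyMul q p f' + linftyMul q p' f) :=
  hp.bilinear shift_linftyMul hf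

lemma linftyMul_mem_domPow {q : ENNReal} [Fact (1 ≤ q)] {k : ℕ} {p : Lp ℝ ⊤ M.μ}
    {f : Lp ℝ q M.μ} (hp : p ∈ (M.shift ⊤).domPow k) (hf : f ∈ (M.shift q).domPow k) :
    linftyMul q p f ∈ (M.shift q).domPow k :=
  IsometryGroup.bilinear_mem_domPow shift_linftyMul hp hf

lemma linftyMul_mem_smooth {q : ENNReal} [Fact (1 ≤ q)] {p : Lp ℝ ⊤ M.μ}
    {f : Lp ℝ q M.μ} (hp : p ∈ (M.shift ⊤).smooth) (hf : f ∈ (M.shift q).smooth) :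
    linftyMul q p f ∈ (M.shift q).smooth :=
  IsometryGroup.mem_smooth.2 fun k => linftyMul_mem_domPow
    (IsometryGroup.mem_smooth.1 hp k) (IsometryGroup.mem_smooth.1 hf k)

lemma isCommutatorSeq_linftyMul {p : Lp ℝ ⊤ M.μ} (hp : p ∈ (M.shift ⊤).smooth) :
    (M.shift 2).IsCommutatorSeq fun k => linftyMul 2 ((M.shift ⊤).generator^[k] p) :=
  fun k _ _ hfg => by
    rw [add_comm]
    exact hasGen_linftyMul (IsometryGroup.hasGen_iterate_generator hp k) hfg

lemma hasGen_linftyExp {p p' : Lp ℝ ⊤ M.μ} (h : (M.shift ⊤).HasGen p p') :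
    (M.shift ⊤).HasGen (linftyExp p) (linftyMul ⊤ (linftyExp p) p') := by
  have hp : HasFDerivAt linftyExp (linftyMul ⊤ (linftyExp p)) (M.shift ⊤ 0 p) := by
    rw [IsometryGroup.zero_apply]
    exact hasFDerivAt_linftyExp p
  simpa only [IsometryGroup.HasGen, Function.comp_def, shift_linftyExp]
    using hp.comp_hasDerivAt (0 : ℝ) h

lemma linftyExp_mem_smooth {p : Lp ℝ ⊤ M.μ} (hp : p ∈ (M.shift ⊤).smooth) :
    linftyExp p ∈ (M.shift ⊤).smooth := by
  obtain ⟨p', hp', hpp'⟩ := IsometryGroup.exists_hasGen_of_mem_smooth hp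
  refine IsometryGroup.mem_smooth.2 fun k => ?_
  induction k with
  | zero => exact IsometryGroup.mem_domPow_zero _
  | succ k ih =>
    exact (hasGen_linftyExp hpp').mem_domPow_succ
      (linftyMul_mem_domPow ih (IsometryGroup.mem_smooth.1 hp' k))

lemma norm_shift_sub_le_of_hasGen_linftyToL2 {p p' : Lp ℝ ⊤ M.μ}
    (h : (M.shift 2).HasGen (linftyToL2 p) (linftyToL2 p')) (x : ℝ) :
    ‖M.shift ⊤ x p - p‖ ≤ ‖p'‖ * |x| := by
  refine norm_le_of_linftyToL2_eq_integral (P := fun s => M.shift ⊤ s p') ?_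
    (fun s _ => ((M.shift ⊤ s).norm_map p').le) ?_
  · simp only [linftyToL2_shift]
    exact IsometryGroup.StronglyContinuous.continuous_apply _
  · simp only [map_sub, linftyToL2_shift]
    exact h.apply_sub_eq_orbitIntegral x

/-- A second derivative in `L^∞` turns differentiability in `L²` into differentiability in
`L^∞`, by Taylor's formula. -/
lemma hasGen_of_hasGen_linftyToL2 {p p' p'' : Lp ℝ ⊤ M.μ}
    (h : (M.shift 2).HasGen (linftyToL2 p) (linftyToL2 p'))
    (h' : (M.shift 2).HasGen (linftyToL2 p') (linftyToL2 p'')) : (M.shift ⊤).HasGen p p' := by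
  have htaylor : ∀ x, ‖M.shift ⊤ x p - p - x • p'‖ ≤ ‖p''‖ * |x| * |x| := fun x => by
    refine norm_le_of_linftyToL2_eq_integral (P := fun s => M.shift ⊤ s p' - p') ?_
      (fun s hs => ?_) ?_
    · simp only [map_sub, linftyToL2_shift]
      exact (IsometryGroup.StronglyContinuous.continuous_apply _).sub continuous_const
    · refine (norm_shift_sub_le_of_hasGen_linftyToL2 h' s).trans ?_
      exact mul_le_mul_of_nonneg_left (by simpa using Set.abs_sub_left_of_mem_uIcc hs)
        (norm_nonneg _)
    · simp only [map_sub, map_smul, linftyToL2_shift]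
      rw [intervalIntegral.integral_sub (IsometryGroup.intervalIntegrable_apply _ _ _)
        intervalIntegrable_const, intervalIntegral.integral_const, sub_zero,
        h.apply_sub_eq_orbitIntegral, IsometryGroup.orbitIntegral]
  rw [IsometryGroup.HasGen, hasDerivAt_iff_isLittleO_nhds_zero]
  simp only [zero_add, IsometryGroup.zero_apply]
  refine (Asymptotics.IsBigO.of_bound ‖p''‖ (Eventually.of_forall fun x => ?_)).trans_isLittleO
    (Asymptotics.isLittleO_pow_id one_lt_two)
  rw [norm_pow, Real.norm_eq_abs, sq, ← mul_assoc]
  exact htaylor x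

lemma exists_smooth_of_memCinf {g : Ω → ℝ} (hg : M.MemCinf g) :
    ∃ p ∈ (M.shift ⊤).smooth, p =ᵐ[M.μ] g ∧
      ∀ k, linftyToL2 ((M.shift ⊤).generator^[k] p) = M.D^[k] (linftyToL2 p) := by
  obtain ⟨f, hfg, hf, hbound⟩ := hg
  choose C hC using hbound
  have hrep : ∀ k, ∃ p : Lp ℝ ⊤ M.μ, linftyToL2 p = M.D^[k] f := fun k => by
    obtain ⟨p, -, hp⟩ := (mem_image_linftyToL2_closedBall_iff (abs_nonneg (C k))).2
      ((hC k).mono fun ω hω => hω.trans (le_abs_self _))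
    exact ⟨p, hp⟩
  choose p hp using hrep
  have hgen : ∀ k, (M.shift ⊤).HasGen (p k) (p (k + 1)) := fun k => by
    refine hasGen_of_hasGen_linftyToL2 (p'' := p (k + 2)) ?_ ?_ <;> rw [hp, hp] <;>
      exact hasGen_iterate_D hf _
  refine ⟨p 0, IsometryGroup.mem_smooth_of_hasGen_succ hgen 0, ?_, fun k => ?_⟩
  · refine (linftyToL2_coeFn (p 0)).symm.trans ?_
    rw [hp]
    exact hfg
  · rw [IsometryGroup.iterate_generator_eq hgen, hp, hp, Function.iterate_zero, id]

end RandomMedium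

lemma integral_abs_mul_le {Ω : Type*} [MeasurableSpace Ω] {μ : Measure Ω} (f g : Lp ℝ 2 μ) :
    ∫ ω, |f ω * g ω| ∂μ ≤ ‖f‖ * ‖g‖ :=
  calc ∫ ω, |f ω * g ω| ∂μ = inner ℝ |f| |g| := by
        rw [inner_eq_integral]
        refine integral_congr_ae ?_
        filter_upwards [Lp.coeFn_abs f, Lp.coeFn_abs g] with ω hf hg
        rw [hf, hg, abs_mul]
    _ ≤ ‖|f|‖ * ‖|g|‖ := real_inner_le_norm _ _
    _ = ‖f‖ * ‖g‖ := by rw [norm_abs_eq_norm, norm_abs_eq_norm]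

lemma levyMeasure_absolutelyContinuous (α : ℝ) : levyMeasure α ≪ volume :=
  withDensity_absolutelyContinuous _ _

instance sFinite_levyMeasure (α : ℝ) : SFinite (levyMeasure α) :=
  inferInstanceAs (SFinite (volume.withDensity _))

namespace RandomMedium

variable {Ω : Type*} [MeasurableSpace Ω] {M : RandomMedium Ω}

variable (M) in
/-- The Hilbert space `H¹(Ω)`. -/
abbrev H1 : Type _ := (M.shift 2).GraphSpace

lemma norm_iterate_generator_le {p : Lp ℝ ⊤ M.μ} {g : Ω → ℝ} {k : ℕ} {C : ℝ} (hC : 0 ≤ C)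
    (hp : ∀ k, linftyToL2 ((M.shift ⊤).generator^[k] p) = M.D^[k] (linftyToL2 p))
    (hpg : p =ᵐ[M.μ] g) (hg : M.DerivBoundedBy g k C) : ‖(M.shift ⊤).generator^[k] p‖ ≤ C := by
  obtain ⟨f, hfg, -, hf⟩ := hg
  have hfp : f = linftyToL2 p := Lp.ext (hfg.trans (hpg.symm.trans (linftyToL2_coeFn p).symm))
  rw [linfty_norm_le_iff hC]
  filter_upwards [hf, linftyToL2_coeFn ((M.shift ⊤).generator^[k] p)] with ω hω hpω
  rwa [← hpω, hp, ← hfp]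

end RandomMedium

namespace Coefficients

open RandomMedium IsometryGroup GraphSpace

variable {Ω : Type*} [MeasurableSpace Ω] {M : RandomMedium Ω} (A : Coefficients M)

/-- The potential `V` as an element of `L^∞`. -/
def potential : Lp ℝ ⊤ M.μ := (exists_smooth_of_memCinf A.smooth_V).choose

/-- The function `e^{r V}`. -/
def expV (r : ℝ) : Lp ℝ ⊤ M.μ := linftyExp (r • A.potential)

lemma expV_mem_smooth (r : ℝ) : A.expV r ∈ (M.shift ⊤).smooth :=
  linftyExp_mem_smooth
    (Submodule.smul_mem _ r (exists_smooth_of_memCinf A.smooth_V).choose_spec.1)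

lemma expV_coeFn (r : ℝ) : A.expV r =ᵐ[M.μ] fun ω => Real.exp (r * A.V ω) := by
  filter_upwards [linftyExp_coeFn (r • A.potential), Lp.coeFn_smul r A.potential,
    (exists_smooth_of_memCinf A.smooth_V).choose_spec.2.1] with ω hexp hsmul hV
  rw [expV, hexp, hsmul, Pi.smul_apply, smul_eq_mul]
  exact congrArg (fun v => Real.exp (r * v)) hV

lemma exists_le_expV (r : ℝ) : ∃ κ, 0 < κ ∧ ∀ᵐ ω ∂M.μ, κ ≤ A.expV r ω := by
  refine ⟨Real.exp (-‖r • A.potential‖), Real.exp_pos _, ?_⟩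
  filter_upwards [linftyExp_coeFn (r • A.potential), ae_abs_le_norm (r • A.potential)]
    with ω hexp hV
  rw [expV, hexp]
  exact Real.exp_le_exp.2 (abs_le.1 hV).1

lemma innerPi_eq (f g : M.L2) : A.innerPi f g = inner ℝ (linftyMul 2 (A.expV (-2)) f) g := by
  rw [inner_linftyMul_eq_integral, innerPi]
  refine integral_congr_ae ?_
  filter_upwards [A.expV_coeFn (-2)] with ω h
  rw [h]
  ring

lemma exists_diffusion : ∃ p ∈ (M.shift ⊤).smooth,
    p =ᵐ[M.μ] fun ω => A.σ ω ^ 2 * Real.exp (-2 * A.V ω) := by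
  obtain ⟨s, hs, hsσ, -⟩ := exists_smooth_of_memCinf A.smooth_σ
  refine ⟨linftyMul ⊤ s (linftyMul ⊤ s (A.expV (-2))),
    linftyMul_mem_smooth hs (linftyMul_mem_smooth hs (A.expV_mem_smooth (-2))), ?_⟩
  filter_upwards [linftyMul_coeFn s (A.expV (-2)), linftyMul_coeFn s (linftyMul ⊤ s (A.expV (-2))),
    hsσ, A.expV_coeFn (-2)] with ω h₁ h₂ hσ hV
  rw [h₂, h₁, hσ, hV]
  ring

/-- The weight `a e^{-2V}` of the diffusive part of the form. -/
def diffusion : Lp ℝ ⊤ M.μ := A.exists_diffusion.choose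

lemma diffusion_mem_smooth : A.diffusion ∈ (M.shift ⊤).smooth := A.exists_diffusion.choose_spec.1

lemma diffusion_coeFn : A.diffusion =ᵐ[M.μ] fun ω => A.σ ω ^ 2 * Real.exp (-2 * A.V ω) :=
  A.exists_diffusion.choose_spec.2

lemma exists_le_diffusion : ∃ κ, 0 < κ ∧ ∀ᵐ ω ∂M.μ, κ ≤ A.diffusion ω := by
  obtain ⟨K, hK, hσ, -⟩ := A.elliptic
  obtain ⟨κ, hκ, hV⟩ := A.exists_le_expV (-2)
  refine ⟨K⁻¹ * κ, by positivity, ?_⟩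
  filter_upwards [A.diffusion_coeFn, hσ, hV, A.expV_coeFn (-2)] with ω hdiff hσω hVω hexp
  rw [hdiff, ← hexp]
  exact mul_le_mul hσω.1 hVω hκ.le (sq_nonneg _)

lemma Bd_eq (u v : M.H1) :
    A.Bd (incl u) (incl v) = 1 / 2 * inner ℝ (linftyMul 2 A.diffusion (gen u)) (gen v) := by
  rw [Bd, (hasGen u).D_eq, (hasGen v).D_eq, inner_linftyMul_eq_integral]
  congr 1
  refine integral_congr_ae ?_
  filter_upwards [A.diffusion_coeFn] with ω h
  rw [h]
  ring

lemma exists_ae_derivBoundedBy_c (k : ℕ) :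
    ∃ C, 0 ≤ C ∧ ∀ᵐ z : ℝ, M.DerivBoundedBy (fun ω => A.c ω z) k C := by
  rcases Nat.eq_zero_or_pos k with rfl | hk
  · obtain ⟨K, hK, -, hc⟩ := A.elliptic
    have hmeas : MeasurableSet {p : Ω × ℝ | K⁻¹ ≤ A.c p.1 p.2 ∧ A.c p.1 p.2 ≤ K} :=
      (measurableSet_le measurable_const A.measurable_c).inter
        (measurableSet_le A.measurable_c measurable_const)
    refine ⟨K, hK.le, ?_⟩
    filter_upwards [A.smooth_c, (Measure.ae_ae_comm hmeas).1 hc] with z ⟨f, hfc, hf, _⟩ hcz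
    refine ⟨f, hfc, hf 0, ?_⟩
    filter_upwards [hfc, hcz] with ω hfω hcω
    rw [Function.iterate_zero, id, hfω, abs_of_nonneg ((inv_pos.2 hK).le.trans hcω.1)]
    exact hcω.2
  · obtain ⟨C, hC⟩ := A.smooth_c_bound k hk
    refine ⟨max C 0, le_max_right C 0, ?_⟩
    filter_upwards [hC] with z ⟨f, hfc, hf, hfC⟩
    exact ⟨f, hfc, hf, hfC.mono fun ω hω => hω.trans (le_max_left C 0)⟩

lemma ae_nonneg_c : ∀ᵐ z : ℝ, ∀ᵐ ω ∂M.μ, 0 ≤ A.c ω z := by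
  obtain ⟨K, hK, -, hc⟩ := A.elliptic
  have hmeas : MeasurableSet {p : Ω × ℝ | 0 ≤ A.c p.1 p.2} :=
    measurableSet_le measurable_const A.measurable_c
  refine (Measure.ae_ae_comm hmeas).1 ?_
  exact hc.mono fun ω hω => hω.mono fun z hz => (inv_pos.2 hK).le.trans hz.1

lemma exists_jumpCoeff : ∃ p : ℝ → Lp ℝ ⊤ M.μ, (∀ z, p z ∈ (M.shift ⊤).smooth) ∧
    (∀ k, ∃ C, ∀ z, ‖(M.shift ⊤).generator^[k] (p z)‖ ≤ C) ∧ (∀ z, ∀ᵐ ω ∂M.μ, 0 ≤ p z ω) ∧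
    ∀ᵐ z : ℝ, p z =ᵐ[M.μ] fun ω => A.c ω z := by
  choose C hC hbound using A.exists_ae_derivBoundedBy_c
  have hregular : ∀ᵐ z : ℝ, ∃ p ∈ (M.shift ⊤).smooth,
      (∀ k, ‖(M.shift ⊤).generator^[k] p‖ ≤ C k) ∧ (∀ᵐ ω ∂M.μ, 0 ≤ p ω) ∧
        p =ᵐ[M.μ] fun ω => A.c ω z := by
    filter_upwards [ae_all_iff.2 hbound, A.smooth_c, A.ae_nonneg_c] with z hzbound hz hz0
    obtain ⟨p, hp, hpc, hpD⟩ := exists_smooth_of_memCinf hz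
    refine ⟨p, hp, fun k => norm_iterate_generator_le (hC k) hpD hpc (hzbound k), ?_, hpc⟩
    filter_upwards [hpc, hz0] with ω hω hω0
    rwa [hω]
  have htotal : ∀ z : ℝ, ∃ p ∈ (M.shift ⊤).smooth,
      (∀ k, ‖(M.shift ⊤).generator^[k] p‖ ≤ C k) ∧ (∀ᵐ ω ∂M.μ, 0 ≤ p ω) ∧
        ((∃ p ∈ (M.shift ⊤).smooth, (∀ k, ‖(M.shift ⊤).generator^[k] p‖ ≤ C k) ∧
          (∀ᵐ ω ∂M.μ, 0 ≤ p ω) ∧ p =ᵐ[M.μ] fun ω => A.c ω z) → p =ᵐ[M.μ] fun ω => A.c ω z) := by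
    intro z
    by_cases hz : ∃ p ∈ (M.shift ⊤).smooth, (∀ k, ‖(M.shift ⊤).generator^[k] p‖ ≤ C k) ∧
        (∀ᵐ ω ∂M.μ, 0 ≤ p ω) ∧ p =ᵐ[M.μ] fun ω => A.c ω z
    · obtain ⟨p, hp, hpC, hp0, hpc⟩ := hz
      exact ⟨p, hp, hpC, hp0, fun _ => hpc⟩
    · refine ⟨0, Submodule.zero_mem _, fun k => ?_, ?_, fun h => absurd h hz⟩
      · rw [iterate_generator_eq (f := fun _ => (0 : Lp ℝ ⊤ M.μ)) (fun _ => HasGen.zero), norm_zero]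
        exact hC k
      · filter_upwards [Lp.coeFn_zero ℝ ⊤ M.μ] with ω hω
        rw [hω, Pi.zero_apply]
  choose p hp hpC hp0 hpc using htotal
  exact ⟨p, hp, fun k => ⟨C k, fun z => hpC z k⟩, hp0, hregular.mono hpc⟩

/-- The jump coefficient `c(·, z)` as an element of `L^∞`, for almost every `z`. -/
def jumpCoeff : ℝ → Lp ℝ ⊤ M.μ := A.exists_jumpCoeff.choose

lemma jumpCoeff_mem_smooth (z : ℝ) : A.jumpCoeff z ∈ (M.shift ⊤).smooth :=
  A.exists_jumpCoeff.choose_spec.1 z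

lemma exists_norm_iterate_generator_jumpCoeff_le (k : ℕ) :
    ∃ C, ∀ z, ‖(M.shift ⊤).generator^[k] (A.jumpCoeff z)‖ ≤ C :=
  A.exists_jumpCoeff.choose_spec.2.1 k

lemma jumpCoeff_nonneg (z : ℝ) : ∀ᵐ ω ∂M.μ, 0 ≤ A.jumpCoeff z ω :=
  A.exists_jumpCoeff.choose_spec.2.2.1 z

lemma ae_jumpCoeff_coeFn : ∀ᵐ z ∂levyMeasure A.α, A.jumpCoeff z =ᵐ[M.μ] fun ω => A.c ω z :=
  levyMeasure_absolutelyContinuous A.α A.exists_jumpCoeff.choose_spec.2.2.2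

/-- Multiplication by `D^k c(·, z)`. -/
def jumpOp (k : ℕ) (z : ℝ) : M.L2 →L[ℝ] M.L2 :=
  linftyMul 2 ((M.shift ⊤).generator^[k] (A.jumpCoeff z))

lemma smoothKernel_jumpOp : (M.shift 2).SmoothKernel (levyMeasure A.α) A.jumpOp where
  bound k := by
    obtain ⟨C, hC⟩ := A.exists_norm_iterate_generator_jumpCoeff_le k
    exact ⟨C, fun z => (norm_linftyMul_le _).trans (hC z)⟩
  isCommutatorSeq z := isCommutatorSeq_linftyMul (A.jumpCoeff_mem_smooth z)
  aemeasurable_zero f g := by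
    have hmeas : StronglyMeasurable
        (Function.uncurry fun (z : ℝ) (ω : Ω) => A.c ω z * f ω * g ω) :=
      (((A.measurable_c.comp measurable_swap).mul
        ((Lp.stronglyMeasurable f).measurable.comp measurable_snd)).mul
        ((Lp.stronglyMeasurable g).measurable.comp measurable_snd)).stronglyMeasurable
    refine (hmeas.integral_prod_right (ν := M.μ)).measurable.aemeasurable.congr ?_
    filter_upwards [A.ae_jumpCoeff_coeFn] with z hz
    rw [jumpOp, inner_linftyMul_eq_integral]
    refine integral_congr_ae ?_
    filter_upwards [hz] with ω hω
    rw [Function.iterate_zero, id, hω]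

/-- The integrand of the jump form. -/
def jumpDensity (f g : M.L2) (ω : Ω) (z : ℝ) : ℝ :=
  (f (M.τ z ω) - f ω) * (g (M.τ z ω) - g ω) * A.c ω z

lemma measurable_jumpDensity (f g : M.L2) : Measurable (Function.uncurry (A.jumpDensity f g)) := by
  have hτ : Measurable fun p : Ω × ℝ => M.τ p.2 p.1 := M.measurable_τ.comp measurable_swap
  have hf := (Lp.stronglyMeasurable f).measurable
  have hg := (Lp.stronglyMeasurable g).measurable
  exact (((hf.comp hτ).sub (hf.comp measurable_fst)).mul
    ((hg.comp hτ).sub (hg.comp measurable_fst))).mul A.measurable_c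

lemma ae_jumpDensity_coeFn (u v : M.H1) : ∀ᵐ z ∂levyMeasure A.α,
    (fun ω => A.jumpDensity (incl u) (incl v) ω z) =ᵐ[M.μ] fun ω =>
      (A.jumpOp 0 z ((M.shift 2).increment z u)) ω * ((M.shift 2).increment z v) ω := by
  filter_upwards [A.ae_jumpCoeff_coeFn] with z hz
  filter_upwards [linftyMul_coeFn (A.jumpCoeff z) ((M.shift 2).increment z u), hz,
    Lp.coeFn_sub (M.shift 2 z (incl u)) (incl u), Lp.coeFn_sub (M.shift 2 z (incl v)) (incl v),
    shift_coeFn z (incl u), shift_coeFn z (incl v)] with ω hmul hc hu hv hτu hτv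
  rw [jumpOp, Function.iterate_zero, id, hmul, increment_apply, increment_apply, hc, hu, hv,
    Pi.sub_apply, Pi.sub_apply, hτu, hτv, jumpDensity]
  ring

lemma integral_norm_jumpDensity_le (u v : M.H1) : ∃ C, ∀ᵐ z ∂levyMeasure A.α,
    ∫ ω, ‖A.jumpDensity (incl u) (incl v) ω z‖ ∂M.μ ≤ C * levyWeight z := by
  obtain ⟨C, hC⟩ := A.smoothKernel_jumpOp.bound 0
  have hC0 : 0 ≤ C := (norm_nonneg _).trans (hC 0)
  refine ⟨4 * C * ‖u‖ * ‖v‖, ?_⟩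
  filter_upwards [A.ae_jumpDensity_coeFn u v] with z hz
  calc ∫ ω, ‖A.jumpDensity (incl u) (incl v) ω z‖ ∂M.μ
      = ∫ ω, |(A.jumpOp 0 z ((M.shift 2).increment z u)) ω *
          ((M.shift 2).increment z v) ω| ∂M.μ := integral_congr_ae (hz.fun_comp norm)
    _ ≤ ‖A.jumpOp 0 z ((M.shift 2).increment z u)‖ * ‖(M.shift 2).increment z v‖ :=
        integral_abs_mul_le _ _
    _ ≤ C * (2 * min 1 |z| * ‖u‖) * (2 * min 1 |z| * ‖v‖) := by
        gcongr
        · exact (A.jumpOp 0 z).le_of_opNorm_le_of_le (hC z) (norm_increment_le z u)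
        · exact norm_increment_le z v
    _ = 4 * C * ‖u‖ * ‖v‖ * levyWeight z := by rw [levyWeight]; ring

lemma integrable_jumpDensity (u v : M.H1) :
    Integrable (Function.uncurry (A.jumpDensity (incl u) (incl v)))
      (M.μ.prod (levyMeasure A.α)) := by
  have hmeas := A.measurable_jumpDensity (incl u) (incl v)
  rw [integrable_prod_iff' hmeas.aestronglyMeasurable]
  constructor
  · filter_upwards [A.ae_jumpDensity_coeFn u v] with z hz
    exact ((Lp.memLp _).integrable_mul (Lp.memLp _)).congr hz.symm
  · obtain ⟨C, hC⟩ := A.integral_norm_jumpDensity_le u v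
    refine ((integrable_levyWeight A.α_pos A.α_lt).const_mul C).mono' ?_ ?_
    · exact (hmeas.stronglyMeasurable.norm.comp_measurable
        measurable_swap).integral_prod_right'.aestronglyMeasurable
    · filter_upwards [hC] with z hz
      rwa [Real.norm_eq_abs, abs_of_nonneg (integral_nonneg fun _ => norm_nonneg _)]

/-- The forms obtained from the jump form by differentiating its kernel. -/
def jumpForm : ℕ → M.H1 →L[ℝ] M.H1 →L[ℝ] ℝ :=
  A.smoothKernel_jumpOp.form (integrable_levyWeight A.α_pos A.α_lt)

lemma Bj_eq (u v : M.H1) : A.Bj (incl u) (incl v) = 1 / 2 * A.jumpForm 0 u v := by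
  rw [Bj, jumpForm, SmoothKernel.form_apply]
  congr 1
  refine (integral_integral_swap (A.integrable_jumpDensity u v)).trans (integral_congr_ae ?_)
  filter_upwards [A.ae_jumpDensity_coeFn u v] with z hz
  rw [inner_eq_integral]
  exact integral_congr_ae hz

lemma jumpForm_self_nonneg (u : M.H1) : 0 ≤ A.jumpForm 0 u u := by
  rw [jumpForm, SmoothKernel.form_apply]
  refine integral_nonneg fun z => ?_
  have h := le_inner_linftyMul (A.jumpCoeff_nonneg z) ((M.shift 2).increment z u)
  rwa [zero_mul] at h

variable {ε lam : ℝ}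

/-- The forms obtained from `(·, ·)_π` by differentiating its weight. -/
def massForm (k : ℕ) : M.H1 →L[ℝ] M.H1 →L[ℝ] ℝ :=
  innerForm ((linftyMul 2 ((M.shift ⊤).generator^[k] (A.expV (-2)))).comp incl) incl

/-- The forms obtained from `2 B^d` by differentiating its coefficient. -/
def diffusionForm (k : ℕ) : M.H1 →L[ℝ] M.H1 →L[ℝ] ℝ :=
  innerForm ((linftyMul 2 ((M.shift ⊤).generator^[k] A.diffusion)).comp gen) gen

/-- The form `B_λ^ε` on `H¹(Ω)`, for `k = 0`, followed by the forms obtained by differentiating its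
coefficients `k` times. -/
def form (ε lam : ℝ) : ℕ → M.H1 →L[ℝ] M.H1 →L[ℝ] ℝ :=
  lam • A.massForm + (1 / 2 : ℝ) • A.diffusionForm + (ε ^ (2 - A.α) * (1 / 2)) • A.jumpForm

lemma form_zero_apply (u v : M.H1) : A.form ε lam 0 u v = A.B ε lam (incl u) (incl v) := by
  rw [B, Bj_eq, Bd_eq, innerPi_eq]
  simp only [form, massForm, diffusionForm, Pi.add_apply, Pi.smul_apply, _root_.add_apply,
    _root_.smul_apply, smul_eq_mul, innerForm_apply, ContinuousLinearMap.comp_apply,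
    Function.iterate_zero, id]
  ring

variable (ε lam) in
lemma smoothForms_form : (M.shift 2).SmoothForms (A.form ε lam) :=
  (((isCommutatorSeq_linftyMul (A.expV_mem_smooth (-2))).smoothForms_incl.const_smul lam).add
    ((isCommutatorSeq_linftyMul A.diffusion_mem_smooth).smoothForms_gen.const_smul (1 / 2))).add
    ((A.smoothKernel_jumpOp.smoothForms _).const_smul _)

lemma exists_coercive_form (hε : 0 < ε) (hlam : 0 < lam) :
    ∃ κ, 0 < κ ∧ ∀ u, κ * ‖u‖ ^ 2 ≤ A.form ε lam 0 u u := by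
  obtain ⟨κ, hκ, hκV⟩ := A.exists_le_expV (-2)
  obtain ⟨κ', hκ', hκσ⟩ := A.exists_le_diffusion
  refine ⟨min (lam * κ) (1 / 2 * κ'), by positivity, fun u => ?_⟩
  calc min (lam * κ) (1 / 2 * κ') * ‖u‖ ^ 2
      = min (lam * κ) (1 / 2 * κ') * ‖incl u‖ ^ 2 + min (lam * κ) (1 / 2 * κ') * ‖gen u‖ ^ 2 := by
        rw [norm_sq_eq, mul_add]
    _ ≤ lam * (κ * ‖incl u‖ ^ 2) + 1 / 2 * (κ' * ‖gen u‖ ^ 2) + 0 := by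
        rw [add_zero, ← mul_assoc, ← mul_assoc]
        gcongr
        · exact min_le_left _ _
        · exact min_le_right _ _
    _ ≤ lam * A.innerPi (incl u) (incl u) + A.Bd (incl u) (incl u) +
          ε ^ (2 - A.α) * A.Bj (incl u) (incl u) := by
        rw [innerPi_eq, Bd_eq, Bj_eq]
        have hjump := A.jumpForm_self_nonneg u
        gcongr
        · exact le_inner_linftyMul hκV (incl u)
        · exact le_inner_linftyMul hκσ (gen u)
        · positivity
    _ = A.form ε lam 0 u u := A.form_zero_apply u u |>.symm

end Coefficients

namespace IsometryGroup

variable {E : Type*} [NormedAddCommGroup E] [NormedSpace ℝ E] {U : IsometryGroup E}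
  [hU : U.StronglyContinuous] {φ : ℝ → ℝ}

lemma integrable_smul_apply (hφ : Continuous φ) (hc : HasCompactSupport φ) (f : E) :
    Integrable fun x => φ x • U x f :=
  (hφ.smul (hU.continuous_apply f)).integrable_of_hasCompactSupport hc.smul_right

variable (U) in
/-- The regularization `∫ φ(x) U_x f dx` of a vector `f` by a compactly supported weight `φ`. -/
def mollify (hφ : Continuous φ) (hc : HasCompactSupport φ) : E →L[ℝ] E :=
  LinearMap.mkContinuous
    { toFun f := ∫ x, φ x • U x f
      map_add' f g := by
        rw [← integral_add (integrable_smul_apply hφ hc f) (integrable_smul_apply hφ hc g)]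
        simp only [map_add, smul_add]
      map_smul' r f := by
        rw [RingHom.id_apply, ← integral_smul]
        simp only [map_smul, smul_comm r] }
    (∫ x, |φ x|) fun f => (norm_integral_le_integral_norm _).trans_eq <| by
      rw [← integral_mul_const]
      simp only [norm_smul, LinearIsometry.norm_map, Real.norm_eq_abs]

lemma mollify_apply (hφ : Continuous φ) (hc : HasCompactSupport φ) (f : E) :
    U.mollify hφ hc f = ∫ x, φ x • U x f := rfl

variable [CompleteSpace E]

lemma apply_mollify (hφ : Continuous φ) (hc : HasCompactSupport φ) (y : ℝ) (f : E) :
    U y (U.mollify hφ hc f) = U.mollify hφ hc (U y f) := by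
  refine ((U y).toContinuousLinearMap.integral_comp_comm (integrable_smul_apply hφ hc f)).symm.trans
    (integral_congr_ae (Eventually.of_forall fun x => ?_))
  exact ((U y).map_smul (φ x) _).trans (by rw [apply_comm])

lemma HasGen.mollify (hφ : Continuous φ) (hc : HasCompactSupport φ) {f g : E} (h : U.HasGen f g) :
    U.HasGen (U.mollify hφ hc f) (U.mollify hφ hc g) :=
  h.map _ fun x f => (apply_mollify hφ hc x f).symm

lemma convolution_apply_neg (hφ : Continuous φ) (hc : HasCompactSupport φ) (f : E) (y : ℝ) :
    convolution φ (fun x => U (-x) f) (ContinuousLinearMap.lsmul ℝ ℝ) volume y =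
      U (-y) (U.mollify hφ hc f) := by
  rw [apply_mollify, mollify_apply, convolution]
  congr 1 with x
  rw [ContinuousLinearMap.lsmul_apply, ← add_apply, neg_sub, sub_eq_add_neg]

lemma hasGen_mollify (hφ : ContDiff ℝ (⊤ : ℕ∞) φ) (hc : HasCompactSupport φ) (f : E) :
    U.HasGen (U.mollify hφ.continuous hc f)
      (-(U.mollify (hφ.continuous_deriv (by simp)) hc.deriv f)) := by
  have hcont : Continuous fun x : ℝ => U (-x) f := (hU.continuous_apply f).comp continuous_neg
  have hconv := hc.hasDerivAt_convolution_left (ContinuousLinearMap.lsmul ℝ ℝ) (μ := volume)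
    (hφ.of_le (by simp)) hcont.locallyIntegrable (0 : ℝ)
  rw [convolution_apply_neg (hφ.continuous_deriv (by simp)) hc.deriv,
    funext (convolution_apply_neg hφ.continuous hc f), neg_zero, zero_apply, ← neg_zero] at hconv
  simpa only [HasGen, Function.comp_def, neg_neg, neg_one_smul]
    using HasDerivAt.scomp (0 : ℝ) hconv (hasDerivAt_neg (0 : ℝ))

lemma tendsto_mollify_contDiffBump {φ : ℕ → ContDiffBump (0 : ℝ)}
    (hφ : Tendsto (fun n => (φ n).rOut) atTop (𝓝 0)) (f : E) :
    Tendsto (fun n => U.mollify ((φ n).contDiff_normed (n := ⊤) (μ := volume)).continuous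
      (φ n).hasCompactSupport_normed f) atTop (𝓝 f) := by
  have hcont : Continuous fun x : ℝ => U (-x) f := (hU.continuous_apply f).comp continuous_neg
  simpa only [fun n => convolution_apply_neg (U := U)
    ((φ n).contDiff_normed (n := ⊤) (μ := volume)).continuous (φ n).hasCompactSupport_normed f 0,
    neg_zero, zero_apply] using
    ContDiffBump.convolution_tendsto_right_of_continuous (μ := volume) hφ hcont (0 : ℝ)

end IsometryGroup

namespace RandomMedium

open IsometryGroup GraphSpace

variable {Ω : Type*} [MeasurableSpace Ω] {M : RandomMedium Ω} {φ : ℝ → ℝ}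

lemma mollify_coeFn (hφ : Continuous φ) (hc : HasCompactSupport φ) {f : M.L2}
    {g : Ω → ℝ} (hg : Measurable g) {C : ℝ} (hC : ∀ ω, ‖g ω‖ ≤ C) (hfg : f =ᵐ[M.μ] g) :
    (M.shift 2).mollify hφ hc f =ᵐ[M.μ] fun ω => ∫ x, g (M.τ x ω) * φ x := by
  have hjoint : Integrable (fun p : Ω × ℝ => g (M.τ p.2 p.1) * φ p.2) (M.μ.prod volume) :=
    ((hφ.integrable_of_hasCompactSupport hc).comp_snd M.μ).bdd_mul (c := C)
      (hg.comp (M.measurable_τ.comp measurable_swap)).aestronglyMeasurable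
      (Eventually.of_forall fun p => hC _)
  refine Integrable.ae_eq_of_forall_setIntegral_eq _ _ ((Lp.memLp _).integrable (by norm_num))
    hjoint.integral_prod_left fun s hs hμs => ?_
  have hfiber : ∀ x, inner ℝ (indicatorConstLp 2 hs hμs.ne (1 : ℝ)) (φ x • M.shift 2 x f) =
      ∫ ω in s, g (M.τ x ω) * φ x ∂M.μ := fun x => by
    rw [inner_smul_right, L2.inner_indicatorConstLp_one, integral_mul_const, mul_comm]
    congr 1
    refine setIntegral_congr_ae hs ?_
    filter_upwards [shift_coeFn x f, ae_τ x hfg] with ω hshift hfgω _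
    rw [hshift, hfgω]
  have hswap : Integrable (Function.uncurry fun x ω => g (M.τ x ω) * φ x)
      (volume.prod (M.μ.restrict s)) := by
    have hrestrict := hjoint.restrict (s := s ×ˢ Set.univ)
    rw [← Measure.prod_restrict, Measure.restrict_univ] at hrestrict
    exact hrestrict.swap
  calc ∫ ω in s, (M.shift 2).mollify hφ hc f ω ∂M.μ
      = ∫ x, inner ℝ (indicatorConstLp 2 hs hμs.ne (1 : ℝ)) (φ x • M.shift 2 x f) := by
        rw [← L2.inner_indicatorConstLp_one hs hμs.ne, mollify_apply,
          ← integral_inner (integrable_smul_apply hφ hc f)]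
    _ = ∫ x, ∫ ω in s, g (M.τ x ω) * φ x ∂M.μ := by simp_rw [hfiber]
    _ = ∫ ω in s, (∫ x, g (M.τ x ω) * φ x) ∂M.μ := integral_integral_swap hswap

variable (M) in
/-- The elements of `H¹(Ω)` that lie in `𝒞`. -/
def testH1 : Set M.H1 := {u | incl u ∈ M.testSpace}

lemma toGraph_mollify_mem_closure_testH1 (hφ : ContDiff ℝ (⊤ : ℕ∞) φ) (hc : HasCompactSupport φ)
    (f : M.L2) : (hasGen_mollify (U := M.shift 2) hφ hc f).toGraph ∈ closure M.testH1 := by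
  have hcont : Continuous fun f => (hasGen_mollify (U := M.shift 2) hφ hc f).toGraph :=
    continuous_iff_continuousAt.2 fun f => tendsto_iff.2
      ⟨((M.shift 2).mollify hφ.continuous hc).continuous.tendsto f,
        ((M.shift 2).mollify (hφ.continuous_deriv (by simp)) hc.deriv).continuous.neg.tendsto f⟩
  refine (Lp.simpleFunc.denseRange (E := ℝ) (μ := M.μ) (p := 2) (by norm_num)).induction_on
    (p := fun f => (hasGen_mollify (U := M.shift 2) hφ hc f).toGraph ∈ closure M.testH1) f
    (isClosed_closure.preimage hcont) fun s => subset_closure ?_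
  obtain ⟨C, hC⟩ := (Lp.simpleFunc.toSimpleFunc s).exists_forall_norm_le
  refine Submodule.subset_span ⟨Lp.simpleFunc.toSimpleFunc s, φ,
    MemLp.of_bound (SimpleFunc.aestronglyMeasurable _) C (Eventually.of_forall hC), hφ, hc, ?_⟩
  exact mollify_coeFn hφ.continuous hc (Lp.simpleFunc.measurable s) hC
    (Lp.simpleFunc.toSimpleFunc_eq_toFun s).symm

variable (M) in
lemma dense_testH1 : Dense M.testH1 := fun u => by
  let φ : ℕ → ContDiffBump (0 : ℝ) := fun n =>
    ⟨1 / ((n : ℝ) + 2), 1 / ((n : ℝ) + 1), by positivity,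
      one_div_lt_one_div_of_lt (by positivity) (by linarith)⟩
  have hφ : ∀ n, ContDiff ℝ (⊤ : ℕ∞) ((φ n).normed volume) := fun n => (φ n).contDiff_normed
  have hc : ∀ n, HasCompactSupport ((φ n).normed volume) := fun n => (φ n).hasCompactSupport_normed
  have hφ0 : Tendsto (fun n => (φ n).rOut) atTop (𝓝 0) := tendsto_one_div_add_atTop_nhds_zero_nat
  have hmollify : ∀ n, (hasGen_mollify (hφ n) (hc n) (incl u)).toGraph =
      ((hasGen u).mollify (hφ n).continuous (hc n)).toGraph := fun n => ext rfl
  refine isClosed_closure.mem_of_tendsto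
    (f := fun n => (hasGen_mollify (hφ n) (hc n) (incl u)).toGraph) (b := atTop) ?_
    (Eventually.of_forall fun n => toGraph_mollify_mem_closure_testH1 (hφ n) (hc n) (incl u))
  simp_rw [hmollify]
  exact tendsto_iff.2
    ⟨tendsto_mollify_contDiffBump hφ0 (incl u), tendsto_mollify_contDiffBump hφ0 (gen u)⟩

end RandomMedium

namespace Coefficients

open RandomMedium IsometryGroup GraphSpace

variable {Ω : Type*} [MeasurableSpace Ω] {M : RandomMedium Ω} (A : Coefficients M)

lemma formDomain_eq (ε lam : ℝ) : A.formDomain ε lam = M.domD := by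
  refine Set.Subset.antisymm (fun f hf => hf.1) fun f hf => ⟨hf, ?_⟩
  obtain ⟨g, hg⟩ := mem_domD_iff.1 hf
  obtain ⟨v, hv, hvf⟩ := mem_closure_iff_seq_limit.1 (dense_testH1 M hg.toGraph)
  refine ⟨fun n => incl (v n), hv, ?_⟩
  have hform : ∀ n, A.B ε lam (incl (v n) - f) (incl (v n) - f) =
      A.form ε lam 0 (v n - hg.toGraph) (v n - hg.toGraph) := fun n => by
    rw [form_zero_apply, map_sub, incl_toGraph]
  have hcont : Continuous fun w : M.H1 =>
      A.form ε lam 0 (w - hg.toGraph) (w - hg.toGraph) := by fun_prop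
  simpa only [hform, sub_self, map_zero, Function.comp_def] using (hcont.tendsto _).comp hvf

end Coefficients

section CoerciveForm

variable {H : Type*} [NormedAddCommGroup H] [InnerProductSpace ℝ H] {b : H →L[ℝ] H →L[ℝ] ℝ}
  {κ : ℝ}

lemma eq_zero_of_coercive (hκ : 0 < κ) (hb : ∀ u, κ * ‖u‖ ^ 2 ≤ b u u) {u : H} (hu : b u u ≤ 0) :
    u = 0 := by
  have hsq : ‖u‖ ^ 2 ≤ 0 := nonpos_of_mul_nonpos_right ((hb u).trans hu) hκ
  exact norm_eq_zero.1 (pow_eq_zero_iff two_ne_zero |>.1 (hsq.antisymm (sq_nonneg _)))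

lemma eq_of_coercive (hκ : 0 < κ) (hb : ∀ u, κ * ‖u‖ ^ 2 ≤ b u u) {u u' : H}
    (h : ∀ v, b u v = b u' v) : u = u' :=
  sub_eq_zero.1 <| eq_zero_of_coercive hκ hb <| by
    rw [b.map_sub₂, h, sub_self]

lemma eq_of_coercive_of_apply_self_le (hκ : 0 < κ) (hb : ∀ u, κ * ‖u‖ ^ 2 ≤ b u u)
    (hsymm : ∀ u v, b u v = b v u) {u w : H} (hle : b w w ≤ b u u) (hpos : 0 ≤ b u (w - u)) :
    w = u := by
  refine sub_eq_zero.1 (eq_zero_of_coercive hκ hb ?_)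
  have hexpand : b (w - u) (w - u) = b w w - b u u - 2 * b u (w - u) := by
    rw [b.map_sub₂, map_sub, map_sub, hsymm w u]
    ring
  linarith

end CoerciveForm

namespace RandomMedium

open IsometryGroup GraphSpace

variable {Ω : Type*} [MeasurableSpace Ω] {M : RandomMedium Ω}

lemma shift_abs (x : ℝ) (f : M.L2) : M.shift 2 x |f| = |M.shift 2 x f| := Lp.ext <| by
  filter_upwards [shift_coeFn x |f|, Lp.coeFn_abs (M.shift 2 x f), shift_coeFn x f,
    ae_τ x (Lp.coeFn_abs f)] with ω h₁ h₂ h₃ h₄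
  rw [h₁, h₂, h₃, h₄]

lemma abs_shift_abs_sub_le (x : ℝ) (f : M.L2) :
    ∀ᵐ ω ∂M.μ, |(M.shift 2 x |f| - |f|) ω| ≤ |(M.shift 2 x f - f) ω| := by
  rw [shift_abs]
  filter_upwards [Lp.coeFn_sub |M.shift 2 x f| |f|, Lp.coeFn_sub (M.shift 2 x f) f,
    Lp.coeFn_abs (M.shift 2 x f), Lp.coeFn_abs f] with ω h₁ h₂ h₃ h₄
  rw [h₁, h₂, Pi.sub_apply, Pi.sub_apply, h₃, h₄]
  exact abs_abs_sub_abs_le_abs_sub _ _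

lemma exists_incl_eq_abs (u : M.H1) : ∃ w : M.H1, incl w = |incl u| := by
  obtain ⟨g, hg⟩ := exists_hasGen_of_norm_apply_sub_le (U := M.shift 2) (v := |incl u|)
    fun x => (norm_abs_sub_abs (M.shift 2 x (incl u)) (incl u)).trans
      ((hasGen u).norm_apply_sub_le x) |>.trans' (by rw [shift_abs])
  exact ⟨hg.toGraph, rfl⟩

lemma shift_const (x c : ℝ) : M.shift 2 x (Lp.const 2 M.μ c) = Lp.const 2 M.μ c := Lp.ext <| by
  filter_upwards [shift_coeFn x (Lp.const 2 M.μ c), Lp.coeFn_const 2 M.μ c,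
    ae_τ x (Lp.coeFn_const 2 M.μ c)] with ω h₁ h₂ h₃
  rw [h₁, h₂, h₃, Function.const_apply, Function.const_apply]

variable (M) in
lemma hasGen_const (c : ℝ) : (M.shift 2).HasGen (Lp.const 2 M.μ c) 0 := by
  simpa only [HasGen, shift_const] using hasDerivAt_const (0 : ℝ) (Lp.const 2 M.μ c)

end RandomMedium

lemma inner_linftyMul_abs_mono {Ω : Type*} [MeasurableSpace Ω] {μ : Measure Ω} {p : Lp ℝ ⊤ μ}
    (hp : ∀ᵐ ω ∂μ, 0 ≤ p ω) {f g : Lp ℝ 2 μ} (hfg : ∀ᵐ ω ∂μ, |f ω| ≤ |g ω|) :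
    inner ℝ (linftyMul 2 p f) f ≤ inner ℝ (linftyMul 2 p g) g := by
  refine inner_linftyMul_mono ?_
  filter_upwards [hp, hfg] with ω hpω hω
  rw [mul_assoc, mul_assoc]
  exact mul_le_mul_of_nonneg_left (abs_le_iff_mul_self_le.1 hω) hpω

namespace Coefficients

open RandomMedium IsometryGroup GraphSpace

variable {Ω : Type*} [MeasurableSpace Ω] {M : RandomMedium Ω} (A : Coefficients M)

lemma linftyMul_expV_linftyMul_expV (r s : ℝ) (f : M.L2) :
    linftyMul 2 (A.expV r) (linftyMul 2 (A.expV s) f) = linftyMul 2 (A.expV (r + s)) f :=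
  Lp.ext <| by
    filter_upwards [linftyMul_coeFn (A.expV r) (linftyMul 2 (A.expV s) f),
      linftyMul_coeFn (A.expV s) f, linftyMul_coeFn (A.expV (r + s)) f, A.expV_coeFn r,
      A.expV_coeFn s, A.expV_coeFn (r + s)] with ω h₁ h₂ h₃ hr hs hrs
    rw [h₁, h₂, h₃, hr, hs, hrs, add_mul, Real.exp_add, mul_assoc]

lemma linftyMul_expV_cancel {r s : ℝ} (h : r + s = 0) (f : M.L2) :
    linftyMul 2 (A.expV r) (linftyMul 2 (A.expV s) f) = f := by
  rw [linftyMul_expV_linftyMul_expV, h]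
  refine Lp.ext ?_
  filter_upwards [linftyMul_coeFn (A.expV 0) f, A.expV_coeFn 0] with ω hω h0
  rw [hω, h0, zero_mul, Real.exp_zero, one_mul]

lemma innerPi_comm (f g : M.L2) : A.innerPi f g = A.innerPi g f := by
  simp only [innerPi, mul_comm (f _) (g _)]

lemma innerPi_nonneg {f g : M.L2} (hf : 0 ≤ f) (hg : 0 ≤ g) : 0 ≤ A.innerPi f g := by
  refine integral_nonneg_of_ae ?_
  filter_upwards [(Lp.coeFn_nonneg f).2 hf, (Lp.coeFn_nonneg g).2 hg] with ω hfω hgω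
  exact mul_nonneg (mul_nonneg hfω hgω) (Real.exp_pos _).le

lemma innerPi_abs (f : M.L2) : A.innerPi |f| |f| = A.innerPi f f := by
  refine integral_congr_ae ?_
  filter_upwards [Lp.coeFn_abs f] with ω hω
  rw [hω, abs_mul_abs_self]

section Form

variable {ε lam : ℝ}

lemma form_comm (u v : M.H1) : A.form ε lam 0 u v = A.form ε lam 0 v u := by
  simp only [form_zero_apply, B, innerPi, Bd, Bj, mul_comm ((incl u : M.L2) _),
    mul_comm ((incl u : M.L2) _ - _), mul_assoc, mul_left_comm ((M.D (incl u)) _)]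

lemma form_eq_add (ε lam lam' : ℝ) (u v : M.H1) :
    A.form ε lam 0 u v = A.form ε lam' 0 u v + (lam - lam') * A.innerPi (incl u) (incl v) := by
  simp only [form_zero_apply, B]
  ring

lemma ae_nonneg_diffusion : ∀ᵐ ω ∂M.μ, 0 ≤ A.diffusion ω := by
  obtain ⟨κ, hκ, h⟩ := A.exists_le_diffusion
  exact h.mono fun ω hω => hκ.le.trans hω

lemma Bd_self_nonneg (u : M.H1) : 0 ≤ A.Bd (incl u) (incl u) := by
  rw [Bd_eq]
  have h := le_inner_linftyMul A.ae_nonneg_diffusion (gen u)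
  rw [zero_mul] at h
  positivity

lemma Bj_self_nonneg (u : M.H1) : 0 ≤ A.Bj (incl u) (incl u) := by
  rw [Bj_eq]
  exact mul_nonneg (by norm_num) (A.jumpForm_self_nonneg u)

lemma Bd_abs_le {u w : M.H1} (hw : incl w = |incl u|) :
    A.Bd (incl w) (incl w) ≤ A.Bd (incl u) (incl u) := by
  rw [Bd_eq, Bd_eq]
  refine mul_le_mul_of_nonneg_left ?_ (by norm_num)
  have hlim : ∀ v : M.H1, Tendsto (fun h : ℝ => inner ℝ
      (linftyMul 2 A.diffusion (h⁻¹ • (M.shift 2 h (incl v) - incl v)))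
      (h⁻¹ • (M.shift 2 h (incl v) - incl v))) (𝓝[≠] 0)
      (𝓝 (inner ℝ (linftyMul 2 A.diffusion (gen v)) (gen v))) := fun v =>
    (((linftyMul 2 A.diffusion).continuous.tendsto _).comp
      (hasGen_iff_tendsto.1 (hasGen v))).inner (hasGen_iff_tendsto.1 (hasGen v))
  refine le_of_tendsto_of_tendsto (hlim w) (hlim u) (Eventually.of_forall fun h =>
    inner_linftyMul_abs_mono A.ae_nonneg_diffusion ?_)
  rw [hw]
  filter_upwards [abs_shift_abs_sub_le h (incl u),
    Lp.coeFn_smul h⁻¹ (M.shift 2 h |incl u| - |incl u|),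
    Lp.coeFn_smul h⁻¹ (M.shift 2 h (incl u) - incl u)] with ω hle habs hu
  rw [habs, hu, Pi.smul_apply, Pi.smul_apply, smul_eq_mul, smul_eq_mul, abs_mul, abs_mul]
  exact mul_le_mul_of_nonneg_left hle (abs_nonneg _)

lemma Bj_abs_le {u w : M.H1} (hw : incl w = |incl u|) :
    A.Bj (incl w) (incl w) ≤ A.Bj (incl u) (incl u) := by
  rw [Bj_eq, Bj_eq, jumpForm, SmoothKernel.form_apply, SmoothKernel.form_apply]
  have hint := fun u =>
    A.smoothKernel_jumpOp.integrable (integrable_levyWeight A.α_pos A.α_lt) 0 u u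
  refine mul_le_mul_of_nonneg_left (integral_mono (hint w) (hint u) fun z => ?_) (by norm_num)
  refine inner_linftyMul_abs_mono (A.jumpCoeff_nonneg z) ?_
  rw [increment_apply, increment_apply, hw]
  exact abs_shift_abs_sub_le z (incl u)

/-- The first Beurling–Deny criterion. -/
lemma form_abs_le (hε : 0 < ε) {u w : M.H1} (hw : incl w = |incl u|) :
    A.form ε lam 0 w w ≤ A.form ε lam 0 u u := by
  have hBd := A.Bd_abs_le hw
  have hBj := A.Bj_abs_le hw
  rw [form_zero_apply, form_zero_apply, B, B, hw, innerPi_abs, ← hw]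
  gcongr

lemma form_const (c : ℝ) (v : M.H1) :
    A.form ε lam 0 (hasGen_const M c).toGraph v =
      lam * A.innerPi (Lp.const 2 M.μ c) (incl v) := by
  have hincr : ∀ z, (M.shift 2).increment z (hasGen_const M c).toGraph = 0 := fun z => by
    rw [increment_apply, incl_toGraph, shift_const, sub_self]
  have hBd : A.Bd (incl (hasGen_const M c).toGraph) (incl v) = 0 := by
    rw [Bd_eq, gen_toGraph, map_zero, inner_zero_left, mul_zero]
  have hBj : A.Bj (incl (hasGen_const M c).toGraph) (incl v) = 0 := by
    rw [Bj_eq, jumpForm, SmoothKernel.form_apply]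
    simp only [hincr, map_zero, inner_zero_left, integral_zero, mul_zero]
  rw [form_zero_apply, B, hBd, hBj, incl_toGraph, mul_zero, add_zero, add_zero]

end Form

section Resolvent

variable {ε lam lam' : ℝ} (hε : 0 < ε) (hlam : 0 < lam) (hlam' : 0 < lam')

lemma isCoercive_form (hε : 0 < ε) (hlam : 0 < lam) : IsCoercive (A.form ε lam 0) := by
  obtain ⟨κ, hκ, h⟩ := A.exists_coercive_form hε hlam
  exact ⟨κ, hκ, fun u => by simpa only [mul_assoc, ← sq] using h u⟩

/-- The Lax–Milgram solution in `H¹(Ω)` of `B_λ^ε(u, ·) = (f, ·)_π`. -/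
def weakSolution : M.L2 →L[ℝ] M.H1 :=
  (A.isCoercive_form hε hlam).continuousLinearEquivOfBilin.symm.toContinuousLinearMap ∘L
    (ContinuousLinearMap.adjoint incl ∘L linftyMul 2 (A.expV (-2)))

lemma form_weakSolution (f : M.L2) (v : M.H1) :
    A.form ε lam 0 (A.weakSolution hε hlam f) v = A.innerPi f (incl v) := by
  rw [← (A.isCoercive_form hε hlam).continuousLinearEquivOfBilin_apply, weakSolution,
    ContinuousLinearMap.comp_apply, ContinuousLinearEquiv.coe_coe,
    ContinuousLinearEquiv.apply_symm_apply, ContinuousLinearMap.comp_apply,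
    ContinuousLinearMap.adjoint_inner_left, innerPi_eq]

lemma eq_weakSolution {f : M.L2} {u : M.H1}
    (h : ∀ v, A.form ε lam 0 u v = A.innerPi f (incl v)) : u = A.weakSolution hε hlam f := by
  obtain ⟨κ, hκ, hcoercive⟩ := A.exists_coercive_form hε hlam
  exact eq_of_coercive hκ hcoercive fun v => (h v).trans (A.form_weakSolution hε hlam f v).symm

/-- `G_λ^ε` as a bounded operator. -/
def resolvent : M.L2 →L[ℝ] M.L2 := incl ∘L A.weakSolution hε hlam

lemma isResolventSolution_iff {f u : M.L2} : A.IsResolventSolution ε lam f u ↔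
    ∃ v : M.H1, incl v = u ∧ ∀ w, A.form ε lam 0 v w = A.innerPi f (incl w) := by
  simp only [IsResolventSolution, formDomain_eq, form_zero_apply, mem_domD_iff]
  constructor
  · rintro ⟨⟨g, hg⟩, h⟩
    exact ⟨hg.toGraph, rfl, fun w => h _ ⟨_, hasGen w⟩⟩
  · rintro ⟨v, rfl, h⟩
    exact ⟨⟨_, hasGen v⟩, fun ψ ⟨_, hψ⟩ => h hψ.toGraph⟩

lemma isResolventSolution_iff_eq_resolvent {f u : M.L2} :
    A.IsResolventSolution ε lam f u ↔ u = A.resolvent hε hlam f := by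
  rw [isResolventSolution_iff]
  constructor
  · rintro ⟨v, rfl, h⟩
    rw [A.eq_weakSolution hε hlam h, resolvent, ContinuousLinearMap.comp_apply]
  · rintro rfl
    exact ⟨_, rfl, A.form_weakSolution hε hlam f⟩

lemma resolvent_apply (f : M.L2) : A.resolvent hε hlam f = A.G ε lam f :=
  ((A.isResolventSolution_iff_eq_resolvent hε hlam).1 (Classical.epsilon_spec
    ⟨_, (A.isResolventSolution_iff_eq_resolvent hε hlam).2 rfl⟩)).symm

lemma eq_resolvent {f : M.L2} {u : M.H1}
    (h : ∀ v, A.form ε lam 0 u v = A.innerPi f (incl v)) : incl u = A.resolvent hε hlam f := by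
  rw [A.eq_weakSolution hε hlam h, resolvent, ContinuousLinearMap.comp_apply]

lemma innerPi_resolvent_left (f g : M.L2) :
    A.innerPi (A.resolvent hε hlam f) g = A.innerPi f (A.resolvent hε hlam g) := by
  rw [innerPi_comm, resolvent, ContinuousLinearMap.comp_apply, ContinuousLinearMap.comp_apply,
    ← A.form_weakSolution hε hlam, ← A.form_weakSolution hε hlam, form_comm]

lemma resolvent_mem_domPow {m : ℕ} {f : M.L2} (hf : f ∈ (M.shift 2).domPow m) :
    A.resolvent hε hlam f ∈ (M.shift 2).domPow (m + 2) := by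
  obtain ⟨κ, hκ, hcoercive⟩ := A.exists_coercive_form hε hlam
  refine (A.smoothForms_form ε lam).mem_domPow_of_repr hκ hcoercive
    (u := A.weakSolution hε hlam f) (w := linftyMul 2 (A.expV (-2)) f) (fun v => ?_)
    (linftyMul_mem_domPow (mem_smooth.1 (A.expV_mem_smooth _) m) hf)
  rw [form_weakSolution, innerPi_eq]

lemma exists_resolvent_eq {m : ℕ} {u : M.L2} (hu : u ∈ (M.shift 2).domPow (m + 2)) :
    ∃ f ∈ (M.shift 2).domPow m, A.resolvent hε hlam f = u := by
  obtain ⟨u', huu', -⟩ := mem_domPow_succ.1 hu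
  obtain ⟨w, hw, hform⟩ := (A.smoothForms_form ε lam).exists_repr_mem_domPow m 0
    (u := huu'.toGraph) hu
  refine ⟨linftyMul 2 (A.expV 2) w, linftyMul_mem_domPow (mem_smooth.1 (A.expV_mem_smooth _) m) hw,
    (A.eq_resolvent hε hlam (u := huu'.toGraph) fun v => ?_).symm⟩
  rw [innerPi_eq, linftyMul_expV_cancel _ (by norm_num), hform]

lemma range_resolvent : Set.range (A.resolvent hε hlam) = (M.shift 2).domPow 2 :=
  Set.Subset.antisymm
    (Set.range_subset_iff.2 fun _ => A.resolvent_mem_domPow hε hlam (mem_domPow_zero _))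
    fun _ hu => let ⟨f, _, h⟩ := A.exists_resolvent_eq hε hlam (m := 0) hu; ⟨f, h⟩

lemma resolvent_injective : Function.Injective (A.resolvent hε hlam) := by
  refine (injective_iff_map_eq_zero _).2 fun f hf => ?_
  have hzero : A.weakSolution hε hlam f = 0 := ext (hf.trans (map_zero incl).symm)
  have hweight : linftyMul 2 (A.expV (-2)) f = 0 :=
    ((M.shift 2).dense_domPow 1).eq_zero_of_inner_left (𝕜 := ℝ) fun v hv => by
      obtain ⟨v', hvv', -⟩ := mem_domPow_succ.1 hv
      rw [← innerPi_eq, ← incl_toGraph hvv', ← A.form_weakSolution hε hlam, hzero, map_zero,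
        _root_.zero_apply]
  rw [← A.linftyMul_expV_cancel (r := 2) (s := -2) (by norm_num) f, hweight, map_zero]

lemma resolvent_eq_resolvent_add (f : M.L2) :
    A.resolvent hε hlam f =
      A.resolvent hε hlam' (f + (lam' - lam) • A.resolvent hε hlam f) := by
  refine A.eq_resolvent hε hlam' (u := A.weakSolution hε hlam f) fun v => ?_
  rw [form_eq_add _ _ _ lam, form_weakSolution]
  simp only [innerPi_eq, map_add, map_smul, inner_add_left, real_inner_smul_left]
  rfl

lemma mul_innerPi_resolvent_le (f : M.L2) :
    lam * A.innerPi (A.resolvent hε hlam f) (A.resolvent hε hlam f) ≤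
      A.innerPi f (A.resolvent hε hlam f) := by
  have hform := A.form_weakSolution hε hlam f (A.weakSolution hε hlam f)
  have hBd := A.Bd_self_nonneg (A.weakSolution hε hlam f)
  have hBj := mul_nonneg (Real.rpow_nonneg hε.le (2 - A.α))
    (A.Bj_self_nonneg (A.weakSolution hε hlam f))
  rw [form_zero_apply, B] at hform
  rw [resolvent, ContinuousLinearMap.comp_apply]
  linarith

lemma resolvent_nonneg {f : M.L2} (hf : 0 ≤ f) : 0 ≤ A.resolvent hε hlam f := by
  obtain ⟨κ, hκ, hcoercive⟩ := A.exists_coercive_form hε hlam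
  obtain ⟨w, hw⟩ := exists_incl_eq_abs (A.weakSolution hε hlam f)
  have hpos : 0 ≤ A.form ε lam 0 (A.weakSolution hε hlam f) (w - A.weakSolution hε hlam f) := by
    rw [form_weakSolution, map_sub, hw]
    exact A.innerPi_nonneg hf (sub_nonneg.2 (le_abs_self _))
  have hwu : w = A.weakSolution hε hlam f := eq_of_coercive_of_apply_self_le hκ hcoercive
    A.form_comm (A.form_abs_le hε hw) hpos
  rw [resolvent, ContinuousLinearMap.comp_apply, ← hwu, hw]
  exact abs_nonneg _

lemma resolvent_const (c : ℝ) :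
    A.resolvent hε hlam (Lp.const 2 M.μ c) = lam⁻¹ • Lp.const 2 M.μ c := by
  rw [eq_inv_smul_iff₀ hlam.ne', ← map_smul]
  refine (A.eq_resolvent hε hlam (u := (hasGen_const M c).toGraph) fun v => ?_).symm
  rw [form_const]
  simp only [innerPi_eq, map_smul, real_inner_smul_left]

end Resolvent

end Coefficients

section UniformlyBounded

variable {E F ι : Type*} [NormedAddCommGroup E] [NormedSpace ℝ E] [NormedAddCommGroup F]
  [NormedSpace ℝ F] {S : ι → E →L[ℝ] F} {C : ℝ} {s : Set E}

lemma tendsto_of_dense_of_bound {l : Filter ι} {S₀ : E →L[ℝ] F} (hS : ∀ i x, ‖S i x‖ ≤ C * ‖x‖)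
    (hs : Dense s) (h : ∀ x ∈ s, Tendsto (fun i => S i x) l (𝓝 (S₀ x))) (x : E) :
    Tendsto (fun i => S i x) l (𝓝 (S₀ x)) := by
  have hequi : Equicontinuous ((↑) ∘ S : ι → E → F) :=
    (show (∃ C, ∀ i x, ‖S i x‖ ≤ C * ‖x‖) ↔ Equicontinuous ((↑) ∘ S : ι → E → F) from
      (NormedSpace.equicontinuous_TFAE S).out 3 1).1 ⟨C, hS⟩
  exact (hequi x).tendsto_of_mem_closure S₀.continuous.continuousWithinAt h (hs x)

lemma cauchySeq_of_dense_of_bound [Nonempty ι] [SemilatticeSup ι]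
    (hS : ∀ i x, ‖S i x‖ ≤ C * ‖x‖) (hs : Dense s) (h : ∀ x ∈ s, CauchySeq fun i => S i x)
    (x : E) : CauchySeq fun i => S i x := by
  refine Metric.cauchySeq_iff'.2 fun ε hε => ?_
  have hC : 0 < |C| + 1 := by positivity
  obtain ⟨y, hy, hxy⟩ := Metric.mem_closure_iff.1 (hs x) (ε / 3 / (|C| + 1)) (by positivity)
  obtain ⟨N, hN⟩ := Metric.cauchySeq_iff'.1 (h y hy) (ε / 3) (by positivity)
  have hclose : ∀ i, dist (S i x) (S i y) < ε / 3 := fun i => by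
    calc dist (S i x) (S i y) = ‖S i (x - y)‖ := by rw [dist_eq_norm, map_sub]
      _ ≤ C * ‖x - y‖ := hS i _
      _ ≤ (|C| + 1) * dist x y := by
        rw [dist_eq_norm]; gcongr; linarith [le_abs_self C]
      _ < ε / 3 := by rwa [lt_div_iff₀' hC] at hxy
  refine ⟨N, fun n hn => ?_⟩
  calc dist (S n x) (S N x) ≤ dist (S n x) (S n y) + dist (S n y) (S N y) + dist (S N y) (S N x) :=
        dist_triangle4 _ _ _ _
    _ < ε := by linarith [hclose n, hN n hn, dist_comm (S N y) (S N x) ▸ hclose N]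

end UniformlyBounded

/-- The resolvent `a ↦ (a - A)⁻¹`, `a > 0`, of a densely defined nonpositive self-adjoint
operator `A` on a real Hilbert space. -/
structure SymmetricResolvent (E : Type*) [NormedAddCommGroup E] [InnerProductSpace ℝ E] where
  toFun : {a : ℝ // 0 < a} → E →L[ℝ] E
  resolvent_eq : ∀ (a b : {a : ℝ // 0 < a}) (f : E),
    toFun a f = toFun b (f + ((b : ℝ) - a) • toFun a f)
  inner_left : ∀ a f g, inner ℝ (toFun a f) g = inner ℝ f (toFun a g)
  mul_inner_self_le : ∀ (a : {a : ℝ // 0 < a}) (f : E),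
    (a : ℝ) * inner ℝ (toFun a f) (toFun a f) ≤ inner ℝ f (toFun a f)
  denseRange : ∀ a, DenseRange (toFun a)

namespace SymmetricResolvent

variable {E : Type*} [NormedAddCommGroup E] [InnerProductSpace ℝ E]

instance : CoeFun (SymmetricResolvent E) fun _ => {a : ℝ // 0 < a} → E →L[ℝ] E := ⟨toFun⟩

variable {R : SymmetricResolvent E} {x y x' y' : E} {a b c : {a : ℝ // 0 < a}} {t : ℝ}

/-- The operator `A` with resolvent `R`, as a graph: `x ∈ Dom(A)` and `A x = y`. -/
def HasGen (R : SymmetricResolvent E) (x y : E) : Prop := R 1 (x - y) = x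

lemma apply_smul_sub_eq_of (h : R a ((a : ℝ) • x - y) = x) : R b ((b : ℝ) • x - y) = x := by
  have hab := R.resolvent_eq a b ((a : ℝ) • x - y)
  rw [h] at hab
  convert hab.symm using 2
  module

lemma hasGen_iff (a : {a : ℝ // 0 < a}) : R.HasGen x y ↔ R a ((a : ℝ) • x - y) = x := by
  have hone : R.HasGen x y ↔ R 1 (((1 : {a : ℝ // 0 < a}) : ℝ) • x - y) = x := by
    rw [HasGen, Positive.val_one, one_smul]
  exact hone.trans ⟨apply_smul_sub_eq_of, apply_smul_sub_eq_of⟩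

lemma hasGen_apply (R : SymmetricResolvent E) (a : {a : ℝ // 0 < a}) (f : E) :
    R.HasGen (R a f) ((a : ℝ) • R a f - f) :=
  (hasGen_iff a).2 (by rw [sub_sub_cancel])

lemma dense_hasGen (R : SymmetricResolvent E) : Dense {x | ∃ y, R.HasGen x y} :=
  (R.denseRange 1).mono (Set.range_subset_iff.2 fun f => ⟨_, R.hasGen_apply 1 f⟩)

lemma HasGen.inner_left (h : R.HasGen x y) (h' : R.HasGen x' y') :
    inner ℝ y x' = inner ℝ x y' := by
  have hsymm := R.inner_left 1 (x - y) (x' - y')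
  rw [h, h', inner_sub_left, inner_sub_right] at hsymm
  linarith

lemma HasGen.inner_nonpos (h : R.HasGen x y) : inner ℝ y x ≤ 0 := by
  have hpos := R.mul_inner_self_le 1 (x - y)
  rw [h, inner_sub_left, Positive.val_one, one_mul] at hpos
  linarith

lemma hasGen_of_inner {u w : E} (h : ∀ x y, R.HasGen x y → inner ℝ u y = inner ℝ w x) :
    R.HasGen u w := by
  refine ext_inner_right ℝ fun f => ?_
  have hf := h _ _ (R.hasGen_apply 1 f)
  rw [Positive.val_one, one_smul, inner_sub_right] at hf
  rw [R.inner_left, inner_sub_left]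
  linarith

lemma hasGen_iff_inner {u w : E} :
    R.HasGen u w ↔ ∀ x y, R.HasGen x y → inner ℝ u y = inner ℝ w x :=
  ⟨fun h _ _ h' => (h.inner_left h').symm, hasGen_of_inner⟩

lemma mul_norm_apply_le (R : SymmetricResolvent E) (a : {a : ℝ // 0 < a}) (f : E) :
    (a : ℝ) * ‖R a f‖ ≤ ‖f‖ := by
  have hpos := R.mul_inner_self_le a f
  rw [real_inner_self_eq_norm_sq] at hpos
  rcases (norm_nonneg (R a f)).eq_or_lt with hzero | hlt
  · rw [← hzero, mul_zero]; positivity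
  · refine le_of_mul_le_mul_right ?_ hlt
    nlinarith [real_inner_le_norm f (R a f)]

lemma apply_comm (a b : {a : ℝ // 0 < a}) (f : E) : R a (R b f) = R b (R a f) := by
  have hsub : ∀ c d : {a : ℝ // 0 < a}, R c f - R d f = ((d : ℝ) - c) • R d (R c f) := fun c d => by
    rw [sub_eq_iff_eq_add', ← map_smul, ← map_add, ← R.resolvent_eq]
  rcases eq_or_ne a b with rfl | hab
  · rfl
  · refine smul_right_injective E (sub_ne_zero.2 (Subtype.coe_ne_coe.2 hab)) ?_
    change ((a : ℝ) - b) • R a (R b f) = ((a : ℝ) - b) • R b (R a f)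
    rw [← hsub b a, ← neg_sub (b : ℝ) a, neg_smul, ← hsub a b, neg_sub]

/-- Yosida's approximation `a A (a - A)⁻¹ = a (a (a - A)⁻¹ - 1)` of `A`. -/
def yosida (R : SymmetricResolvent E) (a : {a : ℝ // 0 < a}) : E →L[ℝ] E :=
  (a : ℝ) • ((a : ℝ) • R a - 1)

lemma yosida_apply (a : {a : ℝ // 0 < a}) (x : E) :
    R.yosida a x = (a : ℝ) • ((a : ℝ) • R a x - x) := rfl

lemma HasGen.smul_apply_sub (h : R.HasGen x y) (a : {a : ℝ // 0 < a}) :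
    (a : ℝ) • R a x - x = R a y := by
  have hx := (hasGen_iff a).1 h
  rw [map_sub, map_smul] at hx
  rw [← sub_eq_zero, ← sub_eq_zero.2 hx]
  abel

lemma HasGen.yosida_eq (h : R.HasGen x y) (a : {a : ℝ // 0 < a}) :
    R.yosida a x = (a : ℝ) • R a y := by
  rw [yosida_apply, h.smul_apply_sub]

lemma norm_smul_apply_le (R : SymmetricResolvent E) (a : {a : ℝ // 0 < a}) (f : E) :
    ‖(a : ℝ) • R a f‖ ≤ ‖f‖ := by
  rw [norm_smul, Real.norm_of_nonneg a.2.le]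
  exact R.mul_norm_apply_le a f

lemma HasGen.norm_yosida_le (h : R.HasGen x y) (a : {a : ℝ // 0 < a}) :
    ‖R.yosida a x‖ ≤ ‖y‖ :=
  h.yosida_eq a ▸ R.norm_smul_apply_le a y

lemma tendsto_coe_atTop : Tendsto ((↑) : {a : ℝ // 0 < a} → ℝ) atTop atTop :=
  tendsto_comp_val_Ioi_atTop.2 tendsto_id

lemma tendsto_smul_apply (R : SymmetricResolvent E) (x : E) :
    Tendsto (fun a : {a : ℝ // 0 < a} => (a : ℝ) • R a x) atTop (𝓝 x) := by
  refine tendsto_of_dense_of_bound (S := fun a : {a : ℝ // 0 < a} => (a : ℝ) • R a)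
    (S₀ := 1) (C := 1) (fun a f => (R.norm_smul_apply_le a f).trans_eq (one_mul _).symm)
    R.dense_hasGen ?_ x
  rintro x ⟨y, h⟩
  change Tendsto (fun a : {a : ℝ // 0 < a} => (a : ℝ) • R a x) atTop (𝓝 x)
  rw [tendsto_iff_norm_sub_tendsto_zero]
  have hlim : Tendsto (fun a : {a : ℝ // 0 < a} => (a : ℝ)⁻¹ * ‖y‖) atTop (𝓝 0) := by
    simpa only [zero_mul, Pi.inv_apply] using tendsto_coe_atTop.inv_tendsto_atTop.mul_const ‖y‖
  refine squeeze_zero (fun _ => norm_nonneg _) (fun a => ?_) hlim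
  rw [h.smul_apply_sub, ← div_eq_inv_mul, le_div_iff₀' a.2]
  exact R.mul_norm_apply_le a y

lemma HasGen.tendsto_yosida (h : R.HasGen x y) :
    Tendsto (fun a => R.yosida a x) atTop (𝓝 y) := by
  simp_rw [h.yosida_eq]
  exact R.tendsto_smul_apply y

lemma inner_yosida_self_nonpos (a : {a : ℝ // 0 < a}) (x : E) : inner ℝ (R.yosida a x) x ≤ 0 := by
  rw [yosida_apply, real_inner_smul_left, inner_sub_left, real_inner_self_eq_norm_mul_norm]
  refine mul_nonpos_of_nonneg_of_nonpos a.2.le (sub_nonpos.2 ?_)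
  exact (real_inner_le_norm _ _).trans (by gcongr; exact R.norm_smul_apply_le a x)

lemma inner_yosida_left (a : {a : ℝ // 0 < a}) (x y : E) :
    inner ℝ (R.yosida a x) y = inner ℝ x (R.yosida a y) := by
  simp only [yosida_apply, real_inner_smul_left, real_inner_smul_right, inner_sub_left,
    inner_sub_right, R.inner_left]

lemma commute_apply (a b : {a : ℝ // 0 < a}) : Commute (R a) (R b) :=
  ContinuousLinearMap.ext (apply_comm a b)

lemma commute_apply_yosida (a b : {a : ℝ // 0 < a}) : Commute (R b) (R.yosida a) :=
  (((commute_apply b a).smul_right _).sub_right (Commute.one_right _)).smul_right _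

lemma commute_yosida (a b : {a : ℝ // 0 < a}) : Commute (R.yosida a) (R.yosida b) :=
  (((commute_apply_yosida b a).smul_left _).sub_left (Commute.one_left _)).smul_left _

end SymmetricResolvent

instance : (atTop : Filter {a : ℝ // 0 < a}).IsCountablyGenerated :=
  inferInstanceAs (atTop : Filter (Set.Ioi (0 : ℝ))).IsCountablyGenerated

lemma mul_le_sub_of_antitoneOn_deriv {φ ψ : ℝ → ℝ} {r t : ℝ}
    (hφ : ∀ s, 0 ≤ s → HasDerivWithinAt φ (-ψ s) (Set.Ici 0) s) (hψ : AntitoneOn ψ (Set.Ici 0))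
    (hr : 0 ≤ r) (hrt : r < t) : (t - r) * ψ t ≤ φ r - φ t := by
  obtain ⟨c, hc, hslope⟩ := exists_hasDerivAt_eq_slope φ (fun s => -ψ s) hrt
    (fun s hs => ((hφ s (hr.trans hs.1)).mono fun x hx => hr.trans hx.1).continuousWithinAt)
    (fun s hs => (hφ s (hr.trans hs.1.le)).hasDerivAt (Ici_mem_nhds (hr.trans_lt hs.1)))
  have hle : ψ t ≤ ψ c := hψ (hr.trans hc.1.le) (hr.trans hrt.le) hc.2.le
  have hpos : 0 < t - r := sub_pos.2 hrt
  rw [eq_div_iff hpos.ne'] at hslope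
  nlinarith

namespace SymmetricResolvent

variable {E : Type*} [NormedAddCommGroup E] [InnerProductSpace ℝ E]

/-- The semigroup `t ↦ exp(t A_a)` of Yosida's approximation `A_a`. -/
def yosidaSemigroup (R : SymmetricResolvent E) (a : {a : ℝ // 0 < a}) (t : ℝ) : E →L[ℝ] E :=
  NormedSpace.exp (t • R.yosida a)

variable {R : SymmetricResolvent E} {x y : E} {a b : {a : ℝ // 0 < a}} {s t : ℝ}

lemma yosidaSemigroup_zero (a : {a : ℝ // 0 < a}) : R.yosidaSemigroup a 0 = 1 := by
  rw [yosidaSemigroup, zero_smul, NormedSpace.exp_zero]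

lemma commute_yosidaSemigroup {S : E →L[ℝ] E} (h : Commute S (R.yosida a)) (t : ℝ) :
    Commute S (R.yosidaSemigroup a t) :=
  (h.smul_right t).exp_right

variable [CompleteSpace E]

lemma yosidaSemigroup_add (a : {a : ℝ // 0 < a}) (s t : ℝ) :
    R.yosidaSemigroup a (s + t) = R.yosidaSemigroup a s * R.yosidaSemigroup a t := by
  let : NormedAlgebra ℚ (E →L[ℝ] E) := NormedAlgebra.restrictScalars ℚ ℝ _
  rw [yosidaSemigroup, add_smul]
  exact NormedSpace.exp_add_of_commute (((Commute.refl _).smul_left s).smul_right t)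

lemma inner_yosidaSemigroup_left (a : {a : ℝ // 0 < a}) (t : ℝ) (x y : E) :
    inner ℝ (R.yosidaSemigroup a t x) y = inner ℝ x (R.yosidaSemigroup a t y) := by
  have hself : IsSelfAdjoint (t • R.yosida a) :=
    by
    refine ContinuousLinearMap.isSelfAdjoint_iff_isSymmetric.2 fun x y => ?_
    change inner ℝ (t • R.yosida a x) y = inner ℝ x (t • R.yosida a y)
    rw [real_inner_smul_left, real_inner_smul_right, inner_yosida_left]
  exact ContinuousLinearMap.isSelfAdjoint_iff_isSymmetric.1 hself.exp x y

lemma hasDerivAt_yosidaSemigroup (a : {a : ℝ // 0 < a}) (t : ℝ) (x : E) :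
    HasDerivAt (fun s => R.yosidaSemigroup a s x) (R.yosidaSemigroup a t (R.yosida a x)) t := by
  simpa only [yosidaSemigroup, map_zero, add_zero, mul_apply_eq_comp] using
    (hasDerivAt_exp_smul_const (R.yosida a) t).clm_apply (hasDerivAt_const t x)

lemma continuous_yosidaSemigroup (a : {a : ℝ // 0 < a}) (x : E) :
    Continuous fun t => R.yosidaSemigroup a t x :=
  continuous_iff_continuousAt.2 fun t => (hasDerivAt_yosidaSemigroup a t x).continuousAt

lemma norm_yosidaSemigroup_le (ht : 0 ≤ t) (x : E) : ‖R.yosidaSemigroup a t x‖ ≤ ‖x‖ := by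
  have hderiv : ∀ s, HasDerivAt (fun s => ‖R.yosidaSemigroup a s x‖ ^ 2)
      (2 * inner ℝ (R.yosidaSemigroup a s x) (R.yosidaSemigroup a s (R.yosida a x))) s :=
    fun s => (hasDerivAt_yosidaSemigroup a s x).norm_sq
  have hanti : Antitone fun s => ‖R.yosidaSemigroup a s x‖ ^ 2 := by
    refine antitone_of_deriv_nonpos (fun s => (hderiv s).differentiableAt) fun s => ?_
    have hcomm := DFunLike.congr_fun (commute_yosidaSemigroup (.refl (R.yosida a)) s) x
    rw [mul_apply_eq_comp, mul_apply_eq_comp] at hcomm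
    rw [(hderiv s).deriv, ← hcomm, real_inner_comm]
    linarith [R.inner_yosida_self_nonpos a (R.yosidaSemigroup a s x)]
  refine le_of_sq_le_sq ?_ (norm_nonneg x)
  simpa only [yosidaSemigroup_zero, one_apply_eq_self] using hanti ht

lemma norm_yosidaSemigroup_sub_le (a b : {a : ℝ // 0 < a}) (ht : 0 ≤ t) (x : E) :
    ‖R.yosidaSemigroup a t x - R.yosidaSemigroup b t x‖ ≤ t * ‖R.yosida a x - R.yosida b x‖ := by
  have hderiv : ∀ s, HasDerivAt
      (fun s => R.yosidaSemigroup a s (R.yosidaSemigroup b (t - s) x))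
      (R.yosidaSemigroup a s (R.yosidaSemigroup b (t - s) (R.yosida a x - R.yosida b x))) s := by
    intro s
    have hcomm : R.yosidaSemigroup b (t - s) (R.yosida a x) =
        R.yosida a (R.yosidaSemigroup b (t - s) x) :=
      (DFunLike.congr_fun (commute_yosidaSemigroup (commute_yosida a b) (t - s)) x).symm
    have hb : HasDerivAt (fun s => R.yosidaSemigroup b (t - s) x)
        (-R.yosidaSemigroup b (t - s) (R.yosida b x)) s :=
      (hasDerivAt_yosidaSemigroup b (t - s) x).comp_const_sub t s
    refine ((hasDerivAt_exp_smul_const (R.yosida a) s).clm_apply hb).congr_deriv ?_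
    rw [map_sub (R.yosidaSemigroup b (t - s)), map_sub (R.yosidaSemigroup a s), hcomm, map_neg]
    exact (sub_eq_add_neg _ _).symm
  have hmean := (convex_Icc 0 t).norm_image_sub_le_of_norm_hasDerivWithin_le
    (fun s _ => (hderiv s).hasDerivWithinAt) (fun s hs => (norm_yosidaSemigroup_le hs.1 _).trans
      (norm_yosidaSemigroup_le (sub_nonneg.2 hs.2) _))
    (Set.left_mem_Icc.2 ht) (Set.right_mem_Icc.2 ht)
  rwa [sub_self, yosidaSemigroup_zero, yosidaSemigroup_zero, sub_zero, Real.norm_of_nonneg ht,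
    mul_comm] at hmean

lemma HasGen.norm_yosidaSemigroup_sub_le (h : R.HasGen x y) (hs : 0 ≤ s) (ht : 0 ≤ t) :
    ‖R.yosidaSemigroup a t x - R.yosidaSemigroup a s x‖ ≤ ‖y‖ * ‖t - s‖ :=
  (convex_Ici 0).norm_image_sub_le_of_norm_hasDerivWithin_le
    (fun r _ => (hasDerivAt_yosidaSemigroup a r x).hasDerivWithinAt)
    (fun _ hr => (norm_yosidaSemigroup_le hr _).trans (h.norm_yosida_le a)) hs ht

lemma exists_tendsto_yosidaSemigroup (R : SymmetricResolvent E) (t : ℝ) (x : E) :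
    ∃ y, Tendsto (fun a => R.yosidaSemigroup a |t| x) atTop (𝓝 y) := by
  refine cauchySeq_tendsto_of_complete (cauchySeq_of_dense_of_bound (C := 1)
    (fun a x => (norm_yosidaSemigroup_le (abs_nonneg t) x).trans_eq (one_mul _).symm)
    R.dense_hasGen ?_ x)
  rintro x ⟨y, h⟩
  have hcauchy := Metric.cauchySeq_iff'.1 h.tendsto_yosida.cauchySeq
  refine Metric.cauchySeq_iff'.2 fun δ hδ => ?_
  obtain ⟨N, hN⟩ := hcauchy (δ / (|t| + 1)) (by positivity)
  refine ⟨N, fun n hn => ?_⟩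
  have hlt := hN n hn
  rw [lt_div_iff₀' (by positivity), dist_eq_norm] at hlt
  rw [dist_eq_norm]
  refine (norm_yosidaSemigroup_sub_le n N (abs_nonneg t) x).trans_lt (lt_of_le_of_lt ?_ hlt)
  gcongr
  linarith

/-- The semigroup `t ↦ exp(t A)` of the operator `A` with resolvent `R`, the limit of the
semigroups of its Yosida approximations, extended evenly to `t < 0`. -/
def semigroup (R : SymmetricResolvent E) (t : ℝ) : E →L[ℝ] E :=
  continuousLinearMapOfTendsto (fun a => R.yosidaSemigroup a |t|)
    (tendsto_pi_nhds.2 fun x => (R.exists_tendsto_yosidaSemigroup t x).choose_spec)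

lemma tendsto_yosidaSemigroup (R : SymmetricResolvent E) (t : ℝ) (x : E) :
    Tendsto (fun a => R.yosidaSemigroup a |t| x) atTop (𝓝 (R.semigroup t x)) :=
  (R.exists_tendsto_yosidaSemigroup t x).choose_spec

lemma tendsto_yosidaSemigroup_of_nonneg (R : SymmetricResolvent E) (ht : 0 ≤ t) (x : E) :
    Tendsto (fun a => R.yosidaSemigroup a t x) atTop (𝓝 (R.semigroup t x)) := by
  simpa only [abs_of_nonneg ht] using R.tendsto_yosidaSemigroup t x

lemma tendsto_yosidaSemigroup_of_tendsto (ht : 0 ≤ t) {u : {a : ℝ // 0 < a} → E}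
    (hu : Tendsto u atTop (𝓝 x)) :
    Tendsto (fun a => R.yosidaSemigroup a t (u a)) atTop (𝓝 (R.semigroup t x)) := by
  have hzero : Tendsto (fun a => R.yosidaSemigroup a t (u a - x)) atTop (𝓝 0) :=
    squeeze_zero_norm (fun a => norm_yosidaSemigroup_le ht _)
      (tendsto_iff_norm_sub_tendsto_zero.1 hu)
  simpa using hzero.add (R.tendsto_yosidaSemigroup_of_nonneg ht x)

lemma norm_semigroup_le (R : SymmetricResolvent E) (t : ℝ) (x : E) : ‖R.semigroup t x‖ ≤ ‖x‖ :=
  le_of_tendsto (R.tendsto_yosidaSemigroup t x).norm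
    (.of_forall fun _ => norm_yosidaSemigroup_le (abs_nonneg t) x)

lemma semigroup_zero (R : SymmetricResolvent E) (x : E) : R.semigroup 0 x = x := by
  refine tendsto_nhds_unique (R.tendsto_yosidaSemigroup_of_nonneg le_rfl x) ?_
  simpa only [yosidaSemigroup_zero, one_apply_eq_self] using tendsto_const_nhds

lemma semigroup_add (R : SymmetricResolvent E) (hs : 0 ≤ s) (ht : 0 ≤ t) (x : E) :
    R.semigroup (s + t) x = R.semigroup s (R.semigroup t x) := by
  refine tendsto_nhds_unique (R.tendsto_yosidaSemigroup_of_nonneg (add_nonneg hs ht) x) ?_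
  simpa only [yosidaSemigroup_add, mul_apply_eq_comp] using
    tendsto_yosidaSemigroup_of_tendsto hs (R.tendsto_yosidaSemigroup_of_nonneg ht x)

lemma semigroup_apply_comm (R : SymmetricResolvent E) (t : ℝ) (b : {a : ℝ // 0 < a}) (x : E) :
    R.semigroup t (R b x) = R b (R.semigroup t x) := by
  refine tendsto_nhds_unique (R.tendsto_yosidaSemigroup t (R b x)) ?_
  refine (((R b).continuous.tendsto _).comp (R.tendsto_yosidaSemigroup t x)).congr fun a => ?_
  exact DFunLike.congr_fun (commute_yosidaSemigroup (commute_apply_yosida a b) |t|) x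

lemma HasGen.semigroup (h : R.HasGen x y) (t : ℝ) :
    R.HasGen (R.semigroup t x) (R.semigroup t y) := by
  rw [HasGen, ← map_sub, ← semigroup_apply_comm, h]

lemma inner_semigroup_left (R : SymmetricResolvent E) (t : ℝ) (x y : E) :
    inner ℝ (R.semigroup t x) y = inner ℝ x (R.semigroup t y) := by
  refine tendsto_nhds_unique ((R.tendsto_yosidaSemigroup t x).inner tendsto_const_nhds) ?_
  simp only [inner_yosidaSemigroup_left]
  exact tendsto_const_nhds.inner (R.tendsto_yosidaSemigroup t y)

lemma HasGen.lipschitzWith_semigroup (h : R.HasGen x y) :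
    LipschitzWith ‖y‖₊ fun t => R.semigroup t x := by
  refine lipschitzWith_iff_norm_sub_le.2 fun t s => ?_
  refine le_of_tendsto ((R.tendsto_yosidaSemigroup t x).sub (R.tendsto_yosidaSemigroup s x)).norm
    (.of_forall fun a =>
      (h.norm_yosidaSemigroup_sub_le (abs_nonneg s) (abs_nonneg t)).trans ?_)
  rw [coe_nnnorm]
  gcongr
  exact abs_abs_sub_abs_le t s

lemma continuous_semigroup (R : SymmetricResolvent E) (x : E) :
    Continuous fun t => R.semigroup t x :=
  continuous_iff_continuousAt.2 fun t => tendsto_of_dense_of_bound (S := R.semigroup) (C := 1)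
    (fun s x => (R.norm_semigroup_le s x).trans_eq (one_mul _).symm) R.dense_hasGen
    (fun _ ⟨_, h⟩ => h.lipschitzWith_semigroup.continuous.tendsto t) x

lemma HasGen.semigroup_sub_eq_integral (h : R.HasGen x y) (ht : 0 ≤ t) :
    R.semigroup t x - x = ∫ s in (0 : ℝ)..t, R.semigroup s y := by
  have hyosida : ∀ a, R.yosidaSemigroup a t x - x =
      ∫ s in (0 : ℝ)..t, R.yosidaSemigroup a s (R.yosida a x) := fun a => by
    rw [intervalIntegral.integral_eq_sub_of_hasDerivAt
      (fun s _ => hasDerivAt_yosidaSemigroup a s x)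
      ((continuous_yosidaSemigroup a _).intervalIntegrable _ _), yosidaSemigroup_zero,
      one_apply_eq_self]
  have hlim := (R.tendsto_yosidaSemigroup_of_nonneg ht x).sub_const x
  simp only [hyosida] at hlim
  refine tendsto_nhds_unique hlim ?_
  refine intervalIntegral.tendsto_integral_filter_of_dominated_convergence (fun _ => ‖y‖)
    (.of_forall fun a => (continuous_yosidaSemigroup a _).aestronglyMeasurable)
    (.of_forall fun a => .of_forall fun s hs => ?_) intervalIntegrable_const
    (.of_forall fun s hs => ?_) <;> rw [Set.uIoc_of_le ht] at hs
  · exact (norm_yosidaSemigroup_le hs.1.le _).trans (h.norm_yosida_le a)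
  · exact tendsto_yosidaSemigroup_of_tendsto hs.1.le h.tendsto_yosida

lemma HasGen.hasDerivWithinAt_semigroup (h : R.HasGen x y) (ht : 0 ≤ t) :
    HasDerivWithinAt (fun s => R.semigroup s x) (R.semigroup t y) (Set.Ici 0) t := by
  have hcont := R.continuous_semigroup y
  have hint : HasDerivAt (fun t => ∫ s in (0 : ℝ)..t, R.semigroup s y) (R.semigroup t y) t :=
    intervalIntegral.integral_hasDerivAt_right (hcont.intervalIntegrable _ _)
      (hcont.stronglyMeasurableAtFilter _ _) hcont.continuousAt
  refine (hint.add_const x).hasDerivWithinAt.congr (fun s hs => ?_) ?_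
  · rw [← h.semigroup_sub_eq_integral hs, sub_add_cancel]
  · rw [← h.semigroup_sub_eq_integral ht, sub_add_cancel]

lemma HasGen.semigroup_eq_self (h : R.HasGen x 0) (t : ℝ) : R.semigroup t x = x := by
  have hconst := h.lipschitzWith_semigroup.dist_le_mul t 0
  rwa [nnnorm_zero, NNReal.coe_zero, zero_mul, dist_le_zero, semigroup_zero] at hconst

lemma HasGen.tendsto_slope (h : R.HasGen x y) :
    Tendsto (fun t : ℝ => t⁻¹ • (R.semigroup t x - x)) (𝓝[>] 0) (𝓝 y) := by
  have hderiv := (h.hasDerivWithinAt_semigroup le_rfl).mono Set.Ioi_subset_Ici_self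
  rw [hasDerivWithinAt_iff_tendsto_slope' Set.self_notMem_Ioi, semigroup_zero] at hderiv
  refine hderiv.congr fun t => ?_
  rw [slope_def_module, sub_zero, semigroup_zero]

lemma hasGen_iff_tendsto :
    R.HasGen x y ↔ Tendsto (fun t : ℝ => t⁻¹ • (R.semigroup t x - x)) (𝓝[>] 0) (𝓝 y) := by
  refine ⟨HasGen.tendsto_slope, fun h => hasGen_of_inner fun u w hu => ?_⟩
  refine tendsto_nhds_unique (tendsto_const_nhds.inner hu.tendsto_slope) ?_
  refine (h.inner tendsto_const_nhds).congr fun t => ?_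
  rw [real_inner_smul_left, real_inner_smul_right, inner_sub_left, inner_sub_right,
    inner_semigroup_left]

lemma yosidaSemigroup_eq_smul_exp (a : {a : ℝ // 0 < a}) (t : ℝ) :
    R.yosidaSemigroup a t = Real.exp (-(t * a)) • NormedSpace.exp ((t * a ^ 2 : ℝ) • R a) := by
  let : NormedAlgebra ℚ (E →L[ℝ] E) := NormedAlgebra.restrictScalars ℚ ℝ _
  have hsplit : t • R.yosida a =
      algebraMap ℝ (E →L[ℝ] E) (-(t * a)) + (t * a ^ 2 : ℝ) • R a := by
    rw [yosida, Algebra.algebraMap_eq_smul_one]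
    module
  rw [yosidaSemigroup, hsplit,
    NormedSpace.exp_add_of_commute (Algebra.commute_algebraMap_left _ _),
    ← NormedSpace.algebraMap_exp_comm, ← Real.exp_eq_exp_ℝ, Algebra.algebraMap_eq_smul_one,
    smul_mul_assoc, one_mul]

variable {K : ProperCone ℝ E}

lemma exp_mem_cone {S : E →L[ℝ] E} (hS : ∀ x ∈ K, S x ∈ K) (hx : x ∈ K) :
    NormedSpace.exp S x ∈ K := by
  have hpow : ∀ n, (S ^ n) x ∈ K := fun n => by
    induction n with
    | zero => exact hx
    | succ n ih => exact pow_succ' S n ▸ hS _ ih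
  have hsum := (NormedSpace.exp_series_hasSum_exp' (𝕂 := ℝ) S).mapL
    (ContinuousLinearMap.apply ℝ E x)
  refine K.isClosed.mem_of_tendsto hsum (.of_forall fun s => ?_)
  exact Submodule.sum_mem _ fun n _ => K.smul_mem (hpow n) (by positivity)

lemma semigroup_mem_cone (hK : ∀ a, ∀ x ∈ K, R a x ∈ K) (t : ℝ) (hx : x ∈ K) :
    R.semigroup t x ∈ K := by
  refine K.isClosed.mem_of_tendsto (R.tendsto_yosidaSemigroup t x) (.of_forall fun a => ?_)
  rw [yosidaSemigroup_eq_smul_exp]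
  exact K.smul_mem (exp_mem_cone (fun y hy => K.smul_mem (hK a y hy) (by positivity)) hx)
    (Real.exp_pos _).le

lemma inner_semigroup_half (R : SymmetricResolvent E) (ht : 0 ≤ t) (x y : E) :
    inner ℝ (R.semigroup t x) y = inner ℝ (R.semigroup (t / 2) x) (R.semigroup (t / 2) y) := by
  rw [← inner_semigroup_left, ← R.semigroup_add (by positivity) (by positivity), add_halves]

lemma antitoneOn_norm_semigroup_half (R : SymmetricResolvent E) (y : E) :
    AntitoneOn (fun s => ‖R.semigroup (s / 2) y‖ ^ 2) (Set.Ici 0) := by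
  intro r hr s _ hrs
  have hr₀ : 0 ≤ r / 2 := div_nonneg hr zero_le_two
  have hsplit : R.semigroup (s / 2) y = R.semigroup (s / 2 - r / 2) (R.semigroup (r / 2) y) := by
    rw [← R.semigroup_add (by linarith) hr₀, sub_add_cancel]
  simp only [hsplit]
  gcongr
  exact R.norm_semigroup_le _ _

lemma HasGen.inner_semigroup_nonpos (h : R.HasGen x y) (ht : 0 ≤ t) :
    inner ℝ (R.semigroup t y) x ≤ 0 :=
  (R.inner_semigroup_half ht y x).trans_le (h.semigroup _).inner_nonpos

lemma HasGen.hasDerivWithinAt_inner_semigroup (h : R.HasGen x y) (z : E) (ht : 0 ≤ t) :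
    HasDerivWithinAt (fun s => inner ℝ (R.semigroup s x) z) (inner ℝ (R.semigroup t y) z)
      (Set.Ici 0) t := by
  simpa using (h.hasDerivWithinAt_semigroup ht).inner ℝ (hasDerivWithinAt_const t _ z)

lemma HasGen.mul_norm_semigroup_le (h : R.HasGen x y) (ht : 0 < t) :
    t * ‖R.semigroup t y‖ ≤ ‖x‖ := by
  -- `⟨P_s x, x⟩` has derivative `-ψ(s) ≤ 0`, and `ψ` has derivative `-‖P_{s/2} A x‖²`, which is
  -- monotone; comparing the increments over `[0, t]` and `[t, 2t]` gives the estimate.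
  have hfirst : ∀ s, 0 ≤ s → HasDerivWithinAt (fun s => inner ℝ (R.semigroup s x) x)
      (-(-inner ℝ (R.semigroup s y) x)) (Set.Ici 0) s := fun s hs => by
    rw [neg_neg]
    exact h.hasDerivWithinAt_inner_semigroup x hs
  have hsecond : ∀ s, 0 ≤ s → HasDerivWithinAt (fun s => -inner ℝ (R.semigroup s y) x)
      (-‖R.semigroup (s / 2) y‖ ^ 2) (Set.Ici 0) s := fun s hs => by
    simp only [R.inner_semigroup_left _ y x, real_inner_comm _ y]
    rw [← real_inner_self_eq_norm_sq, ← R.inner_semigroup_half hs]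
    exact (h.hasDerivWithinAt_inner_semigroup y hs).fun_neg
  have hanti : AntitoneOn (fun s => -inner ℝ (R.semigroup s y) x) (Set.Ici 0) := by
    intro r hr s _ hrs
    rcases hrs.eq_or_lt with rfl | hlt
    · exact le_rfl
    have hincr := mul_le_sub_of_antitoneOn_deriv hsecond
      (R.antitoneOn_norm_semigroup_half y) hr hlt
    exact sub_nonneg.1 ((mul_nonneg (sub_nonneg.2 hrs) (sq_nonneg _)).trans hincr)
  have hincr₁ := mul_le_sub_of_antitoneOn_deriv hfirst hanti le_rfl ht
  have hincr₂ := mul_le_sub_of_antitoneOn_deriv hsecond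
    (R.antitoneOn_norm_semigroup_half y) ht.le (show t < 2 * t by linarith)
  rw [semigroup_zero, real_inner_self_eq_norm_sq, sub_zero, R.inner_semigroup_half ht.le x,
    real_inner_self_eq_norm_sq] at hincr₁
  rw [show 2 * t - t = t by ring, mul_div_cancel_left₀ t two_ne_zero] at hincr₂
  refine le_of_sq_le_sq ?_ (norm_nonneg x)
  nlinarith [h.inner_semigroup_nonpos (show 0 ≤ 2 * t by positivity),
    sq_nonneg ‖R.semigroup (t / 2) x‖]

lemma exists_hasGen_semigroup (R : SymmetricResolvent E) (ht : 0 < t) (f : E) :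
    ∃ g, R.HasGen (R.semigroup t f) g := by
  obtain ⟨g, hg⟩ := exists_inner_eq_of_bound (R 1).toLinearMap
    ((innerₛₗ ℝ (R.semigroup t f)).comp (R 1 - 1).toLinearMap) (‖f‖ * t⁻¹) fun z => by
      have hz := (R.hasGen_apply 1 z).mul_norm_semigroup_le ht
      change |inner ℝ (R.semigroup t f) (R 1 z - z)| ≤ ‖f‖ * t⁻¹ * ‖R 1 z‖
      rw [Positive.val_one, one_smul] at hz
      rw [inner_semigroup_left, mul_assoc, ← div_eq_inv_mul]
      refine (abs_real_inner_le_norm _ _).trans ?_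
      gcongr
      rwa [le_div_iff₀' ht]
  refine ⟨g, hasGen_of_inner fun x y h => ?_⟩
  have hxy : inner ℝ (R.semigroup t f) (R 1 (x - y) - (x - y)) = inner ℝ g (R 1 (x - y)) :=
    hg (x - y)
  rwa [h, sub_sub_cancel] at hxy

end SymmetricResolvent

section PositiveOperator

variable {Ω : Type*} [MeasurableSpace Ω] {μ : Measure Ω} [IsFiniteMeasure μ]
  {S : Lp ℝ 2 μ →L[ℝ] Lp ℝ 2 μ} {κ : ℝ}

lemma map_le_const_of_le_const (hpos : ∀ f, 0 ≤ f → 0 ≤ S f)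
    (hconst : ∀ c, S (Lp.const 2 μ c) = κ • Lp.const 2 μ c) {f : Lp ℝ 2 μ} {c : ℝ}
    (hf : f ≤ Lp.const 2 μ c) : S f ≤ Lp.const 2 μ (κ * c) := by
  have hdiff := hpos _ (sub_nonneg.2 hf)
  rw [map_sub, hconst, sub_nonneg] at hdiff
  exact hdiff.trans_eq ((Lp.constₗ 2 μ ℝ).map_smul κ c).symm

lemma map_mem_image_linftyToL2_closedBall (hκ : 0 ≤ κ) (hpos : ∀ f, 0 ≤ f → 0 ≤ S f)
    (hconst : ∀ c, S (Lp.const 2 μ c) = κ • Lp.const 2 μ c) {f : Lp ℝ 2 μ} {C : ℝ} (hC : 0 ≤ C)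
    (hf : f ∈ linftyToL2 '' Metric.closedBall 0 C) :
    S f ∈ linftyToL2 '' Metric.closedBall 0 (κ * C) := by
  rw [image_linftyToL2_closedBall hC] at hf
  rw [image_linftyToL2_closedBall (mul_nonneg hκ hC)]
  refine ⟨?_, map_le_const_of_le_const hpos hconst hf.2⟩
  have hneg := map_le_const_of_le_const hpos hconst (f := -f) (c := C)
    (by simpa only [map_neg, neg_neg] using neg_le_neg hf.1)
  rw [map_neg] at hneg ⊢
  exact neg_le.1 hneg

lemma linftyToL2_const (c : ℝ) : linftyToL2 (Lp.const ⊤ μ c) = Lp.const 2 μ c :=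
  Lp.ext <| (linftyToL2_coeFn _).trans <|
    (Lp.coeFn_const ⊤ μ c).trans (Lp.coeFn_const 2 μ c).symm

lemma exists_linfty_restriction (hκ : 0 ≤ κ)
    (hS : ∀ f : Lp ℝ ⊤ μ, S (linftyToL2 f) ∈ linftyToL2 '' Metric.closedBall 0 (κ * ‖f‖)) :
    ∃ Q : Lp ℝ ⊤ μ →L[ℝ] Lp ℝ ⊤ μ, (∀ f, linftyToL2 (Q f) = S (linftyToL2 f)) ∧ ‖Q‖ ≤ κ := by
  choose Q hQ_norm hQ using hS
  refine ⟨LinearMap.mkContinuous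
    { toFun := Q
      map_add' := fun f g => linftyToL2_injective (by simp only [map_add, hQ])
      map_smul' := fun c f => linftyToL2_injective (by simp only [map_smul, hQ, RingHom.id_apply]) }
    κ fun f => mem_closedBall_zero_iff.1 (hQ_norm f), hQ, LinearMap.mkContinuous_norm_le _ hκ _⟩

lemma exists_linfty_restriction_norm_eq [IsProbabilityMeasure μ] (hκ : 0 ≤ κ)
    (hpos : ∀ f, 0 ≤ f → 0 ≤ S f) (hconst : ∀ c, S (Lp.const 2 μ c) = κ • Lp.const 2 μ c) :
    ∃ Q : Lp ℝ ⊤ μ →L[ℝ] Lp ℝ ⊤ μ,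
      (∀ (f : Lp ℝ ⊤ μ) (g : Lp ℝ 2 μ), f =ᵐ[μ] g → Q f =ᵐ[μ] S g) ∧ ‖Q‖ = κ := by
  obtain ⟨Q, hQ, hQ_norm⟩ := exists_linfty_restriction hκ fun f =>
    map_mem_image_linftyToL2_closedBall hκ hpos hconst (norm_nonneg f)
      ⟨f, mem_closedBall_zero_iff.2 le_rfl, rfl⟩
  refine ⟨Q, fun f g hfg => ?_, hQ_norm.antisymm ?_⟩
  · have hf : linftyToL2 f = g := Lp.ext ((linftyToL2_coeFn f).trans hfg)
    exact (linftyToL2_coeFn (Q f)).symm.trans (by rw [hQ, hf])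
  · have hQ_one : Q (Lp.const ⊤ μ 1) = κ • Lp.const ⊤ μ 1 := linftyToL2_injective (by
      rw [hQ, map_smul, linftyToL2_const, hconst])
    have hone : ‖Lp.const ⊤ μ (1 : ℝ)‖ = 1 := by
      simp [Lp.norm_const (p := ⊤) (μ := μ) (c := (1 : ℝ)) ENNReal.top_ne_zero]
    simpa [hQ_one, norm_smul, hone, abs_of_nonneg hκ] using Q.le_opNorm (Lp.const ⊤ μ 1)

end PositiveOperator

namespace IsometryGroup

variable {E F : Type*} [NormedAddCommGroup E] [InnerProductSpace ℝ E] [CompleteSpace E]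
  [NormedAddCommGroup F] [NormedSpace ℝ F] [CompleteSpace F]
  {U : IsometryGroup E} [U.StronglyContinuous]

lemma exists_generator_comp {S : F →L[ℝ] E} (hS : ∀ f, ∃ g, U.HasGen (S f) g) :
    ∃ S' : F →L[ℝ] E, ∀ f, U.HasGen (S f) (S' f) := by
  choose S' hS' using hS
  let S'_lin : F →ₗ[ℝ] E :=
    { toFun := S'
      map_add' := fun f g => (hS' (f + g)).unique (map_add S f g ▸ (hS' f).add (hS' g))
      map_smul' := fun c f => (hS' (c • f)).unique (map_smul S c f ▸ (hS' f).const_smul c) }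
  refine ⟨ContinuousLinearMap.ofSeqClosedGraph (g := S'_lin) fun f x y hx hy => ?_, hS'⟩
  have hlim : U.HasGen (S x) y := U.isClosed_genGraph.mem_of_tendsto
    (((S.continuous.tendsto x).comp hx).prodMk_nhds hy) (Eventually.of_forall fun n => hS' (f n))
  exact hlim.unique (hS' x)

lemma exists_iterate_generator_comp {k : ℕ} {S : F →L[ℝ] E} (hS : ∀ f, S f ∈ U.domPow k) :
    ∃ S' : F →L[ℝ] E, ∀ f, U.generator^[k] (S f) = S' f := by
  induction k generalizing S with
  | zero => exact ⟨S, fun _ => rfl⟩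
  | succ k ih =>
    obtain ⟨S₁, hS₁⟩ := exists_generator_comp (S := S) fun f =>
      (mem_domPow_succ.1 (hS f)).imp fun _ => And.left
    obtain ⟨S', hS'⟩ := ih fun f => (hS₁ f).mem_domPow_of_succ (hS f)
    exact ⟨S', fun f => by rw [Function.iterate_succ_apply, (hS₁ f).generator_eq, hS']⟩

end IsometryGroup

instance posSMulMono_Lp {Ω : Type*} [MeasurableSpace Ω] {μ : Measure Ω} {p : ENNReal} :
    PosSMulMono ℝ (Lp ℝ p μ) where
  smul_le_smul_of_nonneg_left c hc f g hfg := by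
    rw [← Lp.coeFn_le] at hfg ⊢
    filter_upwards [Lp.coeFn_smul c f, Lp.coeFn_smul c g, hfg] with ω hf hg hω
    rw [hf, hg]
    exact smul_le_smul_of_nonneg_left hω hc

namespace Coefficients

open RandomMedium IsometryGroup

variable {Ω : Type*} [MeasurableSpace Ω] {M : RandomMedium Ω} (A : Coefficients M)

section Operator

variable {ε lam : ℝ} (hε : 0 < ε) (hlam : 0 < lam)

lemma G_eq_resolvent : A.G ε lam = A.resolvent hε hlam :=
  funext fun f => (A.resolvent_apply hε hlam f).symm

lemma isResolventSolution_iff_eq_G (hε : 0 < ε) (hlam : 0 < lam) (f u : M.L2) :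
    A.IsResolventSolution ε lam f u ↔ u = A.G ε lam f := by
  rw [A.G_eq_resolvent hε hlam, A.isResolventSolution_iff_eq_resolvent hε hlam]

lemma G_injective (hε : 0 < ε) (hlam : 0 < lam) : Function.Injective (A.G ε lam) :=
  A.G_eq_resolvent hε hlam ▸ A.resolvent_injective hε hlam

lemma G_mem_H (hε : 0 < ε) (hlam : 0 < lam) {m : ℕ} {f : M.L2} (hf : f ∈ M.H m) :
    A.G ε lam f ∈ M.H (m + 2) :=
  mem_H_iff.2 (A.G_eq_resolvent hε hlam ▸ A.resolvent_mem_domPow hε hlam (mem_H_iff.1 hf))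

lemma L_resolvent (f : M.L2) :
    A.L ε lam (A.resolvent hε hlam f) = lam • A.resolvent hε hlam f - f := by
  rw [L, A.G_eq_resolvent hε hlam, Function.leftInverse_invFun (A.resolvent_injective hε hlam)]

lemma mem_domL_and_L_eq_iff {u w : M.L2} :
    (u ∈ A.domL ε lam ∧ A.L ε lam u = w) ↔ A.resolvent hε hlam (lam • u - w) = u := by
  rw [domL, A.G_eq_resolvent hε hlam]
  constructor
  · rintro ⟨⟨f, rfl⟩, rfl⟩
    rw [L_resolvent, sub_sub_cancel]
  · intro h
    refine ⟨⟨_, h⟩, ?_⟩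
    rw [← h, L_resolvent, h, sub_sub_cancel]

lemma domL_eq_domPow (hε : 0 < ε) (hlam : 0 < lam) : A.domL ε lam = (M.shift 2).domPow 2 := by
  rw [domL, A.G_eq_resolvent hε hlam, range_resolvent]

lemma dense_domL (hε : 0 < ε) (hlam : 0 < lam) : Dense (A.domL ε lam) :=
  A.domL_eq_domPow hε hlam ▸ (M.shift 2).dense_domPow 2

lemma resolvent_smul_sub_L {u : M.L2} (hu : u ∈ (M.shift 2).domPow 2) :
    A.resolvent hε hlam (lam • u - A.L ε lam u) = u :=
  (A.mem_domL_and_L_eq_iff hε hlam).1 ⟨(A.domL_eq_domPow hε hlam).symm ▸ hu, rfl⟩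

lemma L_mem_domPow (hε : 0 < ε) (hlam : 0 < lam) {m : ℕ} {u : M.L2}
    (hu : u ∈ (M.shift 2).domPow (m + 2)) :
    A.L ε lam u ∈ (M.shift 2).domPow m := by
  obtain ⟨f, hf, rfl⟩ := A.exists_resolvent_eq hε hlam hu
  rw [L_resolvent]
  exact Submodule.sub_mem _ (Submodule.smul_mem _ _ (domPow_antitone (by omega) hu)) hf

lemma mem_domPow_of_L_mem_domPow (hε : 0 < ε) (hlam : 0 < lam) {m : ℕ} {u : M.L2}
    (hu : u ∈ (M.shift 2).domPow 2) (hLu : A.L ε lam u ∈ (M.shift 2).domPow m) :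
    u ∈ (M.shift 2).domPow (m + 2) := by
  induction m with
  | zero => exact hu
  | succ m ih =>
    have hu_succ : u ∈ (M.shift 2).domPow (m + 1) :=
      domPow_succ_le _ (ih (domPow_succ_le _ hLu))
    rw [← A.resolvent_smul_sub_L hε hlam hu]
    exact A.resolvent_mem_domPow hε hlam
      (Submodule.sub_mem _ (Submodule.smul_mem _ _ hu_succ) hLu)

lemma powDomain_L (hε : 0 < ε) (hlam : 0 < lam) (m : ℕ) :
    powDomain (A.domL ε lam) (A.L ε lam) m = M.H (2 * m) := by
  induction m with
  | zero => rfl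
  | succ m ih =>
    ext u
    rw [mem_powDomain_succ_iff, ih, A.domL_eq_domPow hε hlam, mem_H_iff, mem_H_iff]
    exact ⟨fun h => A.mem_domPow_of_L_mem_domPow hε hlam h.1 h.2,
      fun h => ⟨domPow_antitone (by omega) h, A.L_mem_domPow hε hlam h⟩⟩

lemma L_resolvent_comm {u : M.L2} (hu : u ∈ (M.shift 2).domPow 2) :
    A.L ε lam (A.resolvent hε hlam u) = A.resolvent hε hlam (A.L ε lam u) := by
  conv_rhs => rw [← sub_sub_cancel (lam • u) (A.L ε lam u)]
  rw [L_resolvent, map_sub, map_smul, A.resolvent_smul_sub_L hε hlam hu]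

lemma resolvent_pow_mem_domPow (k : ℕ) {m : ℕ} {f : M.L2} (hf : f ∈ (M.shift 2).domPow m) :
    (A.resolvent hε hlam ^ k) f ∈ (M.shift 2).domPow (m + 2 * k) := by
  induction k with
  | zero => exact hf
  | succ k ih =>
    rw [pow_succ']
    exact A.resolvent_mem_domPow hε hlam ih

lemma exists_resolvent_pow_eq (k : ℕ) {m : ℕ} {u : M.L2}
    (hu : u ∈ (M.shift 2).domPow (m + 2 * k)) :
    ∃ f ∈ (M.shift 2).domPow m, (A.resolvent hε hlam ^ k) f = u := by
  induction k generalizing u with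
  | zero => exact ⟨u, hu, rfl⟩
  | succ k ih =>
    obtain ⟨g, hg, rfl⟩ := A.exists_resolvent_eq hε hlam hu
    obtain ⟨f, hf, rfl⟩ := ih hg
    exact ⟨f, hf, by rw [pow_succ']; rfl⟩

lemma L_resolvent_pow_comm (k : ℕ) {u : M.L2} (hu : u ∈ (M.shift 2).domPow 2) :
    A.L ε lam ((A.resolvent hε hlam ^ k) u) = (A.resolvent hε hlam ^ k) (A.L ε lam u) := by
  induction k with
  | zero => rfl
  | succ k ih =>
    have hmem : (A.resolvent hε hlam ^ k) u ∈ (M.shift 2).domPow 2 :=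
      domPow_antitone (by omega) (A.resolvent_pow_mem_domPow hε hlam k hu)
    rw [pow_succ', mul_apply_eq_comp, mul_apply_eq_comp, A.L_resolvent_comm hε hlam hmem, ih]

lemma L_mem_smooth (hε : 0 < ε) (hlam : 0 < lam) {u : M.L2}
    (hu : u ∈ (M.shift 2).smooth) : A.L ε lam u ∈ (M.shift 2).smooth :=
  mem_smooth.2 fun m => A.L_mem_domPow hε hlam (mem_smooth.1 hu (m + 2))

lemma iterate_L_mem_smooth (hε : 0 < ε) (hlam : 0 < lam) (n : ℕ) {u : M.L2}
    (hu : u ∈ (M.shift 2).smooth) : (A.L ε lam)^[n] u ∈ (M.shift 2).smooth :=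
  Set.MapsTo.iterate (fun _ => A.L_mem_smooth hε hlam) n hu

end Operator

section Weight

/-- Multiplication by `e^{-V}`, an isometry from `L²(Ω)` with the scalar product `(·, ·)_π` onto
`L²(Ω)` with its own scalar product. -/
def unweight : M.L2 ≃L[ℝ] M.L2 :=
  ContinuousLinearEquiv.equivOfInverse (linftyMul 2 (A.expV (-1))) (linftyMul 2 (A.expV 1))
    (A.linftyMul_expV_cancel (by norm_num)) (A.linftyMul_expV_cancel (by norm_num))

lemma inner_unweight (f g : M.L2) :
    inner ℝ (A.unweight f) (A.unweight g) = A.innerPi f g := by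
  change inner ℝ (linftyMul 2 (A.expV (-1)) f) (linftyMul 2 (A.expV (-1)) g) = _
  rw [← inner_linftyMul_left, linftyMul_expV_linftyMul_expV, innerPi_eq]
  norm_num

lemma norm_unweight (f : M.L2) : ‖A.unweight f‖ = A.normPi f := by
  rw [normPi, ← inner_unweight, real_inner_self_eq_norm_sq, Real.sqrt_sq (norm_nonneg _)]

lemma linftyMul_expV_nonneg (r : ℝ) {f : M.L2} (hf : 0 ≤ f) :
    0 ≤ linftyMul 2 (A.expV r) f := by
  rw [← Lp.coeFn_nonneg] at hf ⊢
  filter_upwards [linftyMul_coeFn (A.expV r) f, A.expV_coeFn r, hf] with ω hmul hexp hω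
  rw [hmul, hexp]
  exact mul_nonneg (Real.exp_pos _).le hω

lemma unweight_nonneg {f : M.L2} (hf : 0 ≤ f) : 0 ≤ A.unweight f :=
  A.linftyMul_expV_nonneg (-1) hf

lemma unweight_symm_nonneg {f : M.L2} (hf : 0 ≤ f) : 0 ≤ A.unweight.symm f :=
  A.linftyMul_expV_nonneg 1 hf

end Weight

section Semigroup

variable {ε lam : ℝ} (hε : 0 < ε)

/-- The resolvent `G_λ^ε` carried by `unweight` to `L²(Ω)` with its own scalar product, in which
it is symmetric. -/
def symmResolvent : SymmetricResolvent M.L2 where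
  toFun a := A.unweight ∘L A.resolvent hε a.2 ∘L A.unweight.symm
  resolvent_eq a b f := by
    obtain ⟨f, rfl⟩ := A.unweight.surjective f
    have h := A.resolvent_eq_resolvent_add hε a.2 b.2 f
    simpa using congrArg A.unweight h
  inner_left a f g := by
    obtain ⟨f, rfl⟩ := A.unweight.surjective f
    obtain ⟨g, rfl⟩ := A.unweight.surjective g
    simpa [inner_unweight] using A.innerPi_resolvent_left hε a.2 f g
  mul_inner_self_le a f := by
    obtain ⟨f, rfl⟩ := A.unweight.surjective f
    simpa only [ContinuousLinearMap.comp_apply, ContinuousLinearEquiv.coe_coe,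
      ContinuousLinearEquiv.symm_apply_apply, inner_unweight]
      using A.mul_innerPi_resolvent_le hε a.2 f
  denseRange a := by
    have hrange : DenseRange (A.resolvent hε a.2) := by
      rw [DenseRange, ← G_eq_resolvent]
      exact A.dense_domL hε a.2
    exact (A.unweight.surjective.denseRange.comp hrange A.unweight.continuous).comp
      A.unweight.symm.surjective.denseRange
        (A.unweight.continuous.comp (A.resolvent hε a.2).continuous)

lemma symmResolvent_unweight (a : {a : ℝ // 0 < a}) (f : M.L2) :
    A.symmResolvent hε a (A.unweight f) = A.unweight (A.resolvent hε a.2 f) :=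
  congrArg (fun g => A.unweight (A.resolvent hε a.2 g)) (A.unweight.symm_apply_apply f)

lemma hasGen_symmResolvent_iff (hlam : 0 < lam) {u w : M.L2} :
    (A.symmResolvent hε).HasGen (A.unweight u) (A.unweight w) ↔
      u ∈ A.domL ε lam ∧ A.L ε lam u = w := by
  rw [SymmetricResolvent.hasGen_iff ⟨lam, hlam⟩, ← map_smul, ← map_sub, symmResolvent_unweight,
    A.unweight.injective.eq_iff, ← mem_domL_and_L_eq_iff]

lemma mem_domL_and_L_eq_iff_innerPi {ε lam : ℝ} (hε : 0 < ε) (hlam : 0 < lam) (u w : M.L2) :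
    (u ∈ A.domL ε lam ∧ A.L ε lam u = w) ↔
      ∀ v ∈ A.domL ε lam, A.innerPi u (A.L ε lam v) = A.innerPi w v := by
  rw [← A.hasGen_symmResolvent_iff hε hlam, SymmetricResolvent.hasGen_iff_inner]
  constructor
  · intro h v hv
    simpa only [inner_unweight] using h _ _ ((A.hasGen_symmResolvent_iff hε hlam).2 ⟨hv, rfl⟩)
  · intro h x y hxy
    obtain ⟨v, rfl⟩ := A.unweight.surjective x
    obtain ⟨z, rfl⟩ := A.unweight.surjective y
    obtain ⟨hv, rfl⟩ := (A.hasGen_symmResolvent_iff hε hlam).1 hxy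
    simpa only [inner_unweight] using h v hv

/-- The semigroup `(P_t^ε)`, `t ≥ 0`. -/
def semigroup (t : ℝ) : M.L2 →L[ℝ] M.L2 :=
  A.unweight.symm ∘L (A.symmResolvent hε).semigroup t ∘L A.unweight

lemma semigroup_apply (t : ℝ) (f : M.L2) : A.semigroup hε t f =
    A.unweight.symm ((A.symmResolvent hε).semigroup t (A.unweight f)) := rfl

lemma unweight_semigroup (t : ℝ) (f : M.L2) :
    A.unweight (A.semigroup hε t f) = (A.symmResolvent hε).semigroup t (A.unweight f) :=
  A.unweight.apply_symm_apply _

lemma isSemigroup_semigroup : M.IsSemigroup (A.semigroup hε) where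
  zero f := by
    rw [semigroup_apply, SymmetricResolvent.semigroup_zero, A.unweight.symm_apply_apply]
  add s t hs ht f := by
    rw [semigroup_apply, semigroup_apply, unweight_semigroup,
      SymmetricResolvent.semigroup_add _ hs ht]
  continuousOn f := (A.unweight.symm.continuous.comp
    ((A.symmResolvent hε).continuous_semigroup (A.unweight f))).continuousOn

lemma normPi_semigroup_le (t : ℝ) (f : M.L2) : A.normPi (A.semigroup hε t f) ≤ A.normPi f := by
  rw [← norm_unweight, ← norm_unweight, unweight_semigroup]
  exact (A.symmResolvent hε).norm_semigroup_le t _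

lemma innerPi_semigroup_left (t : ℝ) (f g : M.L2) :
    A.innerPi (A.semigroup hε t f) g = A.innerPi f (A.semigroup hε t g) := by
  rw [← inner_unweight, ← inner_unweight, unweight_semigroup, unweight_semigroup,
    SymmetricResolvent.inner_semigroup_left]

lemma tendsto_semigroup_iff (hlam : 0 < lam) (u w : M.L2) :
    Tendsto (fun t : ℝ => t⁻¹ • (A.semigroup hε t u - u)) (𝓝[>] 0) (𝓝 w) ↔
      u ∈ A.domL ε lam ∧ A.L ε lam u = w := by
  rw [← A.hasGen_symmResolvent_iff hε hlam, SymmetricResolvent.hasGen_iff_tendsto,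
    A.unweight.toHomeomorph.isInducing.tendsto_nhds_iff]
  simp only [Function.comp_def, ContinuousLinearEquiv.coe_toHomeomorph, map_smul, map_sub,
    unweight_semigroup]

lemma semigroup_nonneg (t : ℝ) {f : M.L2} (hf : 0 ≤ f) : 0 ≤ A.semigroup hε t f := by
  refine A.unweight_symm_nonneg (ProperCone.mem_positive.1
    ((A.symmResolvent hε).semigroup_mem_cone (K := ProperCone.positive ℝ M.L2)
      (fun a x hx => ?_) t (ProperCone.mem_positive.2 (A.unweight_nonneg hf))))
  rw [ProperCone.mem_positive] at hx ⊢
  exact A.unweight_nonneg (A.resolvent_nonneg hε a.2 (A.unweight_symm_nonneg hx))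

lemma semigroup_const (t c : ℝ) : A.semigroup hε t (Lp.const 2 M.μ c) = Lp.const 2 M.μ c := by
  have hgen : (A.symmResolvent hε).HasGen (A.unweight (Lp.const 2 M.μ c)) (A.unweight 0) :=
    (A.hasGen_symmResolvent_iff hε one_pos).2 <| (A.mem_domL_and_L_eq_iff hε one_pos).2 (by
      rw [one_smul, sub_zero, resolvent_const, inv_one, one_smul])
  rw [map_zero] at hgen
  rw [semigroup_apply, hgen.semigroup_eq_self, A.unweight.symm_apply_apply]

lemma semigroup_mem_Icc (t : ℝ) {f : M.L2} (hf : ∀ᵐ ω ∂M.μ, 0 ≤ f ω ∧ f ω ≤ 1) :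
    ∀ᵐ ω ∂M.μ, 0 ≤ A.semigroup hε t f ω ∧ A.semigroup hε t f ω ≤ 1 := by
  have hf_nonneg : 0 ≤ f := (Lp.coeFn_nonneg f).1 (hf.mono fun _ => And.left)
  have hf_le : f ≤ Lp.const 2 M.μ 1 := (Lp.coeFn_le _ _).1 <| by
    filter_upwards [hf, Lp.coeFn_const 2 M.μ (1 : ℝ)] with ω hω hone
    exact hω.2.trans_eq hone.symm
  have hPf_le : A.semigroup hε t f ≤ Lp.const 2 M.μ (1 * 1) :=
    map_le_const_of_le_const (fun _ => A.semigroup_nonneg hε t)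
      (fun c => by rw [semigroup_const, one_smul]) hf_le
  filter_upwards [(Lp.coeFn_nonneg _).2 (A.semigroup_nonneg hε t hf_nonneg),
    (Lp.coeFn_le _ _).2 hPf_le, Lp.coeFn_const 2 M.μ (1 * 1 : ℝ)] with ω hnonneg hle hone
  exact ⟨hnonneg, hle.trans_eq (hone.trans (one_mul 1))⟩

end Semigroup

section Smoothing

variable {ε lam t : ℝ} (hε : 0 < ε)

lemma hasGen_unweight (hlam : 0 < lam) {u : M.L2} (hu : u ∈ (M.shift 2).domPow 2) :
    (A.symmResolvent hε).HasGen (A.unweight u) (A.unweight (A.L ε lam u)) :=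
  (A.hasGen_symmResolvent_iff hε hlam).2 ⟨(A.domL_eq_domPow hε hlam).symm ▸ hu, rfl⟩

lemma L_semigroup (hlam : 0 < lam) (t : ℝ) {u : M.L2} (hu : u ∈ (M.shift 2).domPow 2) :
    A.L ε lam (A.semigroup hε t u) = A.semigroup hε t (A.L ε lam u) := by
  have hgen := (A.hasGen_unweight hε hlam hu).semigroup t
  rw [← unweight_semigroup, ← unweight_semigroup] at hgen
  exact ((A.hasGen_symmResolvent_iff hε hlam).1 hgen).2

lemma hasDerivWithinAt_semigroup (hlam : 0 < lam) (ht : 0 ≤ t) {u : M.L2}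
    (hu : u ∈ (M.shift 2).domPow 2) :
    HasDerivWithinAt (fun s => A.semigroup hε s u) (A.semigroup hε t (A.L ε lam u))
      (Set.Ici 0) t :=
  A.unweight.symm.hasFDerivAt.comp_hasDerivWithinAt t
    ((A.hasGen_unweight hε hlam hu).hasDerivWithinAt_semigroup ht)

lemma semigroup_resolvent (hlam : 0 < lam) (t : ℝ) (f : M.L2) :
    A.semigroup hε t (A.resolvent hε hlam f) = A.resolvent hε hlam (A.semigroup hε t f) :=
  A.unweight.injective <| by
    rw [unweight_semigroup, ← A.symmResolvent_unweight hε ⟨lam, hlam⟩,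
      SymmetricResolvent.semigroup_apply_comm, ← unweight_semigroup, symmResolvent_unweight]

lemma semigroup_resolvent_pow (hlam : 0 < lam) (t : ℝ) (k : ℕ) (f : M.L2) :
    A.semigroup hε t ((A.resolvent hε hlam ^ k) f) =
      (A.resolvent hε hlam ^ k) (A.semigroup hε t f) :=
  have hcomm : Commute (A.semigroup hε t) (A.resolvent hε hlam) :=
    ContinuousLinearMap.ext (A.semigroup_resolvent hε hlam t)
  DFunLike.congr_fun (hcomm.pow_right k) f

lemma semigroup_mem_smooth (t : ℝ) {f : M.L2} (hf : f ∈ (M.shift 2).smooth) :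
    A.semigroup hε t f ∈ (M.shift 2).smooth := by
  refine mem_smooth.2 fun k => ?_
  obtain ⟨g, -, rfl⟩ := A.exists_resolvent_pow_eq hε one_pos k (m := 0)
    (mem_smooth.1 hf (0 + 2 * k))
  rw [semigroup_resolvent_pow]
  exact domPow_antitone (by omega) (A.resolvent_pow_mem_domPow hε one_pos k (mem_domPow_zero _))

lemma exists_resolvent_eq_semigroup (hlam : 0 < lam) (ht : 0 < t) (f : M.L2) :
    ∃ g, A.resolvent hε hlam g = A.semigroup hε t f := by
  obtain ⟨w, hgen⟩ := (A.symmResolvent hε).exists_hasGen_semigroup ht (A.unweight f)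
  obtain ⟨w, rfl⟩ := A.unweight.surjective w
  rw [← unweight_semigroup] at hgen
  exact ⟨_, (A.mem_domL_and_L_eq_iff hε hlam).1 ((A.hasGen_symmResolvent_iff hε hlam).1 hgen)⟩

lemma exists_resolvent_pow_eq_semigroup (hlam : 0 < lam) (k : ℕ) (ht : 0 < t) (f : M.L2) :
    ∃ g, (A.resolvent hε hlam ^ k) g = A.semigroup hε t f := by
  induction k generalizing t with
  | zero => exact ⟨_, rfl⟩
  | succ k ih =>
    obtain ⟨g, hg⟩ := ih (half_pos ht)
    obtain ⟨g', hg'⟩ := A.exists_resolvent_eq_semigroup hε hlam (half_pos ht) g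
    refine ⟨g', ?_⟩
    rw [pow_succ, mul_apply_eq_comp, hg', ← semigroup_resolvent_pow, hg,
      ← (A.isSemigroup_semigroup hε).add _ _ (half_pos ht).le (half_pos ht).le, add_halves]

lemma semigroup_mem_smooth_of_pos (ht : 0 < t) (f : M.L2) :
    A.semigroup hε t f ∈ (M.shift 2).smooth := by
  refine mem_smooth.2 fun k => ?_
  obtain ⟨g, hg⟩ := A.exists_resolvent_pow_eq_semigroup hε one_pos k ht f
  rw [← hg]
  exact domPow_antitone (by omega) (A.resolvent_pow_mem_domPow hε one_pos k (mem_domPow_zero _))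

lemma hasDerivWithinAt_iterate_D_semigroup (hlam : 0 < lam) (k : ℕ) (ht : 0 ≤ t) {f : M.L2}
    (hf : f ∈ (M.shift 2).smooth) :
    HasDerivWithinAt (fun s => M.D^[k] (A.semigroup hε s f))
      (M.D^[k] (A.semigroup hε t (A.L ε lam f))) (Set.Ici 0) t := by
  -- Writing `f = G^k g` turns `D^k P_s f` into `(D^k G^k) P_s g`, where `D^k G^k` is bounded.
  obtain ⟨S, hS⟩ := exists_iterate_generator_comp (U := M.shift 2) (k := k)
    (S := A.resolvent hε hlam ^ k) fun g => domPow_antitone (by omega)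
      (A.resolvent_pow_mem_domPow hε hlam k (mem_domPow_zero g))
  obtain ⟨g, hg, rfl⟩ := A.exists_resolvent_pow_eq hε hlam k (m := 2)
    (mem_smooth.1 hf (2 + 2 * k))
  have hD : ∀ s, M.D^[k] (A.semigroup hε s ((A.resolvent hε hlam ^ k) g)) =
      S (A.semigroup hε s g) := fun s => by
    rw [iterate_D_eq_iterate_generator (mem_Hinf_iff.2 (A.semigroup_mem_smooth hε s hf)),
      semigroup_resolvent_pow, hS]
  have hDL : M.D^[k] (A.semigroup hε t (A.L ε lam ((A.resolvent hε hlam ^ k) g))) =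
      S (A.semigroup hε t (A.L ε lam g)) := by
    rw [iterate_D_eq_iterate_generator (mem_Hinf_iff.2
      (A.semigroup_mem_smooth hε t (A.L_mem_smooth hε hlam hf))),
      A.L_resolvent_pow_comm hε hlam k hg, semigroup_resolvent_pow, hS]
  simp only [hD, hDL]
  exact S.hasFDerivAt.comp_hasDerivWithinAt t (A.hasDerivWithinAt_semigroup hε hlam ht hg)

lemma iterate_L_semigroup (hlam : 0 < lam) (t : ℝ) (n : ℕ) {f : M.L2}
    (hf : f ∈ (M.shift 2).smooth) :
    (A.L ε lam)^[n] (A.semigroup hε t f) = A.semigroup hε t ((A.L ε lam)^[n] f) := by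
  induction n with
  | zero => rfl
  | succ n ih =>
    rw [Function.iterate_succ_apply', Function.iterate_succ_apply', ih,
      A.L_semigroup hε hlam t (mem_smooth.1 (A.iterate_L_mem_smooth hε hlam n hf) 2)]

lemma smoothOn_Ici_semigroup {f : M.L2} (hf : f ∈ M.Hinf) :
    M.SmoothOn (Set.Ici 0) (fun t => A.semigroup hε t f) := by
  refine ⟨fun n t => A.semigroup hε t ((A.L ε 1)^[n] f), fun t _ => rfl, fun n t ht => ?_⟩
  have hn := A.iterate_L_mem_smooth hε one_pos n (mem_Hinf_iff.1 hf)
  refine ⟨mem_Hinf_iff.2 (A.semigroup_mem_smooth hε t hn), fun k => ?_⟩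
  simp only [Function.iterate_succ_apply']
  exact A.hasDerivWithinAt_iterate_D_semigroup hε one_pos k ht hn

lemma smoothOn_Ioi_semigroup (f : M.L2) :
    M.SmoothOn (Set.Ioi 0) (fun t => A.semigroup hε t f) := by
  refine ⟨fun n t => (A.L ε 1)^[n] (A.semigroup hε t f), fun t _ => rfl, fun n t ht => ?_⟩
  have ht : 0 < t := ht
  refine ⟨mem_Hinf_iff.2 (A.iterate_L_mem_smooth hε one_pos n
    (A.semigroup_mem_smooth_of_pos hε ht f)), fun k => ?_⟩
  have hg := A.semigroup_mem_smooth_of_pos hε (half_pos ht) f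
  set g := A.semigroup hε (t / 2) f with hg_def
  have hrestart : ∀ (n : ℕ) (s : ℝ), t / 2 ≤ s →
      (A.L ε 1)^[n] (A.semigroup hε s f) = A.semigroup hε (s - t / 2) ((A.L ε 1)^[n] g) := by
    intro n s hs
    rw [← A.iterate_L_semigroup hε one_pos _ n hg, hg_def,
      ← (A.isSemigroup_semigroup hε).add _ _ (sub_nonneg.2 hs) (half_pos ht).le, sub_add_cancel]
  have hderiv := (A.hasDerivWithinAt_iterate_D_semigroup hε one_pos k
    (sub_nonneg.2 (half_le_self ht.le)) (A.iterate_L_mem_smooth hε one_pos n hg)).hasDerivAt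
      (Ici_mem_nhds (sub_pos.2 (half_lt_self ht)))
  rw [← Function.iterate_succ_apply' (A.L ε 1), ← hrestart _ t (half_le_self ht.le)] at hderiv
  refine ((hderiv.comp_sub_const t (t / 2)).congr_of_eventuallyEq ?_).hasDerivWithinAt
  filter_upwards [Ioi_mem_nhds (half_lt_self ht)] with s hs
  rw [hrestart n s (le_of_lt hs)]

end Smoothing

end Coefficients

end

theorem proposition3p1 {Ω : Type*} [MeasurableSpace Ω] (M : RandomMedium Ω) (A : Coefficients M)
    (ε : ℝ) (hε : 0 < ε) :
    -- `G_λ^ε` is well defined by the weak resolvent equation, and one-to-one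
    (∀ lam : ℝ, 0 < lam →
      (∀ f u, A.IsResolventSolution ε lam f u ↔ u = A.G ε lam f) ∧
      Function.Injective (A.G ε lam)) ∧
    -- regularity of the resolvent and domains of the powers of `L^ε`
    (∀ lam : ℝ, 0 < lam →
      (∀ f, A.G ε lam f ∈ M.H 2) ∧
      (∀ m : ℕ, 1 ≤ m → ∀ f ∈ M.H m, A.G ε lam f ∈ M.H (m + 2)) ∧
      (∀ m : ℕ, powDomain (A.domL ε lam) (A.L ε lam) m = M.H (2 * m))) ∧
    -- `L^ε` is densely defined and equal to its adjoint for `(·, ·)_π`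
    (∀ lam : ℝ, 0 < lam →
      Dense (A.domL ε lam) ∧
      ∀ u w : M.L2, (u ∈ A.domL ε lam ∧ A.L ε lam u = w) ↔
        ∀ v ∈ A.domL ε lam, A.innerPi u (A.L ε lam v) = A.innerPi w v) ∧
    ∃ P : ℝ → M.L2 →L[ℝ] M.L2,
      -- strongly continuous contraction semigroup of self-adjoint operators
      M.IsSemigroup P ∧
      (∀ t, 0 ≤ t → ∀ f, A.normPi (P t f) ≤ A.normPi f) ∧
      (∀ t, 0 ≤ t → ∀ f g, A.innerPi (P t f) g = A.innerPi f (P t g)) ∧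
      -- its generator is `L^ε`
      (∀ lam : ℝ, 0 < lam → ∀ u w : M.L2,
        Tendsto (fun t : ℝ => t⁻¹ • (P t u - u)) (𝓝[>] 0) (𝓝 w) ↔
          u ∈ A.domL ε lam ∧ A.L ε lam u = w) ∧
      -- smoothness
      (∀ f : M.L2, ContinuousOn (fun t => P t f) (Set.Ici 0) ∧
        M.SmoothOn (Set.Ioi 0) (fun t => P t f)) ∧
      (∀ f ∈ M.Hinf, M.SmoothOn (Set.Ici 0) (fun t => P t f)) ∧
      -- sub-Markov property
      (∀ f : M.L2, (∀ᵐ ω ∂M.μ, 0 ≤ f ω ∧ f ω ≤ 1) →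
        ∀ t, 0 ≤ t → ∀ᵐ ω ∂M.μ, 0 ≤ (P t f) ω ∧ (P t f) ω ≤ 1) ∧
      -- action on `L^∞(Ω)`
      (∀ t, 0 ≤ t → ∃ Q : Lp ℝ ⊤ M.μ →L[ℝ] Lp ℝ ⊤ M.μ,
        (∀ (f : Lp ℝ ⊤ M.μ) (g : M.L2), f =ᵐ[M.μ] g → Q f =ᵐ[M.μ] P t g) ∧ ‖Q‖ = 1) ∧
      (∀ lam : ℝ, 0 < lam → ∃ R : Lp ℝ ⊤ M.μ →L[ℝ] Lp ℝ ⊤ M.μ,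
        (∀ (f : Lp ℝ ⊤ M.μ) (g : M.L2), f =ᵐ[M.μ] g → R f =ᵐ[M.μ] A.G ε lam g) ∧
          ‖R‖ = 1 / lam) := by
  refine ⟨fun lam hlam => ⟨A.isResolventSolution_iff_eq_G hε hlam, A.G_injective hε hlam⟩,
    fun lam hlam => ⟨fun f => A.G_mem_H hε hlam (Set.mem_univ f),
      fun m _ f hf => A.G_mem_H hε hlam hf, A.powDomain_L hε hlam⟩,
    fun lam hlam => ⟨A.dense_domL hε hlam, A.mem_domL_and_L_eq_iff_innerPi hε hlam⟩,
    A.semigroup hε, A.isSemigroup_semigroup hε,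
    fun t _ f => A.normPi_semigroup_le hε t f,
    fun t _ f g => A.innerPi_semigroup_left hε t f g,
    fun lam hlam u w => A.tendsto_semigroup_iff hε hlam u w,
    fun f => ⟨(A.isSemigroup_semigroup hε).continuousOn f, A.smoothOn_Ioi_semigroup hε f⟩,
    fun f hf => A.smoothOn_Ici_semigroup hε hf,
    fun f hf t _ => A.semigroup_mem_Icc hε t hf, fun t _ => ?_, fun lam hlam => ?_⟩
  · exact exists_linfty_restriction_norm_eq zero_le_one (fun f => A.semigroup_nonneg hε t)
      fun c => by rw [A.semigroup_const, one_smul]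
  · rw [one_div, A.G_eq_resolvent hε hlam]
    exact exists_linfty_restriction_norm_eq (inv_nonneg.2 hlam.le)
      (fun f => A.resolvent_nonneg hε hlam) (A.resolvent_const hε hlam)
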